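/- A ReLU network $f:\mathbb R^d\to\mathbb R$ of depth $L\ge1$ is a map $a_0=x$, $a_\ell=\sigma(W_\ell a_{\ell-1}+b_\ell)$ for $1\le\ell\le L-1$, $f(x)=W_La_{L-1}+b_L$, with $\sigma(t)=\max\{t,0\}$ applied coordinatewise, $W_\ell\in\mathbb R^{d_\ell\times d_{\ell-1}}$, $b_\ell\in\mathbb R^{d_\ell}$, $d_0=d$, $d_L=1$. Its width is $\max_{1\le\ell\le L}d_\ell$ and its number of parameters is $\sum_{\ell=1}^L(d_{\ell-1}+1)d_\ell$ (zero entries are counted). It has bit complexity $B$ if, for one number $c\le B$ of fractional bits, every entry of every $W_\ell$ and $b_\ell$ has the form $z/2^c$ with $z\in\mathbb Z$, $|z|<2^{B-1}$ (fixed-point precision). Let $\mathcal D=\{(x_i,y_i)\}_{i=1}^N$ with distinct $x_i\in\mathbb R^d$ and labels $y_i\in\{1,\dots,C\}$ that are not all equal. Put $\epsilon_{\mathcal D}=\frac12\min\{\|x_i-x_j\|_2: y_i\ne y_j\}$ and $R=\max_i\|x_i\|_2$. A function $f$ $\rho$-robustly memorizes $\mathcal D$ if $f(x')=y_i$ for all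 $i$ and all $x'$ in the open ball $\mathcal B_2(x_i,\rho\epsilon_{\mathcal D})$; its $\rho$-robust error is $\max_i\mathbb P_{x'\sim\mathrm{Unif}(\mathcal B_2(x_i,\rho\epsilon_{\mathcal D}))}[f(x')\ne y_i]$. For a real $t\ge0$ let $\Lambda(t)=\log\bigl(2+N+d+C+R+\epsilon_{\mathcal D}^{-1}+t\bigr)$. Theorem. There are universal constants $K>0$ and $k\in\mathbb N$ such that for all $d,N,C$, every such dataset $\mathcal D$ and every $\eta\in(0,1)$ the following hold. (i) If $0<\rho\le\frac1{5N\sqrt d}$, there is a ReLU network $f$ that $\rho$-robustly memorizes $\mathcal D$, with at most $K\Lambda^k(\sqrt N+d)$ parameters, depth at most $K\Lambda^k\sqrt N$, width at most $K\Lambda^k$ and bit complexity at most $K\Lambda^k\sqrt N$, where $\Lambda=\Lambda(0)$. (ii) If $\frac1{5N\sqrt d}<\rho\le\frac1{5\sqrt d}$, there is a ReLU network $f$ whose $\rho$-robust error on $\mathcal D$ is at most $\eta$, with at most $K\Lambda^k(Nd^{1/4}\rho^{1/2}+d)$ parameters, depth at most $K\Lambda^kNd^{1/4}\rho^{1/2}$,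 width at most $K\Lambda^k$ and bit complexity at most $K\Lambda^k\,d^{-1/4}\rho^{-1/2}$, where $\Lambda=\Lambda(1/\eta)$. (iii) If $\frac1{5\sqrt d}<\rho<1$, there is a ReLU network $f$ that $\rho$-robustly memorizes $\mathcal D$, with at most $K\Lambda^k(Nd^2\rho^4+d)$ parameters, depth at most $K\Lambda^kN$, width at most $K\Lambda^k\rho^2d$ and bit complexity at most $K\Lambda^kN$, where $\Lambda=\Lambda(1/(1-\rho))$. -/

import Mathlib

open MeasureTheory
open scoped ENNReal

/-- A fully connected feed-forward network with ReLU activation, with `m` inputs and `n` outputs: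
either a single affine (output) layer, or an affine layer to `k` hidden neurons followed by ReLU and
by a further network. -/
inductive ReLUNet : ℕ → ℕ → Type
  | output {m n : ℕ} (W : Matrix (Fin n) (Fin m) ℝ) (b : Fin n → ℝ) : ReLUNet m n
  | hidden {m k n : ℕ} (W : Matrix (Fin k) (Fin m) ℝ) (b : Fin k → ℝ)
      (rest : ReLUNet k n) : ReLUNet m n

namespace ReLUNet

/-- The vector-valued function computed by the network. -/
def eval {m n : ℕ} : ReLUNet m n → (Fin m → ℝ) → (Fin n → ℝ)
  | output W b, x => fun i => W.mulVec x i + b i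
  | hidden W b rest, x => rest.eval (fun i => max (W.mulVec x i + b i) 0)

/-- The real function on Euclidean space computed by a network with one output. -/
def toFun {d : ℕ} (f : ReLUNet d 1) (x : EuclideanSpace ℝ (Fin d)) : ℝ :=
  f.eval (fun i => x i) 0

/-- The number of layers, that is the number of hidden layers plus one. -/
def depth {m n : ℕ} : ReLUNet m n → ℕ
  | output _ _ => 1
  | hidden _ _ rest => rest.depth + 1

/-- The largest number of neurons in a layer; the input does not count as a layer. -/
def width {m n : ℕ} : ReLUNet m n → ℕ
  | output _ _ => n
  | hidden (k := k) _ _ rest => max k rest.width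

/-- The number of all parameters, zero or not: a layer from `m` to `k` neurons has `(m + 1) * k`
weights and biases. -/
def numParams {m n : ℕ} : ReLUNet m n → ℕ
  | output _ _ => (m + 1) * n
  | hidden (k := k) _ _ rest => (m + 1) * k + rest.numParams

/-- Every weight and every bias of the network satisfies `P`. -/
def AllParams (P : ℝ → Prop) {m n : ℕ} : ReLUNet m n → Prop
  | output W b => (∀ i j, P (W i j)) ∧ ∀ i, P (b i)
  | hidden W b rest => ((∀ i j, P (W i j)) ∧ ∀ i, P (b i)) ∧ rest.AllParams P

/-- The parameters of the network are stored with `B` bits each in fixed-point precision: there is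
one number `c ≤ B` of fractional bits for the whole network, and every parameter is `z / 2 ^ c`
for an integer `z` with `|z| < 2 ^ (B - 1)` (one of the `B` bits is the sign). -/
def HasBitComplexity {m n : ℕ} (f : ReLUNet m n) (B : ℕ) : Prop :=
  ∃ c : ℕ, c ≤ B ∧ f.AllParams fun p => ∃ z : ℤ, p = (z : ℝ) / 2 ^ c ∧ 2 * |z| < 2 ^ B

end ReLUNet

/-- A dataset of `N` distinct points of `ℝ ^ d` with labels in `{1, …, C}`. -/
structure Dataset (d N C : ℕ) where
  x : Fin N → EuclideanSpace ℝ (Fin d)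
  y : Fin N → ℕ
  x_injective : Function.Injective x
  y_mem : ∀ i, y i ∈ Finset.Icc 1 C

namespace Dataset

variable {d N C : ℕ}

/-- The separation constant: half of the smallest distance of two points with different labels. -/
noncomputable def sep (D : Dataset d N C) : ℝ :=
  (1 / 2) * sInf {r : ℝ | ∃ i j, D.y i ≠ D.y j ∧ r = ‖D.x i - D.x j‖}

/-- The largest Euclidean norm of a data point. -/
noncomputable def radius (D : Dataset d N C) : ℝ := ⨆ i, ‖D.x i‖

/-- The function `f` takes the right label on every open ball of radius `ρ * sep` around a data
point. -/
def RobustlyMemorizes (D : Dataset d N C) (ρ : ℝ) (f : EuclideanSpace ℝ (Fin d) → ℝ) : Prop :=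
  ∀ i, ∀ x' ∈ Metric.ball (D.x i) (ρ * D.sep), f x' = D.y i

/-- The robust error: the maximum over the data points of the probability that `f` takes a wrong
value at a uniformly random point of the open ball of radius `ρ * sep` around the data point. -/
noncomputable def robustError (D : Dataset d N C) (ρ : ℝ)
    (f : EuclideanSpace ℝ (Fin d) → ℝ) : ℝ≥0∞ :=
  ⨆ i, ProbabilityTheory.cond volume (Metric.ball (D.x i) (ρ * D.sep)) {x' | f x' ≠ D.y i}

/-- The logarithm whose powers are hidden by the soft-O notation. The argument `t` stands for
further quantities the notation may hide. -/
noncomputable def logFactor (D : Dataset d N C) (t : ℝ) : ℝ :=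
  Real.log (2 + N + d + C + D.radius + 1 / D.sep + t)

end Dataset

/-! A network of small width is treated as a machine with nonnegative registers (`Layer.run`): depth
is running time, and the parameters are both program and memory. If there are `w` registers, the
first layer costs about `d * w` parameters and every further layer about `w ^ 2`.

For `ρ ≤ 1 / (5 √d)` a point is seen through signed sums of its coordinates. Random signs keep half
of the squared norm with probability at least 1/12 (`card_blockSq_ge`, by second and fourth
moments), so logarithmically many fixed sign patterns separate all pairs with different labels
(`exists_signs`), while a signed sum varies over a ball by at most `√d * ρ * sep`. The integer parts
of the scaled sums on a shifted grid form a key that determines the label. ReLUs compute integer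
parts exactly except just below the integers. For a group of `M` points with `M * √d * ρ ≤ 1/5` some
shift keeps all balls of the group away from these places and, by averaging, is bad on the other
balls with tiny probability only (`exists_shift`). The keys and labels of a group are packed into
about `√M` numbers with `√M` entries each; choosing one number and decoding it takes about `√M`
layers up to logarithms (`run_lookup`). One group of all points gives (i). About `N / M` groups with
`M` near `1 / (5 √d ρ)` give (ii); there a ball can be cut by the grid of another group, which is
why an error probability remains.

For `ρ > 1 / (5 √d)` the network compares distances. The data span a space of dimension `n ≤ min N
d`. Adding signed coordinates in blocks maps it by a contraction to about `ρ ^ 2 * n` dimensions, up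
to logarithms, and shrinks the relevant distances by a factor `2 * ρ` at worst
(`exists_contraction`); if `ρ` is too large for this, no compression is needed. Balls do not grow,
so they stay away from the wrong centers. Squares are approximated by iterated tent maps, and the
centers are tested one after the other against a threshold (`run_ballPrograms`). The gap at the
threshold is polynomial in the sizes of the data, hence logarithmically many bits suffice. -/

set_option linter.unusedSectionVars false

/-! ### Dyadic numbers and affine forms. -/

/-- Numbers with `c` binary digits after the point. -/
def dyadics (c : ℕ) : AddSubgroup ℝ where
  carrier := {p | ∃ z : ℤ, p = (z : ℝ) / 2 ^ c}
  zero_mem' := ⟨0, by simp⟩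
  add_mem' := by
    rintro _ _ ⟨a, rfl⟩ ⟨b, rfl⟩
    exact ⟨a + b, by push_cast; ring⟩
  neg_mem' := by
    rintro _ ⟨a, rfl⟩
    exact ⟨-a, by push_cast; ring⟩

theorem intCast_mem_dyadics (c : ℕ) (z : ℤ) : (z : ℝ) ∈ dyadics c :=
  ⟨z * 2 ^ c, by push_cast; field_simp⟩

theorem natCast_mem_dyadics (c n : ℕ) : (n : ℝ) ∈ dyadics c := by
  exact_mod_cast intCast_mem_dyadics c n

theorem one_mem_dyadics (c : ℕ) : (1 : ℝ) ∈ dyadics c := by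
  exact_mod_cast intCast_mem_dyadics c 1

theorem two_pow_mem_dyadics (c n : ℕ) : (2 : ℝ) ^ n ∈ dyadics c := by
  exact_mod_cast natCast_mem_dyadics c (2 ^ n)

theorem int_div_two_pow_mem_dyadics {c e : ℕ} (h : e ≤ c) (z : ℤ) :
    (z : ℝ) / 2 ^ e ∈ dyadics c := by
  obtain ⟨k, rfl⟩ := Nat.exists_eq_add_of_le h
  refine ⟨z * 2 ^ k, ?_⟩
  push_cast
  rw [pow_add]
  field_simp

/-- An affine function of finitely many registers, given by its coefficients and its constant. -/
abbrev AffForm (ι : Type) : Type := (ι → ℝ) × ℝ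

namespace AffForm

variable {ι : Type} [Fintype ι] [DecidableEq ι]

/-- The value of an affine form. -/
def eval (f : AffForm ι) (σ : ι → ℝ) : ℝ := ∑ j, f.1 j * σ j + f.2

/-- The form that reads the register `i`. -/
def reg (i : ι) : AffForm ι := (Pi.single i 1, 0)

/-- A constant form. -/
def const (a : ℝ) : AffForm ι := (0, a)

@[simp] theorem eval_add (f g : AffForm ι) (σ : ι → ℝ) :
    eval (f + g) σ = eval f σ + eval g σ := by
  simp only [eval, Prod.fst_add, Pi.add_apply, add_mul, Finset.sum_add_distrib, Prod.snd_add]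
  ring

@[simp] theorem eval_smul (a : ℝ) (f : AffForm ι) (σ : ι → ℝ) :
    eval (a • f) σ = a * eval f σ := by
  simp only [eval, Prod.smul_fst, Pi.smul_apply, smul_eq_mul, Prod.smul_snd, mul_add,
    Finset.mul_sum, mul_assoc]

@[simp] theorem eval_neg (f : AffForm ι) (σ : ι → ℝ) : eval (-f) σ = -eval f σ := by
  rw [← neg_one_smul ℝ f, eval_smul]; ring

@[simp] theorem eval_sub (f g : AffForm ι) (σ : ι → ℝ) :
    eval (f - g) σ = eval f σ - eval g σ := by
  rw [sub_eq_add_neg, eval_add, eval_neg]; ring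

@[simp] theorem eval_sum {κ : Type} (s : Finset κ) (f : κ → AffForm ι) (σ : ι → ℝ) :
    eval (∑ k ∈ s, f k) σ = ∑ k ∈ s, eval (f k) σ := by
  classical
  induction s using Finset.induction_on with
  | empty => simp [eval]
  | insert a s ha ih => rw [Finset.sum_insert ha, Finset.sum_insert ha, eval_add, ih]

@[simp] theorem eval_reg (i : ι) (σ : ι → ℝ) : eval (reg i) σ = σ i := by
  simp [eval, reg, Pi.single_apply]

@[simp] theorem eval_const (a : ℝ) (σ : ι → ℝ) : eval (const a : AffForm ι) σ = a := by
  simp [eval, const]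

/-- All coefficients have `c` fractional bits and absolute value at most `H`. -/
def Fits (c : ℕ) (H : ℝ) (f : AffForm ι) : Prop :=
  (∀ j, f.1 j ∈ dyadics c ∧ |f.1 j| ≤ H) ∧ f.2 ∈ dyadics c ∧ |f.2| ≤ H

variable {c : ℕ} {H H' : ℝ} {f g : AffForm ι}

theorem Fits.mono (hf : Fits c H f) (h : H ≤ H') : Fits c H' f :=
  ⟨fun j => ⟨(hf.1 j).1, (hf.1 j).2.trans h⟩, hf.2.1, hf.2.2.trans h⟩

theorem Fits.add (hf : Fits c H f) (hg : Fits c H' g) : Fits c (H + H') (f + g) :=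
  ⟨fun j => ⟨add_mem (hf.1 j).1 (hg.1 j).1,
    (abs_add_le _ _).trans (add_le_add (hf.1 j).2 (hg.1 j).2)⟩,
    add_mem hf.2.1 hg.2.1, (abs_add_le _ _).trans (add_le_add hf.2.2 hg.2.2)⟩

theorem Fits.neg (hf : Fits c H f) : Fits c H (-f) :=
  ⟨fun j => ⟨neg_mem (hf.1 j).1, by simpa using (hf.1 j).2⟩,
    neg_mem hf.2.1, by simpa using hf.2.2⟩

theorem Fits.sub (hf : Fits c H f) (hg : Fits c H' g) : Fits c (H + H') (f - g) := by
  rw [sub_eq_add_neg]; exact hf.add hg.neg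

theorem fits_smul_reg {a : ℝ} (ha : a ∈ dyadics c) (i : ι) : Fits c |a| (a • reg i) := by
  refine ⟨fun j => ?_, by simp [reg]⟩
  by_cases h : j = i
  · subst h; simpa [reg] using ha
  · simp [reg, h]

theorem fits_reg (i : ι) : Fits c 1 (reg i) := by
  simpa using fits_smul_reg (one_mem_dyadics c) i

theorem fits_const {a : ℝ} (ha : a ∈ dyadics c) : Fits c |a| (const a : AffForm ι) :=
  ⟨fun j => by simp [const], by simpa [const] using ha⟩

theorem fits_sum {κ : Type} (s : Finset κ) {F : κ → AffForm ι} (h : ∀ k ∈ s, Fits c H (F k)) :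
    Fits c (s.card * H) (∑ k ∈ s, F k) := by
  classical
  induction s using Finset.induction_on with
  | empty => exact ⟨fun j => by simp, by simp⟩
  | insert a s ha ih =>
    rw [Finset.sum_insert ha, Finset.card_insert_of_notMem ha]
    refine ((h a (by simp)).add (ih fun k hk => h k (by simp [hk]))).mono (le_of_eq ?_)
    push_cast; ring

end AffForm

/-! ### Register programs. -/

/-- A layer of ReLU neurons on a fixed set of registers. -/
abbrev Layer (ι : Type) : Type := ι → AffForm ι

namespace Layer

open AffForm

variable {ι : Type} [Fintype ι] [DecidableEq ι]

/-- The action of a layer on the registers. -/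
def step (l : Layer ι) (σ : ι → ℝ) : ι → ℝ := fun i => max ((l i).eval σ) 0

/-- The action of a sequence of layers on the registers. -/
def run : List (Layer ι) → (ι → ℝ) → ι → ℝ
  | [], σ => σ
  | l :: ls, σ => run ls (step l σ)

@[simp] theorem run_nil (σ : ι → ℝ) : run [] σ = σ := rfl

@[simp] theorem run_cons (l : Layer ι) (ls : List (Layer ι)) (σ : ι → ℝ) :
    run (l :: ls) σ = run ls (step l σ) := rfl

theorem run_append (ls ls' : List (Layer ι)) (σ : ι → ℝ) :
    run (ls ++ ls') σ = run ls' (run ls σ) := by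
  induction ls generalizing σ with
  | nil => rfl
  | cons l ls ih => exact ih _

theorem step_nonneg (l : Layer ι) (σ : ι → ℝ) : 0 ≤ step l σ := fun _ => le_max_right _ _

theorem run_nonneg (ls : List (Layer ι)) {σ : ι → ℝ} (h : 0 ≤ σ) : 0 ≤ run ls σ := by
  induction ls generalizing σ with
  | nil => exact h
  | cons l ls ih => exact ih (step_nonneg l σ)

/-- The layer that assigns the rectified value of `f` to the register `i` and keeps all others. -/
def assign (i : ι) (f : AffForm ι) : Layer ι := Function.update reg i f

/-- Registers are nonnegative, so rectification does not alter the ones that are copied; a layer can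
therefore overwrite a single register. -/
theorem step_assign (i : ι) (f : AffForm ι) {σ : ι → ℝ} (h : 0 ≤ σ) (j : ι) :
    step (assign i f) σ j = if j = i then max (f.eval σ) 0 else σ j := by
  by_cases hj : j = i
  · subst hj; simp [step, assign]
  · simpa [step, assign, hj] using h j

theorem step_assign_self (i : ι) (f : AffForm ι) (σ : ι → ℝ) :
    step (assign i f) σ i = max (f.eval σ) 0 := by
  simp [step, assign]

theorem step_assign_of_ne {i j : ι} (hj : j ≠ i) (f : AffForm ι) {σ : ι → ℝ} (h : 0 ≤ σ) :
    step (assign i f) σ j = σ j := by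
  simpa [step, assign, hj] using h j

/-- All coefficients of the layer have `c` fractional bits and absolute value at most `H`. -/
def Fits (c : ℕ) (H : ℝ) (l : Layer ι) : Prop := ∀ i, (l i).Fits c H

theorem fits_assign {c : ℕ} {H : ℝ} (hH : 1 ≤ H) {f : AffForm ι} (hf : f.Fits c H) (i : ι) :
    Fits c H (assign i f) := by
  intro j
  by_cases hj : j = i
  · subst hj; simpa [assign] using hf
  · simpa [assign, hj] using (fits_reg j).mono hH

end Layer

/-! ### From register programs to networks. -/

namespace ReLUNet

open AffForm Layer

variable {ι : Type} [Fintype ι] [DecidableEq ι]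

/-- The network with hidden layers on a fixed set of registers, read off by a final form. -/
noncomputable def ofLayersTail : List (Layer ι) → AffForm ι → ReLUNet (Fintype.card ι) 1
  | [], o => output (fun _ j => o.1 ((Fintype.equivFin ι).symm j)) fun _ => o.2
  | l :: ls, o => hidden (fun i j => (l ((Fintype.equivFin ι).symm i)).1
      ((Fintype.equivFin ι).symm j)) (fun i => (l ((Fintype.equivFin ι).symm i)).2)
      (ofLayersTail ls o)

/-- The network that fills the registers by a first layer and then runs further layers on them. -/
noncomputable def ofLayers {d : ℕ} (inp : ι → AffForm (Fin d)) (ls : List (Layer ι))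
    (o : AffForm ι) : ReLUNet d 1 :=
  hidden (fun i j => (inp ((Fintype.equivFin ι).symm i)).1 j)
    (fun i => (inp ((Fintype.equivFin ι).symm i)).2) (ofLayersTail ls o)

theorem eval_equivFin (f : AffForm ι) (σ : ι → ℝ) :
    ∑ j, f.1 ((Fintype.equivFin ι).symm j) * σ ((Fintype.equivFin ι).symm j) + f.2 = f.eval σ := by
  rw [AffForm.eval, (Fintype.equivFin ι).symm.sum_comp fun j => f.1 j * σ j]

theorem eval_ofLayersTail (ls : List (Layer ι)) (o : AffForm ι) (σ : ι → ℝ) :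
    (ofLayersTail ls o).eval (fun j => σ ((Fintype.equivFin ι).symm j)) 0 = o.eval (run ls σ) := by
  classical
  induction ls generalizing σ with
  | nil => exact eval_equivFin o σ
  | cons l ls ih =>
    rw [run_cons, ← ih]
    simp only [ofLayersTail, eval]
    congr 1
    funext i
    congr 1
    exact eval_equivFin (l _) σ

theorem toFun_ofLayers {d : ℕ} (inp : ι → AffForm (Fin d)) (ls : List (Layer ι)) (o : AffForm ι)
    (x : EuclideanSpace ℝ (Fin d)) :
    (ofLayers inp ls o).toFun x =
      o.eval (run ls fun i => max ((inp i).eval fun j => x j) 0) := by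
  rw [← eval_ofLayersTail]; rfl

theorem depth_ofLayers {d : ℕ} (inp : ι → AffForm (Fin d)) (ls : List (Layer ι)) (o : AffForm ι) :
    (ofLayers inp ls o).depth = ls.length + 2 := by
  have h : (ofLayersTail ls o).depth = ls.length + 1 := by
    induction ls with
    | nil => rfl
    | cons l ls ih => simp [ofLayersTail, depth, ih]
  simp [ofLayers, depth, h]

theorem width_ofLayers {d : ℕ} (inp : ι → AffForm (Fin d)) (ls : List (Layer ι)) (o : AffForm ι) :
    (ofLayers inp ls o).width ≤ Fintype.card ι + 1 := by
  have h : (ofLayersTail ls o).width ≤ Fintype.card ι + 1 := by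
    induction ls with
    | nil => simp [ofLayersTail, width]
    | cons l ls ih => simp [ofLayersTail, width, ih]
  simp [ofLayers, width, h]

theorem numParams_ofLayers {d : ℕ} (inp : ι → AffForm (Fin d)) (ls : List (Layer ι))
    (o : AffForm ι) :
    (ofLayers inp ls o).numParams ≤
      (d + 1) * (Fintype.card ι + 1) + (ls.length + 1) * (Fintype.card ι + 1) ^ 2 := by
  have h : (ofLayersTail ls o).numParams ≤ (ls.length + 1) * (Fintype.card ι + 1) ^ 2 := by
    induction ls with
    | nil => simp [ofLayersTail, numParams]; nlinarith
    | cons l ls ih => simp only [ofLayersTail, numParams, List.length_cons]; nlinarith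
  simp only [ofLayers, numParams]
  nlinarith

/-- The numerator of a parameter is at most `2 ^ (b + c)`; the two further bits pay for the sign and
for the strict inequality. -/
theorem hasBitComplexity_ofLayers {d : ℕ} {inp : ι → AffForm (Fin d)} {ls : List (Layer ι)}
    {o : AffForm ι} {c b : ℕ} (hi : ∀ i, (inp i).Fits c (2 ^ b)) (hl : ∀ l ∈ ls, Layer.Fits c (2 ^ b) l)
    (ho : o.Fits c (2 ^ b)) : (ofLayers inp ls o).HasBitComplexity (c + b + 2) := by
  refine ⟨c, by omega, ?_⟩
  have key : ∀ p : ℝ, p ∈ dyadics c → |p| ≤ 2 ^ b →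
      ∃ z : ℤ, p = (z : ℝ) / 2 ^ c ∧ 2 * |z| < 2 ^ (c + b + 2) := by
    rintro _ ⟨z, rfl⟩ hz
    refine ⟨z, rfl, ?_⟩
    rw [abs_div, abs_of_pos (by positivity : (0 : ℝ) < 2 ^ c), div_le_iff₀ (by positivity)] at hz
    have h1 : |z| ≤ 2 ^ b * 2 ^ c := by exact_mod_cast hz
    have h2 : (0 : ℤ) < 2 ^ b * 2 ^ c := by positivity
    calc 2 * |z| ≤ 2 * (2 ^ b * 2 ^ c) := by linarith
      _ < 4 * (2 ^ b * 2 ^ c) := by linarith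
      _ = 2 ^ (c + b + 2) := by ring
  have h : (ofLayersTail ls o).AllParams
      fun p => ∃ z : ℤ, p = (z : ℝ) / 2 ^ c ∧ 2 * |z| < 2 ^ (c + b + 2) := by
    induction ls with
    | nil => exact ⟨fun i j => key _ (ho.1 _).1 (ho.1 _).2, fun i => key _ ho.2.1 ho.2.2⟩
    | cons l ls ih =>
      refine ⟨⟨fun i j => ?_, fun i => ?_⟩, ih fun l' hl' => hl l' (by simp [hl'])⟩
      · exact key _ ((hl l (by simp) _).1 _).1 ((hl l (by simp) _).1 _).2
      · exact key _ (hl l (by simp) _).2.1 (hl l (by simp) _).2.2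
  exact ⟨⟨fun i j => key _ ((hi _).1 _).1 ((hi _).1 _).2,
    fun i => key _ (hi _).2.1 (hi _).2.2⟩, h⟩

end ReLUNet

/-! ### Extraction of binary digits. -/

namespace Layer

open AffForm

variable {ι : Type} [Fintype ι] [DecidableEq ι]

/-- Moves the binary digit of weight `2 ^ β` from the register `src` to the register `dst`, where it
gets the weight `ω`; the digit is found by a ramp of slope `2 ^ e`. -/
noncomputable def extractBit (src dst p q : ι) (e β : ℕ) (ω : ℝ) : List (Layer ι) :=
  [assign p ((2 : ℝ) ^ e • reg src + const (1 - 2 ^ (e + β))),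
    assign q ((2 : ℝ) ^ e • reg src + const (-2 ^ (e + β))),
    assign dst (reg dst + (ω • reg p + (-ω) • reg q)),
    assign src (reg src + ((-2 ^ β : ℝ) • reg p + (2 ^ β : ℝ) • reg q))]

/-- Moves `n` binary digits, from the weight `2 ^ β` upwards, from `src` to `dst`, where the lowest
one gets the weight `Ω`. -/
noncomputable def extract (src dst p q : ι) (e β : ℕ) (Ω : ℝ) : ℕ → List (Layer ι)
  | 0 => []
  | n + 1 => extractBit src dst p q e (β + n) (Ω * 2 ^ n) ++ extract src dst p q e β Ω n

theorem length_extract (src dst p q : ι) (e β : ℕ) (Ω : ℝ) (n : ℕ) :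
    (extract src dst p q e β Ω n).length = 4 * n := by
  induction n with
  | zero => rfl
  | succ n ih => simp [extract, extractBit, ih]; ring

theorem fits_extract {src dst p q : ι} {c e β n : ℕ} {Ω H : ℝ} (hΩ : 0 ≤ Ω)
    (hΩc : ∀ k : ℕ, Ω * 2 ^ k ∈ dyadics c)
    (h1 : (2 : ℝ) ^ (e + β + n + 2) ≤ H) (h2 : 1 + Ω * 2 ^ (n + 1) ≤ H) :
    ∀ l ∈ extract src dst p q e β Ω n, Fits c H l := by
  induction n with
  | zero => simp [extract]
  | succ n ih =>
    have hpow : (2 : ℝ) ^ n ≤ 2 ^ (n + 1) := pow_le_pow_right₀ one_le_two (by omega)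
    have h0 : (0 : ℝ) ≤ Ω * 2 ^ n := by positivity
    have e1 : (2 : ℝ) ^ (e + β + (n + 1) + 2) = 8 * 2 ^ (e + (β + n)) := by ring
    have e2 : Ω * 2 ^ (n + 1 + 1) = 4 * (Ω * 2 ^ n) := by ring
    have p1 : (2 : ℝ) ^ e ≤ 2 ^ (e + (β + n)) := pow_le_pow_right₀ one_le_two (by omega)
    have p2 : (2 : ℝ) ^ (β + n) ≤ 2 ^ (e + (β + n)) := pow_le_pow_right₀ one_le_two (by omega)
    have p3 : (1 : ℝ) ≤ 2 ^ (e + (β + n)) := one_le_pow₀ one_le_two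
    have hH : 1 ≤ H := by nlinarith
    intro l hl
    simp only [extract, extractBit, List.mem_append, List.mem_cons, List.not_mem_nil,
      or_false] at hl
    rcases hl with (rfl | rfl | rfl | rfl) | hl
    · refine fits_assign hH (((fits_smul_reg (two_pow_mem_dyadics c e) _).add (fits_const
        (sub_mem (one_mem_dyadics c) (two_pow_mem_dyadics c _)))).mono ?_) _
      rw [abs_of_nonneg (by positivity), abs_of_nonpos (by linarith)]
      linarith
    · refine fits_assign hH (((fits_smul_reg (two_pow_mem_dyadics c e) _).add (fits_const
        (neg_mem (two_pow_mem_dyadics c _)))).mono ?_) _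
      rw [abs_neg, abs_of_nonneg (by positivity), abs_of_nonneg (by positivity)]
      linarith
    · refine fits_assign hH (((fits_reg _).add ((fits_smul_reg (hΩc n) _).add
        (fits_smul_reg (neg_mem (hΩc n)) _))).mono ?_) _
      rw [abs_neg, abs_of_nonneg h0]
      linarith
    · refine fits_assign hH (((fits_reg _).add ((fits_smul_reg
        (neg_mem (two_pow_mem_dyadics c _)) _).add
        (fits_smul_reg (two_pow_mem_dyadics c _) _))).mono ?_) _
      rw [abs_neg, abs_of_nonneg (by positivity)]
      linarith
    · refine ih (by linarith [show (2 : ℝ) ^ (e + β + n + 2) = 4 * 2 ^ (e + (β + n)) by ring])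
        (by linarith [show Ω * 2 ^ (n + 1) = 2 * (Ω * 2 ^ n) by ring]) l hl

/-- The difference of the two temporary registers is a ramp in `src` that is 0 up to `2 ^ β - 2 ^
(-e)` and 1 from `2 ^ β` on. The bound on `φ` keeps `X + φ` off the sloped piece, so the ramp equals
the top digit of `X` exactly. -/
theorem run_extractBit {src dst p q : ι} (hd : [src, dst, p, q].Nodup) {e β X : ℕ} {ω φ : ℝ}
    {σ : ι → ℝ} (hσ : 0 ≤ σ) (hω : 0 ≤ ω) (hφ0 : 0 ≤ φ) (hφ : φ ≤ 1 - 1 / 2 ^ e)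
    (hX : σ src = X + φ) (hXβ : X < 2 ^ (β + 1)) :
    run (extractBit src dst p q e β ω) σ src = (X % 2 ^ β : ℕ) + φ ∧
    run (extractBit src dst p q e β ω) σ dst = σ dst + ω * (X / 2 ^ β : ℕ) ∧
    ∀ i, i ∉ [src, dst, p, q] → run (extractBit src dst p q e β ω) σ i = σ i := by
  simp only [List.nodup_cons, List.mem_cons, List.not_mem_nil, or_false, not_or,
    List.nodup_nil, and_true, not_false_eq_true] at hd
  obtain ⟨⟨hsd, hsp, hsq⟩, ⟨hdp, hdq⟩, hpq⟩ := hd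
  set σ1 := step (assign p ((2 : ℝ) ^ e • reg src + const (1 - 2 ^ (e + β)))) σ with h1
  set σ2 := step (assign q ((2 : ℝ) ^ e • reg src + const (-2 ^ (e + β)))) σ1 with h2
  set σ3 := step (assign dst (reg dst + (ω • reg p + (-ω) • reg q))) σ2 with h3
  set σ4 := step (assign src (reg src + ((-2 ^ β : ℝ) • reg p + (2 ^ β : ℝ) • reg q))) σ3 with h4
  have hrun : run (extractBit src dst p q e β ω) σ = σ4 := rfl
  rw [hrun]
  have n1 : 0 ≤ σ1 := step_nonneg _ _
  have n2 : 0 ≤ σ2 := step_nonneg _ _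
  have n3 : 0 ≤ σ3 := step_nonneg _ _
  have hoth : ∀ i, i ≠ src → i ≠ dst → i ≠ p → i ≠ q → σ4 i = σ i := by
    intro i a1 a2 a3 a4
    rw [h4, step_assign_of_ne a1 _ n3, h3, step_assign_of_ne a2 _ n2, h2,
      step_assign_of_ne a4 _ n1, h1, step_assign_of_ne a3 _ hσ]
  have s1 : σ1 src = σ src := by rw [h1, step_assign_of_ne hsp _ hσ]
  have s2 : σ2 src = σ src := by rw [h2, step_assign_of_ne hsq _ n1, s1]
  have s3 : σ3 src = σ src := by rw [h3, step_assign_of_ne hsd _ n2, s2]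
  have d2 : σ2 dst = σ dst := by
    rw [h2, step_assign_of_ne hdq _ n1, h1, step_assign_of_ne hdp _ hσ]
  have p1 : σ1 p = max (2 ^ e * σ src + (1 - 2 ^ (e + β))) 0 := by
    rw [h1, step_assign_self]; simp
  have p2 : σ2 p = max (2 ^ e * σ src + (1 - 2 ^ (e + β))) 0 := by
    rw [h2, step_assign_of_ne hpq _ n1, p1]
  have q2 : σ2 q = max (2 ^ e * σ src + -2 ^ (e + β)) 0 := by
    rw [h2, step_assign_self]; simp [s1]
  have hχ : σ2 p - σ2 q = (X / 2 ^ β : ℕ) := by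
    rw [p2, q2, hX, pow_add]
    have he : (0 : ℝ) < 2 ^ e := by positivity
    rcases lt_or_ge X (2 ^ β) with hlt | hge
    · rw [Nat.div_eq_of_lt hlt]
      have : (X : ℝ) + 1 ≤ 2 ^ β := by exact_mod_cast hlt
      have h5 : (2 : ℝ) ^ e * (X + φ) ≤ 2 ^ e * (2 ^ β - 1 / 2 ^ e) :=
        mul_le_mul_of_nonneg_left (by linarith) he.le
      have h6 : (2 : ℝ) ^ e * (2 ^ β - 1 / 2 ^ e) = 2 ^ e * 2 ^ β - 1 := by field_simp
      rw [max_eq_right (by linarith), max_eq_right (by linarith)]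
      simp
    · have hdiv : X / 2 ^ β = 1 := by
        rw [Nat.div_eq_iff (by positivity)]
        rw [pow_succ] at hXβ
        omega
      have : (2 : ℝ) ^ β ≤ X := by exact_mod_cast hge
      have h5 : (2 : ℝ) ^ e * 2 ^ β ≤ 2 ^ e * (X + φ) :=
        mul_le_mul_of_nonneg_left (by linarith) he.le
      rw [hdiv, max_eq_left (by linarith), max_eq_left (by linarith)]
      push_cast; ring
  have hmd : (X : ℝ) = 2 ^ β * (X / 2 ^ β : ℕ) + (X % 2 ^ β : ℕ) := by
    exact_mod_cast (Nat.div_add_mod X (2 ^ β)).symm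
  refine ⟨?_, ?_, fun i hi => ?_⟩
  · have p3 : σ3 p = σ2 p := by rw [h3, step_assign_of_ne (Ne.symm hdp) _ n2]
    have q3 : σ3 q = σ2 q := by rw [h3, step_assign_of_ne (Ne.symm hdq) _ n2]
    rw [h4, step_assign_self]
    simp only [eval_add, eval_reg, eval_smul, p3, q3, s3]
    rw [show σ src + (-2 ^ β * σ2 p + 2 ^ β * σ2 q) = σ src - 2 ^ β * (σ2 p - σ2 q) by ring, hχ, hX,
      max_eq_left] <;> [skip; have : (0 : ℝ) ≤ (X % 2 ^ β : ℕ) := Nat.cast_nonneg _] <;> linarith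
  · rw [h4, step_assign_of_ne (Ne.symm hsd) _ n3, h3, step_assign_self]
    simp only [eval_add, eval_reg, eval_smul, d2]
    rw [show σ dst + (ω * σ2 p + -ω * σ2 q) = σ dst + ω * (σ2 p - σ2 q) by ring, hχ, max_eq_left]
    have := hσ dst
    simp only [Pi.zero_apply] at this
    positivity
  · simp only [List.mem_cons, List.not_mem_nil, or_false, not_or] at hi
    exact hoth i hi.1 hi.2.1 hi.2.2.1 hi.2.2.2

/-- Digits are taken from the top: once one is removed, the remainder satisfies the size bound for
the next. The part `φ` below the unit is carried along unchanged. -/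
theorem run_extract {src dst p q : ι} (hd : [src, dst, p, q].Nodup) {e β n X : ℕ} {Ω φ : ℝ}
    {σ : ι → ℝ} (hσ : 0 ≤ σ) (hΩ : 0 ≤ Ω) (hφ0 : 0 ≤ φ) (hφ : φ ≤ 1 - 1 / 2 ^ e)
    (hX : σ src = X + φ) (hXβ : X < 2 ^ (β + n)) :
    run (extract src dst p q e β Ω n) σ src = (X % 2 ^ β : ℕ) + φ ∧
    run (extract src dst p q e β Ω n) σ dst = σ dst + Ω * (X / 2 ^ β : ℕ) ∧
    ∀ i, i ∉ [src, dst, p, q] → run (extract src dst p q e β Ω n) σ i = σ i := by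
  induction n generalizing σ X with
  | zero =>
    simp only [add_zero] at hXβ
    simp [extract, Nat.mod_eq_of_lt hXβ, Nat.div_eq_of_lt hXβ, hX]
  | succ n ih =>
    obtain ⟨a1, a2, a3⟩ := run_extractBit hd (e := e) (β := β + n) (ω := Ω * 2 ^ n) hσ
      (by positivity) hφ0 hφ hX hXβ
    obtain ⟨b1, b2, b3⟩ := ih (run_nonneg _ hσ) a1 (Nat.mod_lt _ (by positivity))
    rw [extract, run_append]
    refine ⟨?_, ?_, fun i hi => by rw [b3 i hi, a3 i hi]⟩
    · rw [b1, Nat.mod_mod_of_dvd _ (pow_dvd_pow 2 (by omega))]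
    · rw [b2, a2]
      -- The quotient is the removed digit, with its weight, plus the quotient of the remainder.
      have : X / 2 ^ β = 2 ^ n * (X / 2 ^ (β + n)) + X % 2 ^ (β + n) / 2 ^ β := by
        conv_lhs => rw [← Nat.div_add_mod X (2 ^ (β + n)), pow_add, mul_assoc, add_comm,
          Nat.add_mul_div_left _ _ (by positivity), ← pow_add]
        ring
      rw [this]
      push_cast
      ring

end Layer

/-! ### Selection of a stored number and decoding of its entries. -/

namespace Layer

open AffForm

variable {ι : Type} [Fintype ι] [DecidableEq ι]

/-- Adds `V` to the register `ρ 2` if the integer in `ρ 1` lies between `t₀` and `t₁`. -/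
noncomputable def selectStep (ρ : Fin 8 ↪ ι) (t₀ t₁ V : ℕ) : List (Layer ι) :=
  [assign (ρ 5) (const t₀ - reg (ρ 1)), assign (ρ 6) (reg (ρ 1) + const (1 - t₁)),
    assign (ρ 5) (const 1 - reg (ρ 5) - reg (ρ 6)),
    assign (ρ 2) (reg (ρ 2) + (V : ℝ) • reg (ρ 5))]

/-- Because `U` is an integer, both rectified differences vanish when `t₀ ≤ U < t₁`, and otherwise
one of them is at least 1. One minus their sum, rectified, is thus an exact indicator. -/
theorem run_selectStep (ρ : Fin 8 ↪ ι) (t₀ t₁ V : ℕ) {U : ℕ} {σ : ι → ℝ} (hσ : 0 ≤ σ)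
    (hU : σ (ρ 1) = U) :
    run (selectStep ρ t₀ t₁ V) σ (ρ 2) = σ (ρ 2) + (if t₀ ≤ U ∧ U < t₁ then V else 0 : ℕ) ∧
    ∀ i, i ≠ ρ 2 → i ≠ ρ 5 → i ≠ ρ 6 → run (selectStep ρ t₀ t₁ V) σ i = σ i := by
  have n2 : 0 ≤ σ (ρ 2) := hσ _
  have key : max (1 - max ((t₀ : ℝ) - U) 0 - max ((U : ℝ) + (1 - t₁)) 0) 0 =
      if t₀ ≤ U ∧ U < t₁ then 1 else 0 := by
    split_ifs with h
    · have h1 : (t₀ : ℝ) ≤ U := by exact_mod_cast h.1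
      have h2 : (U : ℝ) + 1 ≤ t₁ := by exact_mod_cast h.2
      rw [max_eq_right (a := (t₀ : ℝ) - U) (by linarith),
        max_eq_right (a := (U : ℝ) + (1 - t₁)) (by linarith)]
      norm_num
    · rw [not_and_or, not_le, not_lt] at h
      apply max_eq_right
      rcases h with h | h
      · have h1 : (U : ℝ) + 1 ≤ t₀ := by exact_mod_cast h
        linarith [le_max_left ((t₀ : ℝ) - U) 0, le_max_right ((U : ℝ) + (1 - t₁)) 0]
      · have h1 : (t₁ : ℝ) ≤ U := by exact_mod_cast h
        linarith [le_max_right ((t₀ : ℝ) - U) 0, le_max_left ((U : ℝ) + (1 - t₁)) 0]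
  constructor
  · simp only [selectStep, run_cons, run_nil, step_assign, hσ, step_nonneg, EmbeddingLike.apply_eq_iff_eq,
      Fin.reduceEq, if_true, if_false, eval_add, eval_sub, eval_reg, eval_smul, eval_const, hU, key]
    rw [max_eq_left]
    · push_cast; split_ifs <;> simp
    · positivity
  · intro i h2 h5 h6
    simp [selectStep, step_assign, hσ, step_nonneg, h2, h5, h6]

/-- Adds to `ρ 2` the number `V j` for which the integer in `ρ 1` is between `t j` and
`t (j + 1)`. -/
noncomputable def select (ρ : Fin 8 ↪ ι) (t V : ℕ → ℕ) : ℕ → List (Layer ι)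
  | 0 => []
  | n + 1 => select ρ t V n ++ selectStep ρ (t n) (t (n + 1)) (V n)

theorem length_select (ρ : Fin 8 ↪ ι) (t V : ℕ → ℕ) (n : ℕ) : (select ρ t V n).length = 4 * n := by
  induction n with
  | zero => rfl
  | succ n ih => simp [select, selectStep, ih]; ring

theorem fits_select (ρ : Fin 8 ↪ ι) (t V : ℕ → ℕ) {n c : ℕ} {H : ℝ} (hH : 3 ≤ H)
    (ht : ∀ j ≤ n, (t j : ℝ) + 2 ≤ H) (hV : ∀ j < n, (V j : ℝ) + 1 ≤ H) :
    ∀ l ∈ select ρ t V n, Fits c H l := by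
  induction n with
  | zero => simp [select]
  | succ n ih =>
    have hH1 : 1 ≤ H := by linarith
    intro l hl
    simp only [select, selectStep, List.mem_append, List.mem_cons, List.not_mem_nil,
      or_false] at hl
    rcases hl with hl | rfl | rfl | rfl | rfl
    · exact ih (fun j hj => ht j (by omega)) (fun j hj => hV j (by omega)) l hl
    · refine fits_assign hH1 (((fits_const (natCast_mem_dyadics c _)).sub (fits_reg _)).mono ?_) _
      rw [abs_of_nonneg (by positivity)]
      linarith [ht n (by omega)]
    · refine fits_assign hH1 (((fits_reg _).add (fits_const (sub_mem (one_mem_dyadics c)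
        (natCast_mem_dyadics c _)))).mono ?_) _
      have h0 : (0 : ℝ) ≤ t (n + 1) := Nat.cast_nonneg _
      have : |(1 : ℝ) - t (n + 1)| ≤ t (n + 1) + 1 := by
        rw [abs_le]; constructor <;> linarith
      linarith [ht (n + 1) le_rfl]
    · refine fits_assign hH1 ((((fits_const (one_mem_dyadics c)).sub (fits_reg _)).sub
        (fits_reg _)).mono ?_) _
      simp; linarith
    · refine fits_assign hH1 (((fits_reg _).add (fits_smul_reg (natCast_mem_dyadics c _) _)).mono ?_) _
      rw [abs_of_nonneg (by positivity)]
      linarith [hV n (by omega)]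

theorem run_select (ρ : Fin 8 ↪ ι) (t V : ℕ → ℕ) (n : ℕ) {U : ℕ} {σ : ι → ℝ} (hσ : 0 ≤ σ)
    (hU : σ (ρ 1) = U) :
    run (select ρ t V n) σ (ρ 2) =
      σ (ρ 2) + (∑ j ∈ Finset.range n, if t j ≤ U ∧ U < t (j + 1) then V j else 0 : ℕ) ∧
    ∀ i, i ≠ ρ 2 → i ≠ ρ 5 → i ≠ ρ 6 → run (select ρ t V n) σ i = σ i := by
  induction n with
  | zero => simp [select]
  | succ n ih =>
    obtain ⟨h1, h2⟩ := ih
    obtain ⟨h3, h4⟩ := run_selectStep ρ (t n) (t (n + 1)) (V n) (run_nonneg (select ρ t V n) hσ)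
      (U := U) (by rw [h2 (ρ 1) (by simp) (by simp) (by simp), hU])
    rw [select, run_append]
    refine ⟨?_, fun i a b c => by rw [h4 i a b c, h2 i a b c]⟩
    rw [h3, h1, Finset.sum_range_succ]
    push_cast
    ring

/-- Reads from the integer in `ρ 2` the entry in the binary digits from `2 ^ β` upwards, which
consists of a key of `κ` digits and a label of `m` digits, and replaces `ρ 7` by its maximum with
the label if the key equals the integer in `ρ 1`. -/
noncomputable def decodeStep (ρ : Fin 8 ↪ ι) (κ m C β : ℕ) : List (Layer ι) :=
  [assign (ρ 3) (const 0), assign (ρ 4) (const 0)] ++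
    (extract (ρ 2) (ρ 4) (ρ 5) (ρ 6) 0 (β + κ) 1 m ++
    (extract (ρ 2) (ρ 3) (ρ 5) (ρ 6) 0 β 1 κ ++
    [assign (ρ 5) (reg (ρ 3) - reg (ρ 1)), assign (ρ 6) (reg (ρ 1) - reg (ρ 3)),
      assign (ρ 5) (reg (ρ 4) - (C : ℝ) • reg (ρ 5) - (C : ℝ) • reg (ρ 6) - reg (ρ 7)),
      assign (ρ 7) (reg (ρ 7) + reg (ρ 5))]))

/-- A wrong key `a` is punished by `C * |a - U|`, which is at least `C` for integers and so
outweighs the label. The maximum of output and label is formed as `out + max (label - out) 0`. -/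
theorem run_decodeStep (ρ : Fin 8 ↪ ι) {κ m C β X U : ℕ} {σ : ι → ℝ} (hσ : 0 ≤ σ)
    (hU : σ (ρ 1) = U) (hX : σ (ρ 2) = X) (hXlt : X < 2 ^ (β + κ + m))
    (hC : X / 2 ^ β / 2 ^ κ ≤ C) :
    run (decodeStep ρ κ m C β) σ (ρ 2) = (X % 2 ^ β : ℕ) ∧
    run (decodeStep ρ κ m C β) σ (ρ 7) = max (σ (ρ 7))
      (if X / 2 ^ β % 2 ^ κ = U then X / 2 ^ β / 2 ^ κ else 0 : ℕ) ∧
    run (decodeStep ρ κ m C β) σ (ρ 1) = U ∧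
    ∀ i, i ∉ Set.range ρ → run (decodeStep ρ κ m C β) σ i = σ i := by
  have hρ : ∀ {i}, i ∉ Set.range ρ → ∀ k, i ≠ ρ k := fun hi k h => hi ⟨k, h.symm⟩
  have hn7 : 0 ≤ σ (ρ 7) := hσ _
  simp only [decodeStep, run_append]
  set σ1 := run [assign (ρ 3) (const 0), assign (ρ 4) (const 0)] σ with h1
  have n1 : 0 ≤ σ1 := run_nonneg _ hσ
  have f1 : ∀ i, i ≠ ρ 3 → i ≠ ρ 4 → σ1 i = σ i := by
    intro i a b
    simp [h1, step_assign, hσ, step_nonneg, a, b]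
  have a3 : σ1 (ρ 3) = 0 := by simp [h1, step_assign, hσ, step_nonneg]
  have a4 : σ1 (ρ 4) = 0 := by simp [h1, step_assign, step_nonneg]
  -- The codeword is an integer, so there is no fractional part and slope `2 ^ 0` suffices.
  obtain ⟨b1, b2, b3⟩ := run_extract (src := ρ 2) (dst := ρ 4) (p := ρ 5) (q := ρ 6) (by simp)
    (e := 0) (β := β + κ) (n := m) (X := X) (Ω := 1) (φ := 0) n1 zero_le_one le_rfl (by norm_num)
    (by rw [f1 _ (by simp) (by simp), hX, add_zero]) (by simpa using hXlt)
  set σ2 := run (extract (ρ 2) (ρ 4) (ρ 5) (ρ 6) 0 (β + κ) 1 m) σ1 with h2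
  have n2 : 0 ≤ σ2 := run_nonneg _ n1
  obtain ⟨c1, c2, c3⟩ := run_extract (src := ρ 2) (dst := ρ 3) (p := ρ 5) (q := ρ 6) (by simp)
    (e := 0) (β := β) (n := κ) (X := X % 2 ^ (β + κ)) (Ω := 1) (φ := 0) n2 zero_le_one le_rfl
    (by norm_num) b1 (Nat.mod_lt _ (by positivity))
  set σ3 := run (extract (ρ 2) (ρ 3) (ρ 5) (ρ 6) 0 β 1 κ) σ2 with h3
  have n3 : 0 ≤ σ3 := run_nonneg _ n2
  have g1 : σ3 (ρ 1) = U := by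
    rw [c3 _ (by simp), b3 _ (by simp), f1 _ (by simp) (by simp), hU]
  have g7 : σ3 (ρ 7) = σ (ρ 7) := by
    rw [c3 _ (by simp), b3 _ (by simp), f1 _ (by simp) (by simp)]
  have g4 : σ3 (ρ 4) = (X / 2 ^ β / 2 ^ κ : ℕ) := by
    rw [c3 _ (by simp), b2, a4, Nat.div_div_eq_div_mul, ← pow_add]
    simp
  have g3 : σ3 (ρ 3) = (X / 2 ^ β % 2 ^ κ : ℕ) := by
    rw [c2, b3 _ (by simp), a3, pow_add, Nat.mod_mul_right_div_self]
    simp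
  have g2 : σ3 (ρ 2) = (X % 2 ^ β : ℕ) := by
    rw [c1, Nat.mod_mod_of_dvd _ (pow_dvd_pow 2 (by omega)), add_zero]
  refine ⟨?_, ?_, ?_, fun i hi => ?_⟩
  · simp [step_assign, n3, step_nonneg, g2]
  · set l := X / 2 ^ β / 2 ^ κ
    set a := X / 2 ^ β % 2 ^ κ
    simp only [run_cons, run_nil, step_assign, n3, step_nonneg, 
      EmbeddingLike.apply_eq_iff_eq, Fin.reduceEq, if_true, if_false, eval_add, eval_sub, eval_reg,
      eval_smul, g1, g3, g4, g7]
    have hl : (0 : ℝ) ≤ l := Nat.cast_nonneg _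
    have hlC : (l : ℝ) ≤ C := by exact_mod_cast hC
    have hm : max ((l : ℝ) - C * max ((a : ℝ) - U) 0 - C * max ((U : ℝ) - a) 0 - σ (ρ 7)) 0 =
        max (((if a = U then l else 0 : ℕ) : ℝ) - σ (ρ 7)) 0 := by
      split_ifs with h
      · simp [h]
      · rw [Nat.cast_zero, max_eq_right (a := 0 - σ (ρ 7)) (by linarith), max_eq_right]
        have hab : 1 ≤ max ((a : ℝ) - U) 0 + max ((U : ℝ) - a) 0 := by
          rcases Nat.lt_or_gt_of_ne h with h | h
          · have : (a : ℝ) + 1 ≤ U := by exact_mod_cast h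
            linarith [le_max_right ((a : ℝ) - U) 0, le_max_left ((U : ℝ) - a) 0]
          · have : (U : ℝ) + 1 ≤ a := by exact_mod_cast h
            linarith [le_max_left ((a : ℝ) - U) 0, le_max_right ((U : ℝ) - a) 0]
        nlinarith
    rw [hm, max_eq_left (by positivity)]
    rcases le_total (σ (ρ 7)) ((if a = U then l else 0 : ℕ) : ℝ) with h | h
    · rw [max_eq_left (by linarith), max_eq_right h]; ring
    · rw [max_eq_right (by linarith), max_eq_left h]; ring
  · simp [step_assign, n3, step_nonneg, g1]
  · simp only [run_cons, run_nil, step_assign, n3, step_nonneg, 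
      hρ hi, if_false]
    rw [c3 _ (by simp [hρ hi]), b3 _ (by simp [hρ hi]), f1 _ (hρ hi _) (hρ hi _)]

theorem fits_decodeStep (ρ : Fin 8 ↪ ι) {κ m C β c : ℕ} {H : ℝ}
    (h1 : (2 : ℝ) ^ (β + κ + m + 2) ≤ H) (h2 : (2 : ℝ) * C + 2 ≤ H) :
    ∀ l ∈ decodeStep ρ κ m C β, Fits c H l := by
  have q1 : ∀ k : ℕ, 1 + (1 : ℝ) * 2 ^ (k + 1) ≤ 2 ^ (k + 2) := by
    intro k
    have : (1 : ℝ) ≤ 2 ^ k := one_le_pow₀ one_le_two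
    rw [pow_succ, pow_add]; linarith
  have q2 : ∀ {k : ℕ}, k ≤ β + κ + m + 2 → (2 : ℝ) ^ k ≤ H := fun hk =>
    (pow_le_pow_right₀ one_le_two hk).trans h1
  have hH2 : 2 ≤ H := by simpa using q2 (k := 1) (by omega)
  have hH : 1 ≤ H := by linarith
  have hC0 : (0 : ℝ) ≤ C := Nat.cast_nonneg _
  have hd : ∀ k : ℕ, (1 : ℝ) * 2 ^ k ∈ dyadics c := fun k => by
    simpa using two_pow_mem_dyadics c k
  intro l hl
  simp only [decodeStep, List.mem_append, List.mem_cons, List.not_mem_nil, or_false] at hl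
  rcases hl with (rfl | rfl) | hl | hl | rfl | rfl | rfl | rfl
  · exact fits_assign hH ((fits_const (zero_mem _)).mono (by simp; linarith)) _
  · exact fits_assign hH ((fits_const (zero_mem _)).mono (by simp; linarith)) _
  · exact fits_extract zero_le_one hd (q2 (by omega)) ((q1 m).trans (q2 (by omega))) l hl
  · exact fits_extract zero_le_one hd (q2 (by omega)) ((q1 κ).trans (q2 (by omega))) l hl
  · exact fits_assign hH (((fits_reg _).sub (fits_reg _)).mono (by linarith)) _
  · exact fits_assign hH (((fits_reg _).sub (fits_reg _)).mono (by linarith)) _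
  · refine fits_assign hH (((((fits_reg _).sub (fits_smul_reg (natCast_mem_dyadics c C) _)).sub
      (fits_smul_reg (natCast_mem_dyadics c C) _)).sub (fits_reg _)).mono ?_) _
    rw [abs_of_nonneg hC0]; linarith
  · exact fits_assign hH (((fits_reg _).add (fits_reg _)).mono (by linarith)) _

/-- The number whose digits in base `2 ^ b` are `E 0, E 1, …`. -/
def codeword (b : ℕ) (E : ℕ → ℕ) (n : ℕ) : ℕ := ∑ s ∈ Finset.range n, E s * 2 ^ (b * s)

theorem codeword_lt {b n : ℕ} {E : ℕ → ℕ} (hE : ∀ s < n, E s < 2 ^ b) :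
    codeword b E n < 2 ^ (b * n) := by
  induction n with
  | zero => simp [codeword]
  | succ n ih =>
    have h1 := ih fun s hs => hE s (by omega)
    have h2 := hE n (by omega)
    rw [codeword] at *
    rw [Finset.sum_range_succ, mul_add, mul_one, pow_add]
    calc _ < 2 ^ (b * n) + E n * 2 ^ (b * n) := by omega
      _ = 2 ^ (b * n) * (E n + 1) := by ring
      _ ≤ _ := Nat.mul_le_mul_left _ h2

theorem codeword_succ_div {b n : ℕ} {E : ℕ → ℕ} (hE : ∀ s < n, E s < 2 ^ b) :
    codeword b E (n + 1) / 2 ^ (b * n) = E n ∧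
      codeword b E (n + 1) % 2 ^ (b * n) = codeword b E n := by
  have h := codeword_lt hE
  have h2 : codeword b E (n + 1) = codeword b E n + 2 ^ (b * n) * E n := by
    rw [codeword, Finset.sum_range_succ, codeword]; ring
  rw [h2, Nat.add_mul_div_left _ _ (by positivity), Nat.add_mul_mod_self_left,
    Nat.div_eq_of_lt h, Nat.mod_eq_of_lt h]
  simp

/-- Decodes `n` entries of a codeword. -/
noncomputable def decode (ρ : Fin 8 ↪ ι) (κ m C : ℕ) : ℕ → List (Layer ι)
  | 0 => []
  | n + 1 => decodeStep ρ κ m C ((κ + m) * n) ++ decode ρ κ m C n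

theorem length_decode (ρ : Fin 8 ↪ ι) (κ m C n : ℕ) :
    (decode ρ κ m C n).length = (4 * (κ + m) + 6) * n := by
  induction n with
  | zero => rfl
  | succ n ih => simp [decode, decodeStep, length_extract, ih]; ring

theorem fits_decode (ρ : Fin 8 ↪ ι) {κ m C c n : ℕ} {H : ℝ}
    (h1 : (2 : ℝ) ^ ((κ + m) * n + 2) ≤ H) (h2 : (2 : ℝ) * C + 2 ≤ H) :
    ∀ l ∈ decode ρ κ m C n, Fits c H l := by
  induction n with
  | zero => simp [decode]
  | succ n ih =>
    intro l hl
    rw [decode, List.mem_append] at hl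
    rcases hl with hl | hl
    · exact fits_decodeStep ρ (by convert h1 using 2; ring) h2 l hl
    · exact ih ((pow_le_pow_right₀ one_le_two (by nlinarith)).trans h1) l hl

/-- Entries with another key contribute 0 and those with key `U` contribute 0 or `Y`, so the running
maximum never leaves `{0, Y}` and keeps `Y` once it is reached. -/
theorem run_decode (ρ : Fin 8 ↪ ι) {κ m C n U Y : ℕ} {E : ℕ → ℕ} {σ : ι → ℝ} (hσ : 0 ≤ σ)
    (hU : σ (ρ 1) = U) (hE : ∀ s < n, E s < 2 ^ (κ + m)) (hC : ∀ s < n, E s / 2 ^ κ ≤ C)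
    (hX : σ (ρ 2) = codeword (κ + m) E n) (hout : σ (ρ 7) = 0 ∨ σ (ρ 7) = Y)
    (hY : ∀ s < n, E s % 2 ^ κ = U → E s / 2 ^ κ = 0 ∨ E s / 2 ^ κ = Y) :
    (run (decode ρ κ m C n) σ (ρ 7) = 0 ∨ run (decode ρ κ m C n) σ (ρ 7) = Y) ∧
    ((σ (ρ 7) = Y ∨ ∃ s < n, E s % 2 ^ κ = U ∧ E s / 2 ^ κ = Y) →
      run (decode ρ κ m C n) σ (ρ 7) = Y) ∧
    ∀ i, i ∉ Set.range ρ → run (decode ρ κ m C n) σ i = σ i := by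
  induction n generalizing σ with
  | zero => simpa [decode] using hout
  | succ n ih =>
    have hE' : ∀ s < n, E s < 2 ^ (κ + m) := fun s hs => hE s (by omega)
    obtain ⟨hdiv, hmod⟩ := codeword_succ_div hE'
    obtain ⟨a1, a2, a3, a4⟩ := run_decodeStep ρ (κ := κ) (m := m) (C := C) (β := (κ + m) * n) hσ hU
      hX (by
        refine (codeword_lt hE).trans_le (le_of_eq ?_)
        congr 1; ring) (by rw [hdiv]; exact hC n (by omega))
    rw [hdiv] at a2
    rw [hmod] at a1
    set σ1 := run (decodeStep ρ κ m C ((κ + m) * n)) σ with h1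
    have hYn : (0 : ℝ) ≤ Y := Nat.cast_nonneg _
    have hval : ((if E n % 2 ^ κ = U then E n / 2 ^ κ else 0 : ℕ) : ℝ) = 0 ∨
        ((if E n % 2 ^ κ = U then E n / 2 ^ κ else 0 : ℕ) : ℝ) = Y := by
      split_ifs with h
      · rcases hY n (by omega) h with h | h <;> simp [h]
      · simp
    have o1 : σ1 (ρ 7) = 0 ∨ σ1 (ρ 7) = Y := by
      rw [a2]
      rcases hout with h | h <;> rcases hval with h' | h' <;> rw [h, h'] <;> simp
    obtain ⟨b1, b2, b3⟩ := ih (run_nonneg _ hσ) a3 hE' (fun s hs => hC s (by omega)) a1 o1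
      (fun s hs => hY s (by omega))
    rw [decode, run_append]
    rw [← h1] at b1 b2 b3 ⊢
    refine ⟨b1, fun h => b2 ?_, fun i hi => by rw [b3 i hi, a4 i hi]⟩
    rcases h with h | ⟨s, hs, h⟩
    · left
      rw [a2, h]
      rcases hval with h' | h' <;> rw [h'] <;> simp
    · rcases Nat.lt_succ_iff_lt_or_eq.mp hs with hs | rfl
      · exact Or.inr ⟨s, hs, h⟩
      · left
        rw [a2, if_pos h.1, h.2]
        rcases hout with h' | h' <;> rw [h'] <;> simp

end Layer

/-! ### Lookup tables with sorted blocks of keys. -/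

namespace Layer

open AffForm

variable {ι : Type} [Fintype ι] [DecidableEq ι]

/-- The index of the block of `u` when the elements of `S` are cut into blocks of length `h`. -/
def blockIndex (S : Finset ℕ) (h u : ℕ) : ℕ := (S.filter (· < u)).card / h

theorem blockIndex_mono (S : Finset ℕ) (h : ℕ) : Monotone (blockIndex S h) := fun _ _ huv =>
  Nat.div_le_div_right (Finset.card_le_card fun _ hx => by
    simp only [Finset.mem_filter] at hx ⊢
    exact ⟨hx.1, hx.2.trans_le huv⟩)

theorem blockIndex_lt {S : Finset ℕ} {h J u : ℕ} (hS : S.card ≤ h * J) (hu : u ∈ S) :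
    blockIndex S h u < J := by
  apply Nat.div_lt_of_lt_mul
  refine lt_of_lt_of_le (Finset.card_lt_card ?_) hS
  rw [Finset.ssubset_iff_of_subset (Finset.filter_subset _ _)]
  exact ⟨u, hu, by simp⟩

/-- The rank in `S` is strictly increasing on `S`, and on the block `j` it takes only the `h` values
from `h * j` on. -/
theorem card_block_le (S : Finset ℕ) {h : ℕ} (hh : 0 < h) (j : ℕ) :
    (S.filter (blockIndex S h · = j)).card ≤ h := by
  have hinj : Set.InjOn (fun u => (S.filter (· < u)).card) (S.filter (blockIndex S h · = j)) := by
    have key : ∀ u ∈ S, ∀ v, u < v → (S.filter (· < u)).card < (S.filter (· < v)).card := by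
      intro u hu v huv
      apply Finset.card_lt_card
      rw [Finset.ssubset_iff_of_subset fun x hx => by
        simp only [Finset.mem_filter] at hx ⊢
        exact ⟨hx.1, hx.2.trans huv⟩]
      exact ⟨u, by simp [hu, huv], by simp⟩
    intro u hu v hv huv
    simp only [Finset.mem_coe, Finset.mem_filter] at hu hv huv
    rcases lt_trichotomy u v with h | h | h
    · exact absurd huv (key u hu.1 v h).ne
    · exact h
    · exact absurd huv (key v hv.1 u h).ne'
  have hmaps : Set.MapsTo (fun u => (S.filter (· < u)).card) (S.filter (blockIndex S h · = j))
      (Finset.Ico (h * j) (h * j + h)) := by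
    intro u hu
    replace hu := Finset.mem_filter.mp (Finset.mem_coe.mp hu)
    have := (Nat.div_eq_iff hh).mp hu.2
    simp only [Finset.coe_Ico, Set.mem_Ico]
    rw [mul_comm h j]
    omega
  simpa using Finset.card_le_card_of_injOn _ hmaps hinj

/-- The number of keys below `2 ^ κ` in the blocks before the block `j`. -/
def blockStart (S : Finset ℕ) (h κ j : ℕ) : ℕ :=
  ((Finset.range (2 ^ κ)).filter (blockIndex S h · < j)).card

/-- `blockIndex` is monotone, so the keys with index below `j` form an initial segment whose end is
its cardinality. Finding the block of a key thereby becomes a comparison with two integers, also for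
keys outside `S`. -/
theorem blockStart_le_iff (S : Finset ℕ) (h : ℕ) {κ j u : ℕ} (hu : u < 2 ^ κ) :
    blockStart S h κ j ≤ u ↔ j ≤ blockIndex S h u := by
  constructor
  · intro hle
    by_contra! hlt
    have : Finset.range (u + 1) ⊆ (Finset.range (2 ^ κ)).filter (blockIndex S h · < j) := by
      intro v hv
      simp only [Finset.mem_range, Finset.mem_filter] at hv ⊢
      exact ⟨by omega, (blockIndex_mono S h (by omega : v ≤ u)).trans_lt hlt⟩
    have := Finset.card_le_card this
    rw [Finset.card_range] at this
    rw [blockStart] at hle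
    omega
  · intro hle
    have : (Finset.range (2 ^ κ)).filter (blockIndex S h · < j) ⊆ Finset.range u := by
      intro v hv
      simp only [Finset.mem_range, Finset.mem_filter] at hv ⊢
      by_contra! huv
      have := blockIndex_mono S h huv
      omega
    simpa [blockStart] using Finset.card_le_card this

/-- The `s`-th entry of the block `j`: a key of `κ` digits followed by its label. -/
noncomputable def blockEntry (S : Finset ℕ) (h κ : ℕ) (lab : ℕ → ℕ) (j s : ℕ) : ℕ :=
  ((S.filter (blockIndex S h · = j)).toList.map fun k => k + 2 ^ κ * lab k).getD s 0

/-- Short blocks are padded with the entry 0. It decodes to the label 0, which does not influence a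
maximum. -/
theorem blockEntry_eq (S : Finset ℕ) (h κ : ℕ) (lab : ℕ → ℕ) (j s : ℕ) :
    blockEntry S h κ lab j s = 0 ∨
      ∃ k ∈ S, blockIndex S h k = j ∧ blockEntry S h κ lab j s = k + 2 ^ κ * lab k := by
  set l := ((S.filter (blockIndex S h · = j)).toList.map fun k => k + 2 ^ κ * lab k) with hl
  have hb : blockEntry S h κ lab j s = l.getD s 0 := rfl
  by_cases hs : s < l.length
  · right
    have hm : l.getD s 0 ∈ l := by
      rw [List.getD_eq_getElem _ _ hs]; exact List.getElem_mem hs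
    rw [← hb] at hm
    rw [hl] at hm
    simp only [List.mem_map, Finset.mem_toList, Finset.mem_filter] at hm
    obtain ⟨k, ⟨h1, h2⟩, h3⟩ := hm
    exact ⟨k, h1, h2, h3.symm⟩
  · left
    rw [hb, List.getD_eq_default _ _ (by omega)]

theorem exists_blockEntry {S : Finset ℕ} {h : ℕ} (hh : 0 < h) (κ : ℕ) (lab : ℕ → ℕ) {u : ℕ}
    (hu : u ∈ S) : ∃ s < h, blockEntry S h κ lab (blockIndex S h u) s = u + 2 ^ κ * lab u := by
  set l := ((S.filter (blockIndex S h · = blockIndex S h u)).toList.map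
    fun k => k + 2 ^ κ * lab k) with hl
  have hm : u + 2 ^ κ * lab u ∈ l := by
    rw [hl, List.mem_map]
    exact ⟨u, by simp [hu], rfl⟩
  obtain ⟨s, hs, he⟩ := List.getElem_of_mem hm
  refine ⟨s, hs.trans_le ?_, ?_⟩
  · simpa [hl] using card_block_le S hh (blockIndex S h u)
  · rw [← he, ← List.getD_eq_getElem _ 0 hs]; rfl

/-- A program that looks up the label of the key in `ρ 1`, for `h * J` keys with labels; it uses
`h + J` steps up to a factor depending on the length of the entries. -/
noncomputable def lookup (ρ : Fin 8 ↪ ι) (S : Finset ℕ) (lab : ℕ → ℕ) (κ m C h J : ℕ) :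
    List (Layer ι) :=
  assign (ρ 2) (const 0) :: (select ρ (blockStart S h κ)
    (fun j => codeword (κ + m) (blockEntry S h κ lab j) h) J ++ decode ρ κ m C h)

theorem length_lookup (ρ : Fin 8 ↪ ι) (S : Finset ℕ) (lab : ℕ → ℕ) (κ m C h J : ℕ) :
    (lookup ρ S lab κ m C h J).length = 1 + 4 * J + (4 * (κ + m) + 6) * h := by
  simp [lookup, length_select, length_decode]; ring

theorem blockEntry_lt {S : Finset ℕ} {lab : ℕ → ℕ} {κ m : ℕ} (hS : ∀ s ∈ S, s < 2 ^ κ)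
    (hm : ∀ s ∈ S, lab s < 2 ^ m) (h j s : ℕ) : blockEntry S h κ lab j s < 2 ^ (κ + m) := by
  rcases blockEntry_eq S h κ lab j s with he | ⟨k, hk, -, he⟩
  · rw [he]; positivity
  · rw [he, pow_add]
    calc k + 2 ^ κ * lab k < 2 ^ κ + 2 ^ κ * lab k := by have := hS k hk; omega
      _ = 2 ^ κ * (lab k + 1) := by ring
      _ ≤ _ := Nat.mul_le_mul_left _ (hm k hk)

theorem fits_lookup (ρ : Fin 8 ↪ ι) {S : Finset ℕ} {lab : ℕ → ℕ} {κ m C h : ℕ} (J : ℕ)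
    (hh : 0 < h) (hS : ∀ s ∈ S, s < 2 ^ κ) (hm : ∀ s ∈ S, lab s < 2 ^ m) {c : ℕ} {H : ℝ}
    (h1 : (2 : ℝ) ^ ((κ + m) * h + 2) ≤ H) (h2 : (2 : ℝ) * C + 2 ≤ H) :
    ∀ l ∈ lookup ρ S lab κ m C h J, Fits c H l := by
  have h3 : (4 : ℝ) * 2 ^ ((κ + m) * h) ≤ H := by
    rw [pow_add] at h1; linarith
  have h4 : (1 : ℝ) ≤ 2 ^ ((κ + m) * h) := one_le_pow₀ one_le_two
  intro l hl
  simp only [lookup, List.mem_cons, List.mem_append] at hl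
  rcases hl with rfl | hl | hl
  · exact fits_assign (by linarith) ((fits_const (zero_mem _)).mono (by simp; linarith)) _
  · refine fits_select ρ _ _ (by linarith) (fun j _ => ?_) (fun j _ => ?_) l hl
    · have : blockStart S h κ j ≤ 2 ^ κ := by
        refine (Finset.card_filter_le _ _).trans (by simp)
      have : (blockStart S h κ j : ℝ) ≤ 2 ^ κ := by exact_mod_cast this
      have : (2 : ℝ) ^ κ ≤ 2 ^ ((κ + m) * h) := pow_le_pow_right₀ one_le_two (by nlinarith)
      linarith
    · have := codeword_lt (b := κ + m) (n := h) (E := blockEntry S h κ lab j)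
        fun s _ => blockEntry_lt hS hm h j s
      have : (codeword (κ + m) (blockEntry S h κ lab j) h : ℝ) ≤ 2 ^ ((κ + m) * h) := by
        exact_mod_cast this.le
      linarith
  · exact fits_decode ρ h1 h2 l hl

/-- The selector loads the codeword of the only block that can contain `U`, and only this one is
decoded. -/
theorem run_lookup (ρ : Fin 8 ↪ ι) {S : Finset ℕ} {lab : ℕ → ℕ} {κ m C h J : ℕ} (hh : 0 < h)
    (hJ : S.card ≤ h * J) (hS : ∀ s ∈ S, s < 2 ^ κ) (hm : ∀ s ∈ S, lab s < 2 ^ m)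
    (hC : ∀ s ∈ S, lab s ≤ C) {σ : ι → ℝ} (hσ : 0 ≤ σ) {U Y : ℕ} (hU : σ (ρ 1) = U)
    (hUκ : U < 2 ^ κ) (hY : U ∈ S → lab U = Y) (hout : σ (ρ 7) = 0 ∨ σ (ρ 7) = Y) :
    (run (lookup ρ S lab κ m C h J) σ (ρ 7) = 0 ∨ run (lookup ρ S lab κ m C h J) σ (ρ 7) = Y) ∧
    ((U ∈ S ∨ σ (ρ 7) = Y) → run (lookup ρ S lab κ m C h J) σ (ρ 7) = Y) ∧
    ∀ i, i ∉ Set.range ρ → run (lookup ρ S lab κ m C h J) σ i = σ i := by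
  have hρ : ∀ {i}, i ∉ Set.range ρ → ∀ k, i ≠ ρ k := fun hi k h => hi ⟨k, h.symm⟩
  rw [lookup, run_cons, run_append]
  set V := fun j => codeword (κ + m) (blockEntry S h κ lab j) h with hV
  set σ1 := step (assign (ρ 2) (const 0)) σ with h1
  have n1 : 0 ≤ σ1 := step_nonneg _ _
  have a : ∀ i, i ≠ ρ 2 → σ1 i = σ i := fun i hi => step_assign_of_ne hi _ hσ
  obtain ⟨b1, b2⟩ := run_select ρ (blockStart S h κ) V J n1 (U := U) (by rw [a _ (by simp), hU])
  set σ2 := run (select ρ (blockStart S h κ) V J) σ1 with h2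
  have n2 : 0 ≤ σ2 := run_nonneg _ n1
  -- If `U` lies beyond the last block, nothing is selected and `ρ 2` stays 0, which is the codeword
  -- of zero entries.
  set E : ℕ → ℕ := fun s => if blockIndex S h U < J then
    blockEntry S h κ lab (blockIndex S h U) s else 0 with hE
  have hE1 : ∀ s, E s = 0 ∨ ∃ k ∈ S, E s = k + 2 ^ κ * lab k := by
    intro s
    simp only [hE]
    split_ifs
    · rcases blockEntry_eq S h κ lab (blockIndex S h U) s with he | ⟨k, hk, -, he⟩
      · exact Or.inl he
      · exact Or.inr ⟨k, hk, he⟩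
    · exact Or.inl rfl
  have hk1 : ∀ k ∈ S, (k + 2 ^ κ * lab k) % 2 ^ κ = k ∧ (k + 2 ^ κ * lab k) / 2 ^ κ = lab k := by
    intro k hk
    rw [Nat.add_mul_mod_self_left, Nat.add_mul_div_left _ _ (by positivity),
      Nat.mod_eq_of_lt (hS k hk), Nat.div_eq_of_lt (hS k hk)]
    simp
  have c2 : σ2 (ρ 2) = codeword (κ + m) E h := by
    rw [b1, h1, step_assign_self]
    have : ∀ j, (if blockStart S h κ j ≤ U ∧ U < blockStart S h κ (j + 1) then V j else 0) =
        if blockIndex S h U = j then V j else 0 := by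
      intro j
      have e1 := blockStart_le_iff S h (j := j) hUκ
      have e2 := blockStart_le_iff S h (j := j + 1) hUκ
      congr 1
      apply propext
      rw [e1, ← not_le, e2]
      omega
    simp only [this, Finset.sum_ite_eq, Finset.mem_range, eval_const, max_self, zero_add]
    congr 1
    simp only [hE, hV]
    split_ifs
    · rfl
    · simp [codeword]
  have c7 : σ2 (ρ 7) = σ (ρ 7) := by rw [b2 _ (by simp) (by simp) (by simp), a _ (by simp)]
  obtain ⟨d1, d2, d3⟩ := run_decode ρ (κ := κ) (m := m) (C := C) (n := h) (U := U) (Y := Y) (E := E)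
    n2 (by rw [b2 _ (by simp) (by simp) (by simp), a _ (by simp), hU])
    (fun s _ => by
      simp only [hE]
      split_ifs
      · exact blockEntry_lt hS hm _ _ _
      · positivity)
    (fun s _ => by
      rcases hE1 s with he | ⟨k, hk, he⟩
      · simp [he]
      · rw [he, (hk1 k hk).2]; exact hC k hk) c2 (by rwa [c7])
    (fun s _ hs => by
      rcases hE1 s with he | ⟨k, hk, he⟩
      · simp [he]
      · rw [he, (hk1 k hk).1] at hs
        subst hs
        rw [he, (hk1 k hk).2]
        exact Or.inr (hY hk))
  refine ⟨d1, fun h' => d2 ?_, fun i hi => ?_⟩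
  · rcases h' with hUS | h'
    · right
      obtain ⟨s, hs, he⟩ := exists_blockEntry hh κ lab hUS
      refine ⟨s, hs, ?_⟩
      simp only [hE, if_pos (blockIndex_lt hJ hUS), he]
      rw [(hk1 U hUS).1, (hk1 U hUS).2]
      exact ⟨rfl, hY hUS⟩
    · left; rw [c7, h']
  · rw [d3 i hi, b2 i (hρ hi _) (hρ hi _) (hρ hi _), a i (hρ hi _)]

end Layer

/-! ### Grid cells as keys, and several tables in sequence. -/

namespace Layer

open AffForm

variable {ι : Type} [Fintype ι] [DecidableEq ι]

/-- It turns equality of two keys into equality of all their grid cells. -/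
theorem codeword_inj {b n : ℕ} {E F : ℕ → ℕ} (hE : ∀ s < n, E s < 2 ^ b) (hF : ∀ s < n, F s < 2 ^ b)
    (h : codeword b E n = codeword b F n) : ∀ s < n, E s = F s := by
  induction n with
  | zero => simp
  | succ n ih =>
    have hE' : ∀ s < n, E s < 2 ^ b := fun s hs => hE s (by omega)
    have hF' : ∀ s < n, F s < 2 ^ b := fun s hs => hF s (by omega)
    obtain ⟨e1, e2⟩ := codeword_succ_div hE'
    obtain ⟨f1, f2⟩ := codeword_succ_div hF'
    rw [h] at e1 e2
    intro s hs
    rcases Nat.lt_succ_iff_lt_or_eq.mp hs with hs | rfl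
    · exact ih hE' hF' (e2.symm.trans f2) s hs
    · exact e1.symm.trans f1

/-- Computes in `ρ 1` the number with the digits `⌊z t + sh t / 2 ^ e⌋` in base `2 ^ q`. -/
noncomputable def discretize (ρ : Fin 8 ↪ ι) (zr : ℕ → ι) (e q : ℕ) (sh : ℕ → ℕ) :
    ℕ → List (Layer ι)
  | 0 => [assign (ρ 1) (const 0)]
  | t + 1 => discretize ρ zr e q sh t ++
      (assign (ρ 0) (reg (zr t) + const ((sh t : ℝ) / 2 ^ e)) ::
        extract (ρ 0) (ρ 1) (ρ 5) (ρ 6) e 0 (2 ^ (q * t)) q)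

theorem length_discretize (ρ : Fin 8 ↪ ι) (zr : ℕ → ι) (e q : ℕ) (sh : ℕ → ℕ) (T : ℕ) :
    (discretize ρ zr e q sh T).length = 1 + (4 * q + 1) * T := by
  induction T with
  | zero => rfl
  | succ T ih => simp [discretize, ih, length_extract]; ring

theorem fits_discretize (ρ : Fin 8 ↪ ι) (zr : ℕ → ι) {e q T c : ℕ} {sh : ℕ → ℕ} {H : ℝ}
    (hc : e ≤ c) (hsh : ∀ t < T, sh t ≤ 2 ^ e) (h1 : (2 : ℝ) ^ (e + q + 2) ≤ H)
    (h2 : (2 : ℝ) ^ (q * T + 2) ≤ H) : ∀ l ∈ discretize ρ zr e q sh T, Fits c H l := by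
  have hH : 2 ≤ H := by
    refine le_trans ?_ h1
    have : (1 : ℝ) ≤ 2 ^ (e + q) := one_le_pow₀ one_le_two
    rw [pow_add]; linarith
  have hH1 : 1 ≤ H := by linarith
  induction T with
  | zero =>
    intro l hl
    simp only [discretize, List.mem_singleton] at hl
    subst hl
    exact fits_assign hH1 ((fits_const (zero_mem _)).mono (by simp; linarith)) _
  | succ T ih =>
    intro l hl
    simp only [discretize, List.mem_append, List.mem_cons] at hl
    rcases hl with hl | rfl | hl
    · exact ih (fun t ht => hsh t (by omega))
        ((pow_le_pow_right₀ one_le_two (by nlinarith)).trans h2) l hl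
    · refine fits_assign hH1 (((fits_reg _).add (fits_const ?_)).mono ?_) _
      · simpa using int_div_two_pow_mem_dyadics hc (sh T)
      · rw [abs_of_nonneg (by positivity)]
        have : (sh T : ℝ) ≤ 2 ^ e := by exact_mod_cast hsh T (by omega)
        have : (sh T : ℝ) / 2 ^ e ≤ 1 := (div_le_one (by positivity)).mpr this
        linarith
    · refine fits_extract (by positivity) (fun k => ?_) (by simpa using h1) (le_trans ?_ h2) l hl
      · rw [← pow_add]; exact two_pow_mem_dyadics _ _
      · have : (1 : ℝ) ≤ 2 ^ (q * (T + 1)) := one_le_pow₀ one_le_two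
        rw [← pow_add, show q * T + (q + 1) = q * (T + 1) + 1 by ring, pow_succ, pow_add]
        linarith

/-- Extraction down to weight 1 splits off the integer part; each coordinate fills its own `q`
digits of `ρ 1`. The coordinates are copied to `ρ 0` before being consumed, so the next table can
use them again. -/
theorem run_discretize (ρ : Fin 8 ↪ ι) {zr : ℕ → ι} (hzr : ∀ t, zr t ∉ Set.range ρ) {e q T : ℕ}
    {sh X : ℕ → ℕ} {φ : ℕ → ℝ} {σ : ι → ℝ} (hσ : 0 ≤ σ) (hφ0 : ∀ t < T, 0 ≤ φ t)
    (hφ : ∀ t < T, φ t ≤ 1 - 1 / 2 ^ e) (hX : ∀ t < T, σ (zr t) + (sh t : ℝ) / 2 ^ e = X t + φ t)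
    (hXq : ∀ t < T, X t < 2 ^ q) :
    run (discretize ρ zr e q sh T) σ (ρ 1) = codeword q X T ∧
    run (discretize ρ zr e q sh T) σ (ρ 7) = σ (ρ 7) ∧
    ∀ i, i ∉ Set.range ρ → run (discretize ρ zr e q sh T) σ i = σ i := by
  have hρ : ∀ {i}, i ∉ Set.range ρ → ∀ k, i ≠ ρ k := fun hi k h => hi ⟨k, h.symm⟩
  induction T with
  | zero =>
    refine ⟨?_, ?_, fun i hi => ?_⟩ <;> simp only [discretize, run_cons, run_nil, step_assign, hσ]
    · simp [codeword]
    · simp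
    · simp [hρ hi]
  | succ T ih =>
    obtain ⟨a1, a2, a3⟩ := ih (fun t ht => hφ0 t (by omega)) (fun t ht => hφ t (by omega))
      (fun t ht => hX t (by omega)) (fun t ht => hXq t (by omega))
    rw [discretize, run_append, run_cons]
    set σ1 := run (discretize ρ zr e q sh T) σ with h1
    have n1 : 0 ≤ σ1 := run_nonneg _ hσ
    set σ2 := step (assign (ρ 0) (reg (zr T) + const ((sh T : ℝ) / 2 ^ e))) σ1 with h2
    have n2 : 0 ≤ σ2 := step_nonneg _ _
    have b : ∀ i, i ≠ ρ 0 → σ2 i = σ1 i := fun i hi => step_assign_of_ne hi _ n1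
    have b0 : σ2 (ρ 0) = X T + φ T := by
      rw [h2, step_assign_self, eval_add, eval_reg, eval_const, a3 _ (hzr T), hX T (by omega),
        max_eq_left]
      have := hφ0 T (by omega)
      positivity
    obtain ⟨c1, c2, c3⟩ := run_extract (src := ρ 0) (dst := ρ 1) (p := ρ 5) (q := ρ 6) (by simp)
      (β := 0) (n := q) (Ω := 2 ^ (q * T)) n2 (by positivity) (hφ0 T (by omega)) (hφ T (by omega)) b0
      (by simpa using hXq T (by omega))
    refine ⟨?_, ?_, fun i hi => ?_⟩
    · rw [c2, b _ (by simp), a1, codeword, codeword, Finset.sum_range_succ]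
      push_cast
      simp [mul_comm]
    · rw [c3 _ (by simp), b _ (by simp), a2]
    · rw [c3 _ (by simp [hρ hi]), b _ (hρ hi _), a3 i hi]

/-- Data of one lookup table: the shifts of the grid, the keys and their labels. -/
structure Table where
  /-- The shifts of the grid in multiples of the finest resolution. -/
  shift : ℕ → ℕ
  /-- The keys in the table. -/
  keys : Finset ℕ
  /-- The label of a key. -/
  label : ℕ → ℕ

/-- Runs several lookup tables one after the other. -/
noncomputable def tables (ρ : Fin 8 ↪ ι) (zr : ℕ → ι) (e q T m C h J : ℕ) (tb : ℕ → Table) :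
    ℕ → List (Layer ι)
  | 0 => []
  | g + 1 => tables ρ zr e q T m C h J tb g ++ (discretize ρ zr e q (tb g).shift T ++
      lookup ρ (tb g).keys (tb g).label (q * T) m C h J)

theorem length_tables (ρ : Fin 8 ↪ ι) (zr : ℕ → ι) (e q T m C h J : ℕ) (tb : ℕ → Table) (G : ℕ) :
    (tables ρ zr e q T m C h J tb G).length =
      (1 + (4 * q + 1) * T + (1 + 4 * J + (4 * (q * T + m) + 6) * h)) * G := by
  induction G with
  | zero => rfl
  | succ G ih => simp [tables, ih, length_discretize, length_lookup]; ring

theorem fits_tables (ρ : Fin 8 ↪ ι) (zr : ℕ → ι) {e q T m C h c G : ℕ} (J : ℕ) {H : ℝ}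
    {tb : ℕ → Table} (hc : e ≤ c) (hh : 0 < h) (hsh : ∀ g < G, ∀ t < T, (tb g).shift t ≤ 2 ^ e)
    (hS : ∀ g < G, ∀ s ∈ (tb g).keys, s < 2 ^ (q * T))
    (hm : ∀ g < G, ∀ s ∈ (tb g).keys, (tb g).label s < 2 ^ m) (h1 : (2 : ℝ) ^ (e + q + 2) ≤ H)
    (h2 : (2 : ℝ) ^ ((q * T + m) * h + 2) ≤ H) (h3 : (2 : ℝ) * C + 2 ≤ H) :
    ∀ l ∈ tables ρ zr e q T m C h J tb G, Fits c H l := by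
  induction G with
  | zero => simp [tables]
  | succ G ih =>
    intro l hl
    simp only [tables, List.mem_append] at hl
    rcases hl with hl | hl | hl
    · exact ih (fun g hg => hsh g (by omega)) (fun g hg => hS g (by omega))
        (fun g hg => hm g (by omega)) l hl
    · exact fits_discretize ρ zr hc (hsh G (by omega)) h1
        ((pow_le_pow_right₀ one_le_two (Nat.add_le_add_right
          ((Nat.le_add_right _ _).trans (Nat.le_mul_of_pos_right _ hh)) 2)).trans h2) l hl
    · exact fits_lookup ρ J hh (hS G (by omega)) (hm G (by omega)) h2 h3 l hl

/-- A table that contains the key yields `Y` and one that does not leaves the output at 0 or `Y`; a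
single hit therefore decides the result. -/
theorem run_tables (ρ : Fin 8 ↪ ι) {zr : ℕ → ι} (hzr : ∀ t, zr t ∉ Set.range ρ)
    {e q T m C h J G : ℕ} {tb : ℕ → Table} (hh : 0 < h) (hJ : ∀ g < G, (tb g).keys.card ≤ h * J)
    (hS : ∀ g < G, ∀ s ∈ (tb g).keys, s < 2 ^ (q * T))
    (hm : ∀ g < G, ∀ s ∈ (tb g).keys, (tb g).label s < 2 ^ m)
    (hC : ∀ g < G, ∀ s ∈ (tb g).keys, (tb g).label s ≤ C)
    {X : ℕ → ℕ → ℕ} {φ : ℕ → ℕ → ℝ} {σ : ι → ℝ} (hσ : 0 ≤ σ) (hφ0 : ∀ g < G, ∀ t < T, 0 ≤ φ g t)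
    (hφ : ∀ g < G, ∀ t < T, φ g t ≤ 1 - 1 / 2 ^ e)
    (hX : ∀ g < G, ∀ t < T, σ (zr t) + ((tb g).shift t : ℝ) / 2 ^ e = X g t + φ g t)
    (hXq : ∀ g < G, ∀ t < T, X g t < 2 ^ q) {Y : ℕ}
    (hY : ∀ g < G, codeword q (X g) T ∈ (tb g).keys → (tb g).label (codeword q (X g) T) = Y)
    (hout : σ (ρ 7) = 0) :
    (run (tables ρ zr e q T m C h J tb G) σ (ρ 7) = 0 ∨
      run (tables ρ zr e q T m C h J tb G) σ (ρ 7) = Y) ∧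
    ((∃ g < G, codeword q (X g) T ∈ (tb g).keys) →
      run (tables ρ zr e q T m C h J tb G) σ (ρ 7) = Y) ∧
    ∀ i, i ∉ Set.range ρ → run (tables ρ zr e q T m C h J tb G) σ i = σ i := by
  induction G with
  | zero => simp [tables, hout]
  | succ G ih =>
    obtain ⟨a1, a2, a3⟩ := ih (fun g hg => hJ g (by omega)) (fun g hg => hS g (by omega))
      (fun g hg => hm g (by omega)) (fun g hg => hC g (by omega)) (fun g hg => hφ0 g (by omega))
      (fun g hg => hφ g (by omega)) (fun g hg => hX g (by omega)) (fun g hg => hXq g (by omega))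
      (fun g hg => hY g (by omega))
    have hG : G < G + 1 := by omega
    rw [tables, run_append, run_append]
    set σ1 := run (tables ρ zr e q T m C h J tb G) σ with h1
    have n1 : 0 ≤ σ1 := run_nonneg _ hσ
    obtain ⟨b1, b2, b3⟩ := run_discretize ρ hzr (q := q) n1 (hφ0 G hG) (hφ G hG)
      (fun t ht => by rw [a3 _ (hzr t)]; exact hX G hG t ht) (hXq G hG)
    set σ2 := run (discretize ρ zr e q (tb G).shift T) σ1 with h2
    obtain ⟨c1, c2, c3⟩ := run_lookup ρ hh (hJ G hG) (hS G hG) (hm G hG) (hC G hG)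
      (σ := σ2) (run_nonneg _ n1) b1 (codeword_lt (hXq G hG)) (hY G hG) (by rw [b2]; exact a1)
    refine ⟨c1, fun hg => c2 ?_, fun i hi => by rw [c3 i hi, b3 i hi, a3 i hi]⟩
    obtain ⟨g, hg, hk⟩ := hg
    rcases Nat.lt_succ_iff_lt_or_eq.mp hg with hg | rfl
    · right; rw [b2, a2 ⟨g, hg, hk⟩]
    · exact Or.inl hk

end Layer

open AffForm Layer in
/-- A network that runs `G` lookup tables on the shifted grid cells of `T` affine functions. -/
theorem exists_net_tables {d T : ℕ} (hT : 0 < T) {e q m C h J G c b : ℕ}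
    (A : ℕ → AffForm (Fin d)) (hA : ∀ t < T, (A t).Fits c (2 ^ b)) (tb : ℕ → Table)
    (hc : e ≤ c) (hh : 0 < h) (hsh : ∀ g < G, ∀ t < T, (tb g).shift t ≤ 2 ^ e)
    (hJ : ∀ g < G, (tb g).keys.card ≤ h * J)
    (hS : ∀ g < G, ∀ s ∈ (tb g).keys, s < 2 ^ (q * T))
    (hm : ∀ g < G, ∀ s ∈ (tb g).keys, (tb g).label s < 2 ^ m)
    (hC : ∀ g < G, ∀ s ∈ (tb g).keys, (tb g).label s ≤ C)
    (h1 : e + q + 2 ≤ b) (h2 : (q * T + m) * h + 2 ≤ b) (h3 : (2 : ℝ) * C + 2 ≤ 2 ^ b) :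
    ∃ f : ReLUNet d 1,
      f.depth = (1 + (4 * q + 1) * T + (1 + 4 * J + (4 * (q * T + m) + 6) * h)) * G + 2 ∧
      f.width ≤ T + 9 ∧ f.numParams ≤ (d + 1) * (T + 9) + f.depth * (T + 9) ^ 2 ∧
      f.HasBitComplexity (c + b + 2) ∧
      ∀ (x : EuclideanSpace ℝ (Fin d)) (Y : ℕ) (r : ℕ → ℕ → ℝ),
        (∀ g < G, ∀ t < T, r g t = (A t).eval (fun j => x j) + ((tb g).shift t : ℝ) / 2 ^ e) →
        (∀ t < T, 0 ≤ (A t).eval fun j => x j) →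
        (∀ g < G, ∀ t < T, Int.fract (r g t) ≤ 1 - 1 / 2 ^ e) →
        (∀ g < G, ∀ t < T, r g t < 2 ^ q) →
        (∀ g < G, codeword q (fun t => ⌊r g t⌋₊) T ∈ (tb g).keys →
          (tb g).label (codeword q (fun t => ⌊r g t⌋₊) T) = Y) →
        (∃ g < G, codeword q (fun t => ⌊r g t⌋₊) T ∈ (tb g).keys) → f.toFun x = Y := by
  set ρ : Fin 8 ↪ Fin T ⊕ Fin 8 := ⟨Sum.inr, Sum.inr_injective⟩ with hρ
  -- Only indices below `T` are read; the other values just make the function total.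
  set zr : ℕ → Fin T ⊕ Fin 8 := fun t => Sum.inl (if h : t < T then ⟨t, h⟩ else ⟨0, hT⟩) with hzr
  have hzr' : ∀ t, zr t ∉ Set.range ρ := by
    rintro t ⟨k, hk⟩
    simp [hρ, hzr] at hk
  set inp : Fin T ⊕ Fin 8 → AffForm (Fin d) := Sum.elim (fun t => A t) (fun _ => const 0) with hinp
  set ls := tables ρ zr e q T m C h J tb G with hls
  have hlen : ls.length = (1 + (4 * q + 1) * T + (1 + 4 * J + (4 * (q * T + m) + 6) * h)) * G :=
    length_tables ..
  have hcard : Fintype.card (Fin T ⊕ Fin 8) + 1 = T + 9 := by simp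
  have hp : ∀ {k : ℕ}, k ≤ b → (2 : ℝ) ^ k ≤ 2 ^ b := fun hk => pow_le_pow_right₀ one_le_two hk
  refine ⟨ReLUNet.ofLayers inp ls (reg (ρ 7)), ?_, ?_, ?_, ?_, ?_⟩
  · rw [ReLUNet.depth_ofLayers, hlen]
  · exact (ReLUNet.width_ofLayers _ _ _).trans_eq hcard
  · refine (ReLUNet.numParams_ofLayers _ _ _).trans ?_
    rw [hcard, ReLUNet.depth_ofLayers]
    gcongr
    omega
  · refine ReLUNet.hasBitComplexity_ofLayers ?_ ?_ ?_
    · rintro (t | k)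
      · exact hA t t.2
      · exact (fits_const (zero_mem _)).mono (by simp)
    · exact fits_tables ρ zr J hc hh hsh hS hm (hp h1) (hp h2) h3
    · exact (fits_reg _).mono (one_le_pow₀ one_le_two)
  · intro x Y r hr hA0 hfr hrq hY hex
    rw [ReLUNet.toFun_ofLayers, eval_reg]
    set σ : Fin T ⊕ Fin 8 → ℝ := fun i => max ((inp i).eval fun j => x j) 0 with hσ
    have hr0 : ∀ g < G, ∀ t < T, 0 ≤ r g t := by
      intro g hg t ht
      rw [hr g hg t ht]
      have := hA0 t ht
      positivity
    refine (run_tables ρ hzr' hh hJ hS hm hC (X := fun g t => ⌊r g t⌋₊)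
      (φ := fun g t => Int.fract (r g t)) (σ := σ) (fun i => le_max_right _ _)
      (fun g _ t _ => Int.fract_nonneg _) hfr ?_ ?_ hY ?_).2.1 hex
    · intro g hg t ht
      have e1 : σ (zr t) = (A t).eval fun j => x j := by
        simp only [hσ, hzr, hinp, dif_pos ht, Sum.elim_inl]
        exact max_eq_left (hA0 t ht)
      rw [e1, ← hr g hg t ht, natCast_floor_eq_intCast_floor (hr0 g hg t ht)]
      exact (Int.floor_add_fract _).symm
    · intro g hg t ht
      rw [Nat.floor_lt (hr0 g hg t ht)]
      exact_mod_cast hrq g hg t ht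
    · simp [hσ, hρ, hinp]

/-! ### Moments of signed block sums and the choice of sign patterns. -/

/-- The real number `1` or `-1` for a Boolean. -/
def boolSign (b : Bool) : ℝ := if b then 1 else -1

theorem boolSign_eq (b : Bool) : boolSign b = 1 ∨ boolSign b = -1 := by
  cases b <;> simp [boolSign]

theorem boolSign_sq (b : Bool) : boolSign b ^ 2 = 1 := by
  cases b <;> simp [boolSign]

/-- The signed sum of the coordinates of `v` in the block `k`. -/
def blockSum {n : ℕ} {κ : Type} [DecidableEq κ] (β : Fin n → κ) (v : Fin n → ℝ) (s : Fin n → Bool)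
    (k : κ) : ℝ := ∑ j, if β j = k then boolSign (s j) * v j else 0

/-- The sum of the squares of the signed block sums. -/
def blockSq {n : ℕ} {κ : Type} [Fintype κ] [DecidableEq κ] (β : Fin n → κ) (v : Fin n → ℝ)
    (s : Fin n → Bool) : ℝ := ∑ k, blockSum β v s k ^ 2

section moments

variable {κ : Type} [Fintype κ] [DecidableEq κ]

/-- The first sign affects one block only, so the sum is affine in it; averaging over this sign
removes the linear term. This drives both moment computations by induction on `n`. -/
theorem blockSq_cons {n : ℕ} (β : Fin (n + 1) → κ) (v : Fin (n + 1) → ℝ) (b : Bool)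
    (s : Fin n → Bool) :
    blockSq β v (Fin.cons b s) = blockSq (fun j => β j.succ) (fun j => v j.succ) s + v 0 ^ 2 +
      boolSign b * (2 * v 0 * blockSum (fun j => β j.succ) (fun j => v j.succ) s (β 0)) := by
  have h : ∀ k, blockSum β v (Fin.cons b s) k ^ 2 =
      blockSum (fun j => β j.succ) (fun j => v j.succ) s k ^ 2 + ((if β 0 = k then v 0 ^ 2 else 0) +
      if β 0 = k then boolSign b * (2 * v 0 * blockSum (fun j => β j.succ) (fun j => v j.succ) s k)
        else 0) := by
    intro k
    rw [blockSum, Fin.sum_univ_succ]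
    simp only [Fin.cons_zero, Fin.cons_succ]
    rw [← blockSum]
    split_ifs
    · linear_combination (v 0 ^ 2) * boolSign_sq b
    · ring
  rw [blockSq, Finset.sum_congr rfl fun k _ => h k]
  simp only [Finset.sum_add_distrib, Finset.sum_ite_eq, Finset.mem_univ, if_true]
  rw [blockSq]
  ring

theorem sum_cons_bool {n : ℕ} (f : (Fin (n + 1) → Bool) → ℝ) :
    ∑ s, f s = ∑ s : Fin n → Bool, (f (Fin.cons true s) + f (Fin.cons false s)) := by
  rw [← (Fin.consEquiv fun _ : Fin (n + 1) => Bool).sum_comp, Fintype.sum_prod_type,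
    Fintype.sum_bool, ← Finset.sum_add_distrib]
  rfl

theorem sum_blockSq {n : ℕ} (β : Fin n → κ) (v : Fin n → ℝ) :
    ∑ s, blockSq β v s = 2 ^ n * ∑ j, v j ^ 2 := by
  induction n with
  | zero => simp [blockSq, blockSum]
  | succ n ih =>
    rw [sum_cons_bool]
    simp only [blockSq_cons, boolSign]
    rw [Finset.sum_congr rfl fun s _ => show _ =
      2 * blockSq (fun j => β j.succ) (fun j => v j.succ) s + 2 * v 0 ^ 2 by simp; ring]
    rw [Finset.sum_add_distrib, ← Finset.mul_sum, ih, Fin.sum_univ_succ]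
    simp
    ring

theorem blockSum_sq_le {n : ℕ} (β : Fin n → κ) (v : Fin n → ℝ) (s : Fin n → Bool) (k : κ) :
    blockSum β v s k ^ 2 ≤ blockSq β v s :=
  Finset.single_le_sum (f := fun k => blockSum β v s k ^ 2) (fun _ _ => sq_nonneg _)
    (Finset.mem_univ k)

/-- Let `Q` be the sum without the first coordinate and `a = v 0`. Averaging over the first sign
gives at most `Q ^ 2 + 6 * a ^ 2 * Q + a ^ 4`, because the squared cross term is `4 * a ^ 2` times
the square of one block sum, hence at most `4 * a ^ 2 * Q`. The recursion closes with the constant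
3. -/
theorem sum_blockSq_sq_le {n : ℕ} (β : Fin n → κ) (v : Fin n → ℝ) :
    ∑ s, blockSq β v s ^ 2 ≤ 3 * 2 ^ n * (∑ j, v j ^ 2) ^ 2 := by
  induction n with
  | zero => simp [blockSq, blockSum]
  | succ n ih =>
    rw [sum_cons_bool]
    set β' := fun j : Fin n => β j.succ
    set v' := fun j : Fin n => v j.succ
    have h : ∀ s : Fin n → Bool,
        blockSq β v (Fin.cons true s) ^ 2 + blockSq β v (Fin.cons false s) ^ 2 ≤
        2 * blockSq β' v' s ^ 2 + 12 * v 0 ^ 2 * blockSq β' v' s + 2 * v 0 ^ 4 := by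
      intro s
      rw [blockSq_cons, blockSq_cons]
      have := mul_le_mul_of_nonneg_left (blockSum_sq_le β' v' s (β 0)) (sq_nonneg (v 0))
      simp only [boolSign, if_true, Bool.false_eq_true, if_false]
      nlinarith
    refine (Finset.sum_le_sum fun s _ => h s).trans ?_
    rw [Finset.sum_add_distrib, Finset.sum_add_distrib, ← Finset.mul_sum, ← Finset.mul_sum,
      sum_blockSq, Fin.sum_univ_succ]
    have h1 := ih β' v'
    have h2 : (0 : ℝ) < 2 ^ n := by positivity
    have h3 : ∑ _s : Fin n → Bool, (2 : ℝ) * v 0 ^ 4 = 2 ^ n * (2 * v 0 ^ 4) := by simp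
    rw [h3, pow_succ]
    have h4 : 0 ≤ (2 : ℝ) ^ n * v 0 ^ 4 := by positivity
    change _ ≤ 3 * (2 ^ n * 2) * (v 0 ^ 2 + ∑ j, v' j ^ 2) ^ 2
    nlinarith

/-- At least one sign pattern in twelve keeps half of the square norm. -/
theorem card_blockSq_ge {n : ℕ} (β : Fin n → κ) (v : Fin n → ℝ) :
    (2 : ℝ) ^ n ≤ 12 *
      (Finset.univ.filter fun s : Fin n → Bool => (∑ j, v j ^ 2) / 2 ≤ blockSq β v s).card := by
  set μ := ∑ j, v j ^ 2 with hμ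
  set G := Finset.univ.filter fun s : Fin n → Bool => μ / 2 ≤ blockSq β v s with hG
  have hμ0 : 0 ≤ μ := Finset.sum_nonneg fun _ _ => sq_nonneg _
  have hQ : ∀ s, 0 ≤ blockSq β v s := fun s => Finset.sum_nonneg fun _ _ => sq_nonneg _
  have hpow : (0 : ℝ) < 2 ^ n := by positivity
  rcases hμ0.eq_or_lt with h0 | hpos
  · have : G = Finset.univ := by
      rw [hG, Finset.filter_eq_self]
      intro s _
      rw [← h0]
      simpa using hQ s
    rw [this]
    simp
  -- Paley–Zygmund: patterns below half of the mean contribute at most half of the total;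
  -- Cauchy–Schwarz with the constant 3 then gives the proportion `(1/2) ^ 2 / 3 = 1/12`.
  have hsum : 2 ^ n * μ / 2 ≤ ∑ s ∈ G, blockSq β v s := by
    have h1 := Finset.sum_filter_add_sum_filter_not Finset.univ
      (fun s : Fin n → Bool => μ / 2 ≤ blockSq β v s) (blockSq β v)
    rw [sum_blockSq, ← hG, ← hμ] at h1
    have h2 : ∑ s ∈ Finset.univ.filter (fun s : Fin n → Bool => ¬ μ / 2 ≤ blockSq β v s),
        blockSq β v s ≤ ∑ _s : Fin n → Bool, μ / 2 := by
      refine (Finset.sum_le_sum (g := fun _ => μ / 2) fun s hs => ?_).trans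
        (Finset.sum_le_sum_of_subset_of_nonneg (Finset.filter_subset _ _) fun _ _ _ => by positivity)
      exact (not_le.mp (Finset.mem_filter.mp hs).2).le
    simp at h2
    simp only [not_le] at h1
    linarith
  have hcs : (∑ s ∈ G, blockSq β v s) ^ 2 ≤ G.card * ∑ s ∈ G, blockSq β v s ^ 2 :=
    sq_sum_le_card_mul_sum_sq
  have hle : ∑ s ∈ G, blockSq β v s ^ 2 ≤ 3 * 2 ^ n * μ ^ 2 :=
    (Finset.sum_le_sum_of_subset_of_nonneg (Finset.filter_subset _ _)
      fun _ _ _ => sq_nonneg _).trans (sum_blockSq_sq_le β v)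
  have h1 : (2 ^ n * μ / 2) ^ 2 ≤ G.card * (3 * 2 ^ n * μ ^ 2) :=
    (pow_le_pow_left₀ (by positivity) hsum 2).trans
      (hcs.trans (mul_le_mul_of_nonneg_left hle (Nat.cast_nonneg _)))
  have h2 : 2 ^ n * (2 ^ n * μ ^ 2 / 4) ≤ 12 * (G.card : ℝ) * (2 ^ n * μ ^ 2 / 4) := by
    nlinarith
  exact le_of_mul_le_mul_right h2 (by positivity)

/-- For fewer than `2 ^ p` vectors there are `8 * p` sign patterns such that for every vector one
of them keeps half of the square norm. -/
theorem exists_signs {n : ℕ} (β : Fin n → κ) {α : Type} [DecidableEq α] (V : Finset α)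
    (v : α → Fin n → ℝ) {p : ℕ} (hp : V.card < 2 ^ p) :
    ∃ s : ℕ → Fin n → Bool, ∀ a ∈ V, ∃ t < 8 * p, (∑ j, v a j ^ 2) / 2 ≤ blockSq β (v a) (s t) := by
  -- Double counting: some pattern is good for at least a twelfth of the vectors in `W`.
  have key : ∀ W : Finset α, ∃ s : Fin n → Bool,
      12 * ((W.filter fun a => ¬ (∑ j, v a j ^ 2) / 2 ≤ blockSq β (v a) s).card : ℝ) ≤
        11 * W.card := by
    intro W
    by_contra! hlt
    have h1 : ∑ s : Fin n → Bool,
        ((W.filter fun a => (∑ j, v a j ^ 2) / 2 ≤ blockSq β (v a) s).card : ℝ) =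
        ∑ a ∈ W, ((Finset.univ.filter fun s : Fin n → Bool =>
          (∑ j, v a j ^ 2) / 2 ≤ blockSq β (v a) s).card : ℝ) := by
      simp only [Finset.card_filter, Nat.cast_sum]
      rw [Finset.sum_comm]
    have h2 : (W.card : ℝ) * 2 ^ n ≤ 12 * ∑ a ∈ W, ((Finset.univ.filter fun s : Fin n → Bool =>
          (∑ j, v a j ^ 2) / 2 ≤ blockSq β (v a) s).card : ℝ) := by
      rw [Finset.mul_sum, ← nsmul_eq_mul]
      exact Finset.card_nsmul_le_sum _ _ _ fun a _ => card_blockSq_ge β (v a)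
    have h3 : 12 * ∑ s : Fin n → Bool,
        ((W.filter fun a => (∑ j, v a j ^ 2) / 2 ≤ blockSq β (v a) s).card : ℝ) <
        ∑ _s : Fin n → Bool, (W.card : ℝ) := by
      rw [Finset.mul_sum]
      refine Finset.sum_lt_sum_of_nonempty Finset.univ_nonempty fun s _ => ?_
      have h4 := Finset.card_filter_add_card_filter_not (s := W)
        (fun a => (∑ j, v a j ^ 2) / 2 ≤ blockSq β (v a) s)
      have h5 : ((W.filter fun a => (∑ j, v a j ^ 2) / 2 ≤ blockSq β (v a) s).card : ℝ) +
        ((W.filter fun a => ¬ (∑ j, v a j ^ 2) / 2 ≤ blockSq β (v a) s).card : ℝ) = W.card := by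
        exact_mod_cast h4
      simp only [not_le] at h5
      linarith [hlt s]
    rw [h1] at h3
    simp at h3
    linarith
  -- Greedy choice: each new pattern is picked for the vectors not yet served.
  have iter : ∀ T : ℕ, ∃ s : ℕ → Fin n → Bool,
      ((V.filter fun a => ∀ t < T, ¬ (∑ j, v a j ^ 2) / 2 ≤ blockSq β (v a) (s t)).card : ℝ) ≤
        (11 / 12) ^ T * V.card := by
    intro T
    induction T with
    | zero => exact ⟨fun _ _ => true, by simp⟩
    | succ T ih =>
      obtain ⟨s, hs⟩ := ih
      obtain ⟨s', hs'⟩ := key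
        (V.filter fun a => ∀ t < T, ¬ (∑ j, v a j ^ 2) / 2 ≤ blockSq β (v a) (s t))
      refine ⟨Function.update s T s', ?_⟩
      rw [Finset.filter_filter] at hs'
      have : (V.filter fun a => ∀ t < T + 1,
          ¬ (∑ j, v a j ^ 2) / 2 ≤ blockSq β (v a) (Function.update s T s' t)) =
          V.filter fun a => (∀ t < T, ¬ (∑ j, v a j ^ 2) / 2 ≤ blockSq β (v a) (s t)) ∧
            ¬ (∑ j, v a j ^ 2) / 2 ≤ blockSq β (v a) s' := by
        apply Finset.filter_congr
        intro a _
        constructor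
        · intro h
          refine ⟨fun t ht => ?_, ?_⟩
          · have := h t (by omega)
            rwa [Function.update_of_ne (by omega)] at this
          · simpa using h T (by omega)
        · rintro ⟨h1, h2⟩ t ht
          rcases Nat.lt_succ_iff_lt_or_eq.mp ht with ht | rfl
          · rw [Function.update_of_ne (by omega)]; exact h1 t ht
          · simpa using h2
      rw [this, pow_succ]
      linarith
  obtain ⟨s, hs⟩ := iter (8 * p)
  refine ⟨s, fun a ha => ?_⟩
  by_contra! hno
  have h1 : (1 : ℝ) ≤
      (V.filter fun a => ∀ t < 8 * p, ¬ (∑ j, v a j ^ 2) / 2 ≤ blockSq β (v a) (s t)).card := by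
    have : 0 < (V.filter fun a => ∀ t < 8 * p,
        ¬ (∑ j, v a j ^ 2) / 2 ≤ blockSq β (v a) (s t)).card :=
      Finset.card_pos.mpr ⟨a, by simpa [ha] using hno⟩
    exact_mod_cast this
  -- Since `(11/12) ^ 8 < 1/2`, eight patterns halve the unserved vectors, and `8 * p` leave less
  -- than one.
  have h2 : ((11 : ℝ) / 12) ^ (8 * p) ≤ (1 / 2) ^ p := by
    rw [pow_mul]
    exact pow_le_pow_left₀ (by positivity) (by norm_num) p
  have h3 : (V.card : ℝ) < 2 ^ p := by exact_mod_cast hp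
  have h4 : ((1 : ℝ) / 2) ^ p * V.card < 1 := by
    calc ((1 : ℝ) / 2) ^ p * V.card < (1 / 2) ^ p * 2 ^ p :=
          mul_lt_mul_of_pos_left h3 (by positivity)
      _ = 1 := by rw [← mul_pow]; norm_num
  have h5 : ((11 : ℝ) / 12) ^ (8 * p) * V.card ≤ (1 / 2) ^ p * V.card :=
    mul_le_mul_of_nonneg_right h2 (Nat.cast_nonneg _)
  linarith

end moments

/-! ### Shifts of the grid. -/

/-- The shift by `k / n` moves `r` into the last `n`-th of a cell of the integer grid. -/
def BadShift (n k : ℕ) (r : ℝ) : Prop := (⌊n * r⌋ + k) % (n : ℤ) = n - 1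

/-- The shifted point lies in the last `n`-th of its cell only if the integer `A` is `n - 1` modulo
`n`. Elsewhere the digit extraction with slope `n` is exact. -/
theorem fract_le_of_not_badShift {n k : ℕ} (hn : 0 < n) {r : ℝ} (h : ¬ BadShift n k r) :
    Int.fract (r + k / n) ≤ 1 - 1 / n := by
  have hn' : (0 : ℝ) < n := by exact_mod_cast hn
  set A : ℤ := ⌊(n : ℝ) * r⌋ + k with hA
  have hlt : (n : ℝ) * (r + k / n) < A + 1 := by
    have := Int.lt_floor_add_one ((n : ℝ) * r)
    rw [hA]; push_cast
    rw [mul_add, mul_div_cancel₀ _ hn'.ne']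
    linarith
  have hle : (A : ℝ) ≤ n * (r + k / n) := by
    have := Int.floor_le ((n : ℝ) * r)
    rw [hA]; push_cast
    rw [mul_add, mul_div_cancel₀ _ hn'.ne']
    linarith
  have hdm : (n : ℤ) * (A / n) + A % n = A := Int.mul_ediv_add_emod A n
  have hmod : A % n + 1 ≤ (n : ℤ) - 1 := by
    have h1 := Int.emod_lt_of_pos A (by exact_mod_cast hn : (0 : ℤ) < n)
    have h2 : A % n ≠ (n : ℤ) - 1 := h
    omega
  have hmod' : ((A % n : ℤ) : ℝ) + 1 ≤ n - 1 := by exact_mod_cast hmod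
  have hdm' : (n : ℝ) * ((A / n : ℤ) : ℝ) + ((A % n : ℤ) : ℝ) = A := by exact_mod_cast hdm
  have hfl : A / n ≤ ⌊r + k / n⌋ := by
    rw [Int.le_floor]
    have h0 : (0 : ℝ) ≤ ((A % n : ℤ) : ℝ) := by
      exact_mod_cast Int.emod_nonneg A (by exact_mod_cast hn.ne')
    by_contra! hc
    have := mul_lt_mul_of_pos_left hc hn'
    linarith
  have hfl' : ((A / n : ℤ) : ℝ) ≤ ⌊r + k / n⌋ := by exact_mod_cast hfl
  have h1 : (n : ℝ) * Int.fract (r + k / n) ≤ n - 1 := by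
    rw [Int.fract, mul_sub]
    have := mul_le_mul_of_nonneg_left hfl' hn'.le
    linarith
  rw [show (1 : ℝ) - 1 / n = (n - 1) / n by field_simp, le_div_iff₀ hn']
  linarith

theorem BadShift.eq {n k l : ℕ} {r : ℝ} (hk : k < n) (hl : l < n) (h : BadShift n k r)
    (h' : BadShift n l r) : k = l := by
  rw [BadShift] at h h'
  have : (⌊n * r⌋ + (k : ℤ)) % n = (⌊n * r⌋ + (l : ℤ)) % n := h.trans h'.symm
  have h3 : (k : ℤ) ≡ l [ZMOD n] := Int.ModEq.add_left_cancel' _ this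
  have h4 : k ≡ l [MOD n] := (Int.natCast_modEq_iff).mp h3
  rwa [Nat.ModEq, Nat.mod_eq_of_lt hk, Nat.mod_eq_of_lt hl] at h4

/-- Two different shifts cannot be bad for the same `⌊n * r⌋`, so bad shifts inject into the
integers from `⌊n * (p - τ)⌋` to `⌊n * (p + τ)⌋`. -/
theorem card_filter_badShift_le {n : ℕ} (p τ : ℝ) (K : Finset ℕ) (hK : ∀ k ∈ K, k < n)
    (hτ : 0 ≤ τ) (h : ∀ k ∈ K, ∃ r, |r - p| ≤ τ ∧ BadShift n k r) :
    (K.card : ℝ) ≤ 2 * τ * n + 2 := by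
  choose! r hr hb using h
  have hn : (0 : ℝ) ≤ n := Nat.cast_nonneg _
  have hmaps : Set.MapsTo (fun k => ⌊(n : ℝ) * r k⌋) K
      (Finset.Icc ⌊(n : ℝ) * (p - τ)⌋ ⌊(n : ℝ) * (p + τ)⌋) := by
    intro k hk
    have := abs_le.mp (hr k hk)
    simp only [Finset.coe_Icc, Set.mem_Icc]
    constructor <;> apply Int.floor_le_floor <;> apply mul_le_mul_of_nonneg_left _ hn <;> linarith
  have hinj : Set.InjOn (fun k => ⌊(n : ℝ) * r k⌋) K := by
    intro k hk l hl hkl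
    refine BadShift.eq (hK k hk) (hK l hl) (hb k hk) ?_
    have := hb l hl
    rw [BadShift] at this ⊢
    simp only at hkl
    rwa [hkl]
  have hcard := Finset.card_le_card_of_injOn _ hmaps hinj
  rw [Int.card_Icc] at hcard
  have h1 := Int.lt_floor_add_one ((n : ℝ) * (p - τ))
  have h2 := Int.floor_le ((n : ℝ) * (p + τ))
  have h3 : ((⌊(n : ℝ) * (p + τ)⌋ + 1 - ⌊(n : ℝ) * (p - τ)⌋).toNat : ℤ) =
      ⌊(n : ℝ) * (p + τ)⌋ + 1 - ⌊(n : ℝ) * (p - τ)⌋ := by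
    apply Int.toNat_of_nonneg
    have : ⌊(n : ℝ) * (p - τ)⌋ ≤ ⌊(n : ℝ) * (p + τ)⌋ :=
      Int.floor_le_floor (mul_le_mul_of_nonneg_left (by linarith) hn)
    omega
  have h4 : (K.card : ℤ) ≤ ⌊(n : ℝ) * (p + τ)⌋ + 1 - ⌊(n : ℝ) * (p - τ)⌋ := by
    rw [← h3]; exact_mod_cast hcard
  have h5 : (K.card : ℝ) ≤ ⌊(n : ℝ) * (p + τ)⌋ + 1 - ⌊(n : ℝ) * (p - τ)⌋ := by exact_mod_cast h4
  nlinarith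

/-- There is a shift of the grid by a multiple of `1 / n` that keeps all of the intervals of radius
`τ` around the `p i` away from the ends of the cells, and that under each of the given measures is
bad with small probability only. -/
theorem exists_shift {E : Type} [MeasurableSpace E] {N n M : ℕ} {ψ : E → ℝ}
    (hψ : Measurable ψ) (μ : Fin N → Measure E) (hμ : ∀ i, μ i Set.univ ≤ 1) (I : Finset (Fin N))
    (hI : I.card ≤ M) (p : Fin N → ℝ) {τ : ℝ} (hτ : 0 ≤ τ) (hn : 0 < n)
    (hcount : M * (2 * τ * n + 2) ≤ 7 * n / 8) :
    ∃ k < n, (∀ i ∈ I, ∀ r, |r - p i| ≤ τ → ¬ BadShift n k r) ∧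
      ∀ i, n * μ i {x | BadShift n k (ψ x)} ≤ 8 * N := by
  classical
  have hn' : (0 : ℝ) < n := by exact_mod_cast hn
  set bad : Fin N → Finset ℕ := fun i =>
    (Finset.range n).filter fun k => ∃ r, |r - p i| ≤ τ ∧ BadShift n k r with hbad
  have hbadcard : ∀ i, ((bad i).card : ℝ) ≤ 2 * τ * n + 2 := fun i =>
    card_filter_badShift_le (p i) τ (bad i) (fun k hk => by simp [hbad] at hk; exact hk.1) hτ
      fun k hk => (Finset.mem_filter.mp hk).2
  -- The shifts that are safe for the whole group; by `hcount` they are at least `n / 8` in number.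
  set A := Finset.range n \ I.biUnion bad with hA
  have hAcard : (n : ℝ) ≤ 8 * A.card := by
    have h1 : n ≤ A.card + (I.biUnion bad).card := by
      have := Finset.le_card_sdiff (I.biUnion bad) (Finset.range n)
      rw [Finset.card_range, ← hA] at this
      omega
    have h2 : ((I.biUnion bad).card : ℝ) ≤ I.card * (2 * τ * n + 2) := by
      calc ((I.biUnion bad).card : ℝ) ≤ ∑ i ∈ I, ((bad i).card : ℝ) := by
            exact_mod_cast Finset.card_biUnion_le
        _ ≤ ∑ _i ∈ I, (2 * τ * n + 2) := Finset.sum_le_sum fun i _ => hbadcard i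
        _ = I.card * (2 * τ * n + 2) := by rw [Finset.sum_const, nsmul_eq_mul]
    have h3 : (I.card : ℝ) * (2 * τ * n + 2) ≤ M * (2 * τ * n + 2) :=
      mul_le_mul_of_nonneg_right (by exact_mod_cast hI) (by positivity)
    have h4 : (n : ℝ) ≤ A.card + (I.biUnion bad).card := by exact_mod_cast h1
    linarith
  have hAne : A.Nonempty := by
    rw [← Finset.card_pos]
    have : (0 : ℝ) < A.card := by linarith
    exact_mod_cast this
  have hmeas : ∀ k, MeasurableSet {x | BadShift n k (ψ x)} := by
    intro k
    have : Measurable fun x => ⌊(n : ℝ) * ψ x⌋ := (hψ.const_mul _).floor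
    exact this (MeasurableSet.of_discrete (s := {z : ℤ | (z + k) % (n : ℤ) = n - 1}))
  obtain ⟨k, hk, hmin⟩ := Finset.exists_min_image A
    (fun k => ∑ i, μ i {x | BadShift n k (ψ x)}) hAne
  have hkA := Finset.mem_sdiff.mp hk
  refine ⟨k, Finset.mem_range.mp hkA.1, fun i hi r hr hb => hkA.2 ?_, fun i => ?_⟩
  · exact Finset.mem_biUnion.mpr ⟨i, hi, Finset.mem_filter.mpr ⟨hkA.1, r, hr, hb⟩⟩
  -- For one measure the bad events of different shifts are disjoint, so over all shifts and all `N`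
  -- measures the total mass is at most `N`. A minimizing shift has at most the average `N /
  -- A.card`.
  · have h1 : (A.card : ℝ≥0∞) * ∑ i, μ i {x | BadShift n k (ψ x)} ≤ N := by
      rw [← nsmul_eq_mul]
      refine (Finset.card_nsmul_le_sum A _ _ hmin).trans ?_
      rw [Finset.sum_comm]
      calc ∑ i, ∑ k ∈ A, μ i {x | BadShift n k (ψ x)} ≤ ∑ _i : Fin N, (1 : ℝ≥0∞) := by
            refine Finset.sum_le_sum fun i _ => le_trans ?_ (hμ i)
            refine sum_measure_le_measure_univ (fun k _ => (hmeas k).nullMeasurableSet) ?_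
            intro k hk l hl hkl
            refine (Set.disjoint_left.mpr fun x hx hy => hkl ?_).aedisjoint
            exact BadShift.eq (Finset.mem_range.mp (Finset.mem_sdiff.mp hk).1)
              (Finset.mem_range.mp (Finset.mem_sdiff.mp hl).1) hx hy
        _ = N := by simp
    have h2 : (n : ℝ≥0∞) ≤ 8 * A.card := by exact_mod_cast hAcard
    calc n * μ i {x | BadShift n k (ψ x)}
        ≤ 8 * A.card * ∑ i, μ i {x | BadShift n k (ψ x)} := by
          gcongr
          exact Finset.single_le_sum (f := fun i => μ i {x | BadShift n k (ψ x)})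
            (fun _ _ => zero_le) (Finset.mem_univ i)
      _ ≤ 8 * N := by rw [mul_assoc]; gcongr

/-! ### Elementary bounds for the data. -/

namespace Dataset

variable {d N C : ℕ} (D : Dataset d N C)

theorem two_mul_sep_le {i j : Fin N} (h : D.y i ≠ D.y j) : 2 * D.sep ≤ ‖D.x i - D.x j‖ := by
  have : sInf {r : ℝ | ∃ i j, D.y i ≠ D.y j ∧ r = ‖D.x i - D.x j‖} ≤ ‖D.x i - D.x j‖ :=
    csInf_le ⟨0, by rintro _ ⟨_, _, _, rfl⟩; exact norm_nonneg _⟩ ⟨i, j, h, rfl⟩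
  rw [sep]; linarith

theorem sep_pos (h : ∃ i j, D.y i ≠ D.y j) : 0 < D.sep := by
  set S := {r : ℝ | ∃ i j, D.y i ≠ D.y j ∧ r = ‖D.x i - D.x j‖} with hS
  have hfin : S.Finite := by
    refine (Set.finite_range fun ij : Fin N × Fin N => ‖D.x ij.1 - D.x ij.2‖).subset ?_
    rintro _ ⟨i, j, _, rfl⟩
    exact ⟨(i, j), rfl⟩
  obtain ⟨i, j, hij⟩ := h
  have hne : S.Nonempty := ⟨_, i, j, hij, rfl⟩
  obtain ⟨a, b, hab, he⟩ := hne.csInf_mem hfin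
  have : 0 < sInf S := by
    rw [he, norm_pos_iff, sub_ne_zero]
    exact fun hx => hab (by rw [D.x_injective hx])
  rw [sep]; positivity

theorem norm_le_radius (i : Fin N) : ‖D.x i‖ ≤ D.radius :=
  le_ciSup (f := fun i => ‖D.x i‖) (Set.finite_range _).bddAbove i

theorem radius_nonneg : 0 ≤ D.radius := Real.iSup_nonneg fun _ => norm_nonneg _

theorem sep_le_radius (h : ∃ i j, D.y i ≠ D.y j) : D.sep ≤ D.radius := by
  obtain ⟨i, j, hij⟩ := h
  have := D.two_mul_sep_le hij
  have := norm_sub_le (D.x i) (D.x j)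
  linarith [D.norm_le_radius i, D.norm_le_radius j]

theorem two_le_card (h : ∃ i j, D.y i ≠ D.y j) : 2 ≤ N := by
  obtain ⟨i, j, hij⟩ := h
  by_contra! hlt
  exact hij (by rw [Fin.ext_iff.mpr (by omega : (i : ℕ) = j)])

theorem one_le_dim (h : ∃ i j, D.y i ≠ D.y j) : 1 ≤ d := by
  obtain ⟨i, j, hij⟩ := h
  by_contra! hlt
  obtain rfl : d = 0 := by omega
  exact hij (by rw [D.x_injective (Subsingleton.elim (D.x i) (D.x j))])

/-- The quantities under the logarithm are bounded by `2 ^ L`. -/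
structure SizeBound (t : ℝ) (L : ℕ) : Prop where
  two_le : 2 ≤ L
  card_le : N ≤ 2 ^ L
  dim_le : d ≤ 2 ^ L
  label_le : C + 2 ≤ 2 ^ L
  radius_le : D.radius ≤ 2 ^ L
  inv_sep_le : 1 / D.sep ≤ 2 ^ L
  le : t ≤ 2 ^ L

/-- `L` is the base-2 logarithm rounded up: `log₂ X ≤ 2 * log X`, and rounding costs one more `log X
≥ 1`, as `X ≥ 5 > e` by `N ≥ 2` and `d ≥ 1`. All sizes can then be handled as powers of two. -/
theorem exists_sizeBound (h : ∃ i j, D.y i ≠ D.y j) {t : ℝ} (ht : 0 ≤ t) :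
    1 ≤ D.logFactor t ∧ ∃ L : ℕ, D.SizeBound t L ∧ (L : ℝ) ≤ 3 * D.logFactor t := by
  set X : ℝ := 2 + N + d + C + D.radius + 1 / D.sep + t with hX
  have hR := D.radius_nonneg
  have hs := D.sep_pos h
  have hN : (2 : ℝ) ≤ N := by exact_mod_cast D.two_le_card h
  have hd : (1 : ℝ) ≤ d := by exact_mod_cast D.one_le_dim h
  have hC : (0 : ℝ) ≤ C := Nat.cast_nonneg _
  have hs' : 0 ≤ 1 / D.sep := by positivity
  have hX5 : 5 ≤ X := by rw [hX]; linarith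
  have hlog1 : 1 ≤ Real.log X := by
    rw [Real.le_log_iff_exp_le (by linarith)]
    linarith [Real.exp_one_lt_d9]
  obtain ⟨L, hL1, hL2⟩ : ∃ L : ℕ, X ≤ 2 ^ L ∧ (L : ℝ) ≤ 3 * Real.log X := by
    refine ⟨⌈Real.logb 2 X⌉₊, ?_, ?_⟩
    · rw [← Real.rpow_natCast, ← Real.logb_le_iff_le_rpow (by norm_num) (by linarith)]
      exact Nat.le_ceil _
    · have h1 := (Nat.ceil_lt_add_one (Real.logb_nonneg (b := 2) (by norm_num)
        (by linarith : 1 ≤ X))).le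
      have h2 : Real.logb 2 X ≤ 2 * Real.log X := by
        rw [Real.logb, div_le_iff₀ (Real.log_pos (by norm_num))]
        nlinarith [Real.log_two_gt_d9]
      linarith
  refine ⟨hlog1, L, ⟨?_, ?_, ?_, ?_, ?_, ?_, ?_⟩, hL2⟩
  · by_contra! hlt
    have : (2 : ℝ) ^ L ≤ 2 ^ 1 := pow_le_pow_right₀ one_le_two (by omega)
    linarith
  · have : (N : ℝ) ≤ 2 ^ L := by rw [hX] at hL1; linarith
    exact_mod_cast this
  · have : (d : ℝ) ≤ 2 ^ L := by rw [hX] at hL1; linarith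
    exact_mod_cast this
  · have : (C : ℝ) + 2 ≤ 2 ^ L := by rw [hX] at hL1; linarith
    exact_mod_cast this
  all_goals rw [hX] at hL1; linarith

end Dataset

/-! ### Signed sums, a dyadic scale, and stability of grid cells. -/

/-- The sum of the coordinates with the given signs. -/
def signSum {d : ℕ} (s : Fin d → Bool) (x : EuclideanSpace ℝ (Fin d)) : ℝ :=
  ∑ j, boolSign (s j) * x j

theorem signSum_sub {d : ℕ} (s : Fin d → Bool) (x y : EuclideanSpace ℝ (Fin d)) :
    signSum s (x - y) = signSum s x - signSum s y := by
  simp [signSum, mul_sub]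

theorem abs_signSum_le {d : ℕ} (s : Fin d → Bool) (x : EuclideanSpace ℝ (Fin d)) :
    |signSum s x| ≤ √(d : ℝ) * ‖x‖ := by
  apply Real.abs_le_sqrt _ |>.trans_eq
  · rw [Real.sqrt_mul (Nat.cast_nonneg _), Real.sqrt_sq (norm_nonneg x)]
  · rw [EuclideanSpace.real_norm_sq_eq]
    refine (Finset.sum_mul_sq_le_sq_mul_sq _ _ _).trans_eq ?_
    simp [boolSign_sq]

theorem measurable_signSum {d : ℕ} (s : Fin d → Bool) : Measurable (signSum s) := by
  unfold signSum
  fun_prop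

/-- The ends of the interval allowed for `lam * ε` differ by the factor 2, so it contains a value
with `lam` a power of two. The bounds on `ε` confine the exponent. -/
theorem exists_dyadic_scale {ε : ℝ} (hε : 0 < ε) {L : ℕ} (h1 : ε ≤ 2 ^ L) (h2 : 1 / ε ≤ 2 ^ L) :
    ∃ lam : ℝ, 0 < lam ∧ lam ∈ dyadics L ∧ lam ≤ 2 ^ (L + 1) ∧ 10 / 11 ≤ lam * ε ∧
      lam * ε ≤ 20 / 11 := by
  obtain ⟨z, hz1, hz2⟩ := exists_mem_Ico_zpow (x := (20 / 11) / ε) (y := 2) (by positivity) one_lt_two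
  have hlow : (10 / 11) / ε ≤ 2 ^ z := by
    rw [zpow_add₀ (by norm_num), zpow_one] at hz2
    have : (20 / 11) / ε = 2 * ((10 / 11) / ε) := by ring
    linarith
  have hzL : -(L : ℤ) ≤ z := by
    by_contra! hlt
    have h3 : (2 : ℝ) ^ z ≤ 2 ^ (-(L : ℤ) - 1) := zpow_le_zpow_right₀ one_le_two (by omega)
    have h4 : (2 : ℝ) ^ (-(L : ℤ) - 1) = 1 / 2 ^ L / 2 := by
      rw [zpow_sub₀ (by norm_num), zpow_neg, zpow_natCast, zpow_one]; ring
    have h5 : 1 / 2 ^ L ≤ 1 / ε := one_div_le_one_div_of_le hε h1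
    have h6 : (10 / 11) / ε = 10 / 11 * (1 / ε) := by ring
    have h7 : (0 : ℝ) < 1 / 2 ^ L := by positivity
    rw [h4] at h3
    linarith
  obtain ⟨m, hm⟩ := Int.eq_ofNat_of_zero_le (by omega : 0 ≤ z + L)
  refine ⟨2 ^ z, by positivity, ⟨2 ^ m, ?_⟩, ?_, ?_, ?_⟩
  · rw [show z = (m : ℤ) - L by omega, zpow_sub₀ (by norm_num), zpow_natCast, zpow_natCast]
    push_cast; rfl
  · have : (20 / 11) / ε = 20 / 11 * (1 / ε) := by ring
    have : 0 < 1 / ε := by positivity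
    rw [pow_succ]
    linarith
  · rwa [div_le_iff₀ hε] at hlow
  · rwa [le_div_iff₀ hε] at hz1

theorem badShift_of_mem_Ico {n k : ℕ} (hn : 0 < n) {r : ℝ} {z : ℤ} (h1 : n * z - 1 ≤ n * r + k)
    (h2 : n * r + k < n * z) : BadShift n k r := by
  have hf : ⌊(n : ℝ) * r⌋ + (k : ℤ) = n * z - 1 := by
    rw [← Int.floor_add_natCast, Int.floor_eq_iff]
    push_cast
    constructor <;> linarith
  rw [BadShift, hf, show (n : ℤ) * z - 1 = (n - 1) + n * (z - 1) by ring, Int.add_mul_emod_self_left]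
  exact Int.emod_eq_of_lt (by omega) (by omega)

/-- To jump at an integer, the shifted point would have to cross the last `n`-th of the preceding
cell, where the shift is bad. -/
theorem floor_add_eq_of_not_badShift {n k : ℕ} (hn : 0 < n) {r r' : ℝ} (hr : r ≤ r')
    (h : ∀ s, r ≤ s → s ≤ r' → ¬ BadShift n k s) : ⌊r + k / n⌋ = ⌊r' + k / n⌋ := by
  have hn' : (0 : ℝ) < n := by exact_mod_cast hn
  by_contra hne
  have hlt : ⌊r + k / n⌋ < ⌊r' + k / n⌋ :=
    lt_of_le_of_ne (Int.floor_le_floor (by linarith)) hne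
  set z := ⌊r' + k / n⌋ with hz
  have h1 : r + k / n < z := Int.floor_lt.mp hlt
  have h2 : (z : ℝ) ≤ r' + k / n := Int.floor_le _
  have hnk : (n : ℝ) * (k / n) = k := mul_div_cancel₀ _ hn'.ne'
  have hn1 : (n : ℝ) * (1 / n) = 1 := mul_div_cancel₀ _ hn'.ne'
  have hnp : (0 : ℝ) < 1 / n := by positivity
  refine h (max r (z - k / n - 1 / n)) (le_max_left _ _) (max_le hr (by linarith))
    (badShift_of_mem_Ico hn (z := z) ?_ ?_)
  · have := mul_le_mul_of_nonneg_left (le_max_right r (z - k / n - 1 / n)) hn'.le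
    nlinarith
  · have := mul_lt_mul_of_pos_left (max_lt (by linarith : r < z - k / n)
      (by linarith : (z : ℝ) - k / n - 1 / n < z - k / n)) hn'
    nlinarith

theorem floor_add_eq_of_abs_le {n k : ℕ} (hn : 0 < n) {p r τ : ℝ} (hτ : 0 ≤ τ)
    (h : ∀ s, |s - p| ≤ τ → ¬ BadShift n k s) (hr : |r - p| ≤ τ) :
    ⌊r + k / n⌋ = ⌊p + k / n⌋ := by
  have hr' := abs_le.mp hr
  rcases le_total r p with hle | hle
  · exact floor_add_eq_of_not_badShift hn hle fun s h1 h2 =>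
      h s (abs_le.mpr ⟨by linarith, by linarith⟩)
  · exact (floor_add_eq_of_not_badShift hn hle fun s h1 h2 =>
      h s (abs_le.mpr ⟨by linarith, by linarith⟩)).symm

theorem cond_univ_le_one {E : Type} [MeasurableSpace E] (μ : Measure E) (s : Set E) :
    ProbabilityTheory.cond μ s Set.univ ≤ 1 := by
  rw [ProbabilityTheory.cond]
  simp only [Measure.smul_apply, Measure.restrict_apply_univ, smul_eq_mul]
  exact ENNReal.inv_mul_le_one _

/-! ### The table network for `ρ ≤ 1 / (5 √d)`. -/

namespace Dataset

variable {d N C : ℕ} (D : Dataset d N C)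

/-- With a single block, `blockSq` is the square of the signed sum. Half of `(2 * sep) ^ 2` is `2 *
sep ^ 2`, which exceeds `(7/5 * sep) ^ 2`. -/
theorem exists_separating_signs (hne : ∃ i j, D.y i ≠ D.y j) {L : ℕ} (hN : N ≤ 2 ^ L) :
    ∃ s : ℕ → Fin d → Bool, ∀ i j, D.y i ≠ D.y j → ∃ t < 16 * L + 8,
      7 / 5 * D.sep ≤ |signSum (s t) (D.x i - D.x j)| := by
  obtain ⟨s, hs⟩ := exists_signs (fun _ : Fin d => ()) (Finset.univ : Finset (Fin N × Fin N))
    (fun a k => (D.x a.1 - D.x a.2) k) (p := 2 * L + 1) (by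
      rw [Finset.card_univ, Fintype.card_prod, Fintype.card_fin]
      calc N * N ≤ 2 ^ L * 2 ^ L := Nat.mul_le_mul hN hN
        _ = 2 ^ (2 * L) := by rw [← pow_add]; congr 1; ring
        _ < 2 ^ (2 * L + 1) := Nat.pow_lt_pow_right (by norm_num) (by omega))
  refine ⟨s, fun i j hij => ?_⟩
  obtain ⟨t, ht, h⟩ := hs (i, j) (Finset.mem_univ _)
  refine ⟨t, by omega, ?_⟩
  have hsep := D.sep_pos hne
  have h1 : blockSq (fun _ : Fin d => ()) (fun k => (D.x i - D.x j) k) (s t) =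
      signSum (s t) (D.x i - D.x j) ^ 2 := by
    simp [blockSq, blockSum, signSum]
  have h2 : ∑ k, (D.x i - D.x j) k ^ 2 = ‖D.x i - D.x j‖ ^ 2 :=
    (EuclideanSpace.real_norm_sq_eq _).symm
  simp only at h
  rw [h1, h2] at h
  have h3 := D.two_mul_sep_le hij
  refine abs_le_of_sq_le_sq' ?_ (abs_nonneg _) |>.2
  rw [sq_abs]
  nlinarith

/-- These are the depth and the bit complexity from `exists_net_tables` for the parameters of
`exists_net_grid`: `T = 16 * L + 8`, `q = 3 * L + 4`, `e = 4 * L + 8`, labels of `L` bits and `J =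
h`. -/
theorem grid_size_le {L h G : ℕ} (hL : 2 ≤ L) (hh : 0 < h) (hG : 0 < G) :
    (1 + (4 * (3 * L + 4) + 1) * (16 * L + 8) +
      (1 + 4 * h + (4 * ((3 * L + 4) * (16 * L + 8) + L) + 6) * h)) * G + 2 ≤
        2000 * L ^ 2 * (h * G) ∧
    4 * L + 8 + (((3 * L + 4) * (16 * L + 8) + L) * h + (4 * L + 8 + (3 * L + 4) + 2)) + 2 ≤
      200 * L ^ 2 * h := by
  have hLL : 2 * L ≤ L ^ 2 := by nlinarith
  have hqT : (3 * L + 4) * (16 * L + 8) ≤ 100 * L ^ 2 := by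
    calc (3 * L + 4) * (16 * L + 8) ≤ (5 * L) * (20 * L) := Nat.mul_le_mul (by omega) (by omega)
      _ = 100 * L ^ 2 := by ring
  have h5 : L ^ 2 ≤ L ^ 2 * h := Nat.le_mul_of_pos_right _ hh
  constructor
  · have h1 : 1 + (4 * (3 * L + 4) + 1) * (16 * L + 8) +
        (1 + 4 * h + (4 * ((3 * L + 4) * (16 * L + 8) + L) + 6) * h) ≤ 1000 * L ^ 2 * h := by
      have h2 : (4 * (3 * L + 4) + 1) * (16 * L + 8) ≤ 420 * L ^ 2 := by
        calc _ ≤ (21 * L) * (20 * L) := Nat.mul_le_mul (by omega) (by omega)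
          _ = _ := by ring
      have h3 : (4 * ((3 * L + 4) * (16 * L + 8) + L) + 6) ≤ 410 * L ^ 2 := by omega
      have h4 := Nat.mul_le_mul_right h h3
      have h6 : 4 * h ≤ L ^ 2 * h := Nat.mul_le_mul_right _ (by omega)
      have e1 : 410 * L ^ 2 * h = 410 * (L ^ 2 * h) := by ring
      have e2 : 1000 * L ^ 2 * h = 1000 * (L ^ 2 * h) := by ring
      omega
    have h2 : 1 ≤ h * G := Nat.mul_pos hh hG
    have h3 : 4 * 1 ≤ L ^ 2 * (h * G) := Nat.mul_le_mul (by omega) h2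
    calc _ ≤ 1000 * L ^ 2 * h * G + 2 := by gcongr
      _ = 1000 * (L ^ 2 * (h * G)) + 2 := by ring
      _ ≤ 2000 * (L ^ 2 * (h * G)) := by omega
      _ = _ := by ring
  · have h2 := Nat.mul_le_mul_right h (show (3 * L + 4) * (16 * L + 8) + L ≤ 101 * L ^ 2 by omega)
    have e1 : 101 * L ^ 2 * h = 101 * (L ^ 2 * h) := by ring
    have e2 : 200 * L ^ 2 * h = 200 * (L ^ 2 * h) := by ring
    omega

set_option maxHeartbeats 400000 in
/-- A network of lookup tables, one for each group of at most `M` points, whose error is at most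
`η`; it is correct everywhere if there is only one group. -/
theorem exists_net_grid (hne : ∃ i j, D.y i ≠ D.y j) {η : ℝ} (hη : 0 < η) {L : ℕ}
    (hL : D.SizeBound (1 / η) L) {ρ : ℝ} (hρ0 : 0 < ρ) {M h G : ℕ} (hM : 1 ≤ M) (hMN : M ≤ N)
    (hρ : ρ ≤ 1 / (5 * M * √(d : ℝ))) (hMh : M ≤ h * h) (hG0 : 0 < G) (hGN : G ≤ N)
    (gr : Fin N → ℕ) (hgr : ∀ i, gr i < G)
    (hfib : ∀ g, (Finset.univ.filter fun i => gr i = g).card ≤ M) :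
    ∃ (f : ReLUNet d 1) (B : ℕ), f.depth ≤ 2000 * L ^ 2 * (h * G) ∧ f.width ≤ 30 * L ∧
      f.numParams ≤ 60 * L * d + 1800000 * L ^ 4 * (h * G) ∧ f.HasBitComplexity B ∧
      B ≤ 200 * L ^ 2 * h ∧ D.robustError ρ f.toFun ≤ ENNReal.ofReal η ∧
      (G = 1 → D.RobustlyMemorizes ρ f.toFun) := by
  classical
  have hh : 0 < h := by
    rcases Nat.eq_zero_or_pos h with rfl | hh
    · omega
    · exact hh
  have hsep := D.sep_pos hne
  have hL2 := hL.two_le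
  have hd1 : 1 ≤ d := D.one_le_dim hne
  obtain ⟨s, hs⟩ := D.exists_separating_signs hne hL.card_le
  obtain ⟨lam, hlam0, hlamc, hlamle, hlam1, hlam2⟩ := exists_dyadic_scale hsep
    ((D.sep_le_radius hne).trans hL.radius_le) hL.inv_sep_le
  set ε := D.sep with hε
  set T := 16 * L + 8 with hT
  set q := 3 * L + 4 with hq
  set e := 4 * L + 8 with he
  set n := 2 ^ e with hn
  have hn0 : 0 < n := by positivity
  have hncast : (n : ℝ) = 2 ^ e := by rw [hn]; push_cast; rfl
  -- The offset dominates the scaled sums on the balls, so that they pass the first ReLU unchanged.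
  set ψ : ℕ → EuclideanSpace ℝ (Fin d) → ℝ :=
    fun t x => lam * signSum (s t) x + 2 ^ (3 * L + 2) with hψ
  have hMpos : (0 : ℝ) < M := by exact_mod_cast hM
  have hsd : 0 < √(d : ℝ) := Real.sqrt_pos.mpr (by exact_mod_cast hd1)
  -- the variation of the projections on a ball
  have hball : ∀ t i x, x ∈ Metric.ball (D.x i) (ρ * ε) →
      |signSum (s t) x - signSum (s t) (D.x i)| ≤ ε / (5 * M) := by
    intro t i x hx
    rw [← signSum_sub]
    refine (abs_signSum_le _ _).trans ?_
    rw [Metric.mem_ball, dist_eq_norm] at hx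
    have h1 : √(d : ℝ) * ρ ≤ 1 / (5 * M) := by
      calc √(d : ℝ) * ρ ≤ √(d : ℝ) * (1 / (5 * M * √(d : ℝ))) := by gcongr
        _ = 1 / (5 * M) := by field_simp
    calc √(d : ℝ) * ‖x - D.x i‖ ≤ √(d : ℝ) * (ρ * ε) := by gcongr
      _ = √(d : ℝ) * ρ * ε := by ring
      _ ≤ 1 / (5 * M) * ε := by gcongr
      _ = ε / (5 * M) := by ring
  set τ : ℝ := 4 / (11 * M) with hτ
  have hτ0 : 0 ≤ τ := by positivity
  have hballψ : ∀ t i x, x ∈ Metric.ball (D.x i) (ρ * ε) → |ψ t x - ψ t (D.x i)| ≤ τ := by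
    intro t i x hx
    have h1 : ψ t x - ψ t (D.x i) = lam * (signSum (s t) x - signSum (s t) (D.x i)) := by
      simp only [hψ]; ring
    rw [h1, abs_mul, abs_of_pos hlam0]
    calc lam * |signSum (s t) x - signSum (s t) (D.x i)| ≤ lam * (ε / (5 * M)) := by
          gcongr; exact hball t i x hx
      _ = lam * ε / (5 * M) := by ring
      _ ≤ 20 / 11 / (5 * M) := by gcongr
      _ = τ := by rw [hτ]; field_simp; norm_num
  -- the range of the projections
  have hrange : ∀ t i x, x ∈ Metric.ball (D.x i) (ρ * ε) →
      0 ≤ ψ t x ∧ ψ t x ≤ 2 ^ (3 * L + 3) := by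
    intro t i x hx
    have hρ1 : ρ ≤ 1 := by
      refine hρ.trans ?_
      rw [div_le_one (by positivity)]
      have h1 : (1 : ℝ) ≤ M := by exact_mod_cast hM
      have h2 : (1 : ℝ) ≤ √(d : ℝ) := Real.one_le_sqrt.mpr (by exact_mod_cast hd1)
      nlinarith
    have hx' : ‖x‖ ≤ 2 ^ (L + 1) := by
      rw [Metric.mem_ball, dist_eq_norm] at hx
      have h1 : ‖x‖ ≤ ‖x - D.x i‖ + ‖D.x i‖ := by
        simpa using norm_add_le (x - D.x i) (D.x i)
      have h2 := D.norm_le_radius i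
      have h3 := D.sep_le_radius hne
      have h4 : ρ * ε ≤ 1 * ε := by gcongr
      have h5 := hL.radius_le
      rw [pow_succ]; linarith
    have hsq : √(d : ℝ) ≤ 2 ^ L := by
      rw [Real.sqrt_le_left (by positivity)]
      have h1 : (d : ℝ) ≤ 2 ^ L := by exact_mod_cast hL.dim_le
      have h2 : (1 : ℝ) ≤ 2 ^ L := one_le_pow₀ one_le_two
      nlinarith
    have h1 : |lam * signSum (s t) x| ≤ 2 ^ (3 * L + 2) := by
      rw [abs_mul, abs_of_pos hlam0]
      calc lam * |signSum (s t) x| ≤ 2 ^ (L + 1) * (2 ^ L * 2 ^ (L + 1)) := by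
            gcongr
            exact (abs_signSum_le _ _).trans (by gcongr)
        _ = 2 ^ (3 * L + 2) := by ring
    have h2 := abs_le.mp h1
    simp only [hψ]
    have h3 : (2 : ℝ) ^ (3 * L + 3) = 2 * 2 ^ (3 * L + 2) := by ring
    constructor <;> linarith
  -- the shifts
  have hshift : ∀ g t, ∃ k < n,
      (∀ i ∈ Finset.univ.filter (fun i => gr i = g), ∀ r, |r - ψ t (D.x i)| ≤ τ →
        ¬ BadShift n k r) ∧
      ∀ i, n * ProbabilityTheory.cond volume (Metric.ball (D.x i) (ρ * ε))
        {x | BadShift n k (ψ t x)} ≤ 8 * N := by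
    intro g t
    refine exists_shift (((measurable_signSum (s t)).const_mul _).add_const _) _
      (fun i => cond_univ_le_one _ _) _ (hfib g) (fun i => ψ t (D.x i)) hτ0 hn0 ?_
    -- The count is `8 * n / 11 + 2 * M`, and `2 * M ≤ n / 8` brings it below `7 * n / 8`.
    have h1 : (16 : ℝ) * M ≤ n := by
      have h2 : 16 * M ≤ n := by
        calc 16 * M ≤ 2 ^ 4 * 2 ^ L := Nat.mul_le_mul le_rfl (hMN.trans hL.card_le)
          _ = 2 ^ (4 + L) := by rw [pow_add]
          _ ≤ n := Nat.pow_le_pow_right (by norm_num) (by omega)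
      exact_mod_cast h2
    have h3 : (M : ℝ) * (2 * τ * n + 2) = 8 / 11 * n + 2 * M := by
      rw [hτ]; field_simp; ring
    rw [h3]; linarith
  choose k hkn hksafe hkprob using hshift
  -- keys and tables
  set r : EuclideanSpace ℝ (Fin d) → ℕ → ℕ → ℝ := fun x g t => ψ t x + (k g t : ℝ) / 2 ^ e with hr
  set key : ℕ → EuclideanSpace ℝ (Fin d) → ℕ :=
    fun g x => Layer.codeword q (fun t => ⌊r x g t⌋₊) T with hkey
  have hr0 : ∀ i x, x ∈ Metric.ball (D.x i) (ρ * ε) → ∀ g t, 0 ≤ r x g t ∧ r x g t < 2 ^ q := by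
    intro i x hx g t
    obtain ⟨h1, h2⟩ := hrange t i x hx
    have h3 : (0 : ℝ) ≤ (k g t : ℝ) / 2 ^ e := by positivity
    have h4 : (k g t : ℝ) / 2 ^ e < 1 := by
      rw [div_lt_one (by positivity), ← hncast]
      exact_mod_cast hkn g t
    have h5 : (1 : ℝ) ≤ 2 ^ (3 * L + 3) := one_le_pow₀ one_le_two
    have h6 : (2 : ℝ) ^ q = 2 * 2 ^ (3 * L + 3) := by rw [hq]; ring
    simp only [hr]
    constructor <;> linarith
  have hfloor : ∀ i x, x ∈ Metric.ball (D.x i) (ρ * ε) → ∀ g t, ⌊r x g t⌋₊ < 2 ^ q := by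
    intro i x hx g t
    obtain ⟨h1, h2⟩ := hr0 i x hx g t
    rw [Nat.floor_lt h1]
    exact_mod_cast h2
  have hcenter : ∀ i, D.x i ∈ Metric.ball (D.x i) (ρ * ε) := fun i =>
    Metric.mem_ball_self (by positivity)
  have hkeylt : ∀ i g, key g (D.x i) < 2 ^ (q * T) := fun i g =>
    Layer.codeword_lt fun t _ => hfloor i _ (hcenter i) g t
  -- Equal keys force all projections to agree up to less than 1. For different labels one
  -- projection differs by at least `lam * (7/5 - 1/5) * ε ≥ 12/11`.
  have hdist : ∀ g i j x, x ∈ Metric.ball (D.x j) (ρ * ε) → key g x = key g (D.x i) →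
      D.y i = D.y j := by
    intro g i j x hx hk
    by_contra hij
    obtain ⟨t, ht, hst⟩ := hs i j hij
    have h1 := Layer.codeword_inj (fun t _ => hfloor j x hx g t)
      (fun t _ => hfloor i _ (hcenter i) g t) hk t ht
    have h2 : |r x g t - r (D.x i) g t| < 1 := by
      obtain ⟨a1, -⟩ := hr0 j x hx g t
      obtain ⟨a2, -⟩ := hr0 i _ (hcenter i) g t
      have b1 := Nat.floor_le a1
      have b2 := Nat.floor_le a2
      have c1 := Nat.lt_floor_add_one (r x g t)
      have c2 := Nat.lt_floor_add_one (r (D.x i) g t)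
      rw [h1] at b1 c1
      rw [abs_lt]
      constructor <;> linarith
    have h3 : r x g t - r (D.x i) g t = lam * (signSum (s t) x - signSum (s t) (D.x i)) := by
      simp only [hr, hψ]; ring
    rw [h3, abs_mul, abs_of_pos hlam0] at h2
    have h4 := hball t j x hx
    have h5 : ε / (5 * M) ≤ ε / 5 := by
      apply div_le_div_of_nonneg_left hsep.le (by norm_num)
      have : (1 : ℝ) ≤ M := by exact_mod_cast hM
      linarith
    rw [signSum_sub] at hst
    have h6 : 6 / 5 * ε ≤ |signSum (s t) x - signSum (s t) (D.x i)| := by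
      have h7 := abs_sub_abs_le_abs_sub (signSum (s t) (D.x i) - signSum (s t) (D.x j))
        (signSum (s t) x - signSum (s t) (D.x j))
      rw [show signSum (s t) (D.x i) - signSum (s t) (D.x j) -
        (signSum (s t) x - signSum (s t) (D.x j)) = -(signSum (s t) x - signSum (s t) (D.x i)) by
        ring, abs_neg] at h7
      linarith
    have h8 : lam * (6 / 5 * ε) ≤ lam * |signSum (s t) x - signSum (s t) (D.x i)| := by gcongr
    linarith
  -- By `hdist` all data points with a given key share their label, so the choice of a witness is
  -- immaterial; the default 0 is never used on a stored key.
  set tb : ℕ → Layer.Table := fun g =>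
    { shift := k g
      keys := (Finset.univ.filter fun i => gr i = g).image fun i => key g (D.x i)
      label := fun u => if hu : ∃ i, key g (D.x i) = u then D.y hu.choose else 0 } with htb
  have hmemkeys : ∀ {g u}, u ∈ (tb g).keys → ∃ i, key g (D.x i) = u := by
    intro g u hu
    obtain ⟨i, -, hi⟩ := Finset.mem_image.mp hu
    exact ⟨i, hi⟩
  have hlabel : ∀ g u, (tb g).label u ≤ C := by
    intro g u
    simp only [htb]
    split_ifs with hu
    · exact (Finset.mem_Icc.mp (D.y_mem _)).2
    · exact Nat.zero_le _
  set b := (q * T + L) * h + (e + q + 2) with hb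
  have hpb : ∀ {j : ℕ}, j ≤ b → (2 : ℝ) ^ j ≤ 2 ^ b := fun hj => pow_le_pow_right₀ one_le_two hj
  have hClt : C + 2 ≤ 2 ^ L := hL.label_le
  obtain ⟨f, hdepth, hwidth, hparams, hbits, hf⟩ := exists_net_tables (d := d) (T := T) (by omega)
    (e := e) (q := q) (m := L) (C := C) (h := h) (J := h) (G := G) (c := e) (b := b)
    (fun t => (fun j => lam * boolSign (s t j), (2 : ℝ) ^ (3 * L + 2))) (by
      intro t _
      refine ⟨fun j => ?_, two_pow_mem_dyadics _ _, ?_⟩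
      · obtain ⟨z, hz⟩ := hlamc
        have hmem : lam ∈ dyadics e := by
          rw [hz]; exact int_div_two_pow_mem_dyadics (by omega) z
        have hle : |lam| ≤ 2 ^ b := by
          rw [abs_of_pos hlam0]; exact hlamle.trans (hpb (by omega))
        rcases boolSign_eq (s t j) with h1 | h1 <;> simp only [h1]
        · simpa using ⟨hmem, hle⟩
        · simpa using ⟨hmem, hle⟩
      · rw [abs_of_pos (by positivity)]
        exact hpb (by omega))
    tb le_rfl hh (fun g _ t _ => (hkn g t).le)
    (fun g _ => (Finset.card_image_le.trans (hfib g)).trans hMh)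
    (fun g _ u hu => by
      obtain ⟨i, rfl⟩ := hmemkeys hu
      exact hkeylt i g)
    (fun g _ u _ => (hlabel g u).trans_lt (by omega)) (fun g _ u _ => hlabel g u)
    (by omega) (by omega) (by
      have h1 : (C : ℝ) + 2 ≤ 2 ^ L := by exact_mod_cast hClt
      have h2 : (2 : ℝ) ^ (L + 1) ≤ 2 ^ b := hpb (by omega)
      rw [pow_succ] at h2
      linarith)
  have heval : ∀ t (x : EuclideanSpace ℝ (Fin d)),
      AffForm.eval ((fun j => lam * boolSign (s t j), (2 : ℝ) ^ (3 * L + 2)) : AffForm (Fin d))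
        (fun j => x j) = ψ t x := by
    intro t x
    simp only [AffForm.eval, hψ, signSum, Finset.mul_sum, mul_assoc]
  -- Extraction has to be exact in every table. The table of the point's own group contains its key,
  -- since the cells are constant on the ball; any other table misses the key or stores the right
  -- label by `hdist`.
  have hcorrect : ∀ i x, x ∈ Metric.ball (D.x i) (ρ * ε) →
      (∀ g < G, ∀ t < T, ¬ BadShift n (k g t) (ψ t x)) → f.toFun x = D.y i := by
    intro i x hx hgood
    refine hf x (D.y i) (r x) (fun g _ t _ => by rw [heval]) (fun t _ => ?_) (fun g hg t ht => ?_)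
      (fun g _ t _ => (hr0 i x hx g t).2) (fun g _ hu => ?_) ⟨gr i, hgr i, ?_⟩
    · rw [heval]; exact (hrange t i x hx).1
    · have := fract_le_of_not_badShift hn0 (hgood g hg t ht)
      rw [hncast] at this
      exact this
    · have hex := hmemkeys hu
      have : (tb g).label (key g x) = D.y hex.choose := dif_pos hex
      refine this.trans (hdist g _ i x hx hex.choose_spec.symm)
    · refine Finset.mem_image.mpr ⟨i, by simp, ?_⟩
      simp only [hkey]
      congr 1
      funext t
      have h1 := floor_add_eq_of_abs_le hn0 hτ0 (hksafe (gr i) t i (by simp)) (hballψ t i x hx)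
      rw [hncast] at h1
      simp only [hr, ← Int.floor_toNat]
      rw [h1]
  have hbadprob : ∀ i, ProbabilityTheory.cond volume (Metric.ball (D.x i) (ρ * ε))
      {x | f.toFun x ≠ D.y i} ≤ ENNReal.ofReal η := by
    intro i
    set P := ProbabilityTheory.cond volume (Metric.ball (D.x i) (ρ * ε)) with hP
    set U : Set (EuclideanSpace ℝ (Fin d)) :=
      ⋃ g ∈ Finset.range G, ⋃ t ∈ Finset.range T, {x | BadShift n (k g t) (ψ t x)} with hU
    have h1 : P {x | f.toFun x ≠ D.y i} ≤ P U := by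
      rw [hP, ProbabilityTheory.cond_apply measurableSet_ball,
        ProbabilityTheory.cond_apply measurableSet_ball]
      refine mul_le_mul_right (measure_mono ?_) _
      rintro x ⟨hx, hfx⟩
      refine ⟨hx, ?_⟩
      by_contra hxU
      refine hfx (hcorrect i x hx fun g hg t ht hbad => hxU ?_)
      simp only [hU, Set.mem_iUnion, Finset.mem_range]
      exact ⟨g, hg, t, ht, hbad⟩
    have h2 : P U ≤ ∑ g ∈ Finset.range G, ∑ t ∈ Finset.range T,
        P {x | BadShift n (k g t) (ψ t x)} :=
      (measure_biUnion_finset_le _ _).trans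
        (Finset.sum_le_sum fun g _ => measure_biUnion_finset_le _ _)
    have h3 : (n : ℝ≥0∞) * P {x | f.toFun x ≠ D.y i} ≤ n * ENNReal.ofReal η := by
      calc (n : ℝ≥0∞) * P {x | f.toFun x ≠ D.y i}
          ≤ n * ∑ g ∈ Finset.range G, ∑ t ∈ Finset.range T,
            P {x | BadShift n (k g t) (ψ t x)} := by gcongr; exact h1.trans h2
        _ ≤ ∑ _g ∈ Finset.range G, ∑ _t ∈ Finset.range T, (8 * N : ℝ≥0∞) := by
            rw [Finset.mul_sum]
            refine Finset.sum_le_sum fun g _ => ?_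
            rw [Finset.mul_sum]
            exact Finset.sum_le_sum fun t _ => hkprob g t i
        _ = ENNReal.ofReal (G * (T * (8 * N))) := by
            rw [Finset.sum_const, Finset.sum_const, Finset.card_range, Finset.card_range,
              nsmul_eq_mul, nsmul_eq_mul]
            rw [show (G : ℝ) * (T * (8 * N)) = ((G * (T * (8 * N)) : ℕ) : ℝ) by push_cast; rfl,
              ENNReal.ofReal_natCast]
            push_cast; rfl
        _ ≤ ENNReal.ofReal (n * η) := by
            apply ENNReal.ofReal_le_ofReal
            have a1 : (G : ℝ) ≤ 2 ^ L := by exact_mod_cast hGN.trans hL.card_le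
            have a2 : (N : ℝ) ≤ 2 ^ L := by exact_mod_cast hL.card_le
            have a3 : (T : ℝ) ≤ 2 ^ (L + 5) := by
              have : L < 2 ^ L := Nat.lt_two_pow_self
              have : T ≤ 2 ^ (L + 5) := by rw [pow_add]; omega
              exact_mod_cast this
            have a4 : 1 ≤ 2 ^ L * η := by
              have := hL.le
              rwa [div_le_iff₀ hη] at this
            -- The exponent `4 * L + 8` of `n` is spent on `G`, `T`, `8 * N` and `1 / η`.
            have a5 : (n : ℝ) = 2 ^ L * (2 ^ (L + 5) * (8 * 2 ^ L)) * 2 ^ L := by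
              rw [hncast, he]; ring
            rw [a5, mul_assoc _ _ η]
            calc (G : ℝ) * (T * (8 * N)) ≤ 2 ^ L * (2 ^ (L + 5) * (8 * 2 ^ L)) := by gcongr
              _ ≤ 2 ^ L * (2 ^ (L + 5) * (8 * 2 ^ L)) * (2 ^ L * η) :=
                le_mul_of_one_le_right (by positivity) a4
        _ = n * ENNReal.ofReal η := by
            rw [ENNReal.ofReal_mul (by positivity), ENNReal.ofReal_natCast]
    exact (ENNReal.mul_le_mul_iff_right (by exact_mod_cast hn0.ne') (ENNReal.natCast_ne_top n)).mp h3
  obtain ⟨hdepth', hbits'⟩ := grid_size_le hL2 hh hG0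
  rw [← hdepth] at hdepth'
  refine ⟨f, e + b + 2, hdepth', hwidth.trans (by omega), ?_, hbits, ?_, iSup_le hbadprob, ?_⟩
  · calc f.numParams ≤ (d + 1) * (T + 9) + f.depth * (T + 9) ^ 2 := hparams
      _ ≤ (2 * d) * (30 * L) + 2000 * L ^ 2 * (h * G) * (30 * L) ^ 2 := by
        gcongr <;> omega
      _ = _ := by ring
  · exact hbits'
  -- A single group makes its shift safe on every ball, so no exceptional set is left.
  · rintro rfl i x hx
    refine hcorrect i x hx fun g hg t _ => ?_
    obtain rfl : g = gr i := by have := hgr i; omega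
    exact hksafe (gr i) t i (by simp) _ (hballψ t i x hx)

end Dataset

/-! ### Choice of the group size for small and middle radii. -/

namespace Dataset

variable {d N C : ℕ} (D : Dataset d N C)

theorem exists_sqrt_ceil {M : ℕ} (hM : 1 ≤ M) :
    ∃ h : ℕ, M ≤ h * h ∧ (h : ℝ) ≤ 2 * √(M : ℝ) := by
  refine ⟨⌈√(M : ℝ)⌉₊, ?_, ?_⟩
  · have h1 := Nat.le_ceil (√(M : ℝ))
    have h2 : (M : ℝ) ≤ (⌈√(M : ℝ)⌉₊ : ℝ) * ⌈√(M : ℝ)⌉₊ := by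
      calc (M : ℝ) = √(M : ℝ) * √(M : ℝ) := (Real.mul_self_sqrt (Nat.cast_nonneg _)).symm
        _ ≤ _ := by gcongr
    exact_mod_cast h2
  · have h1 := (Nat.ceil_lt_add_one (Real.sqrt_nonneg (M : ℝ))).le
    have h2 : 1 ≤ √(M : ℝ) := Real.one_le_sqrt.mpr (by exact_mod_cast hM)
    linarith

theorem pow_le_of_le_three_mul {L : ℕ} {lam : ℝ} (h1 : 1 ≤ lam) (hL : (L : ℝ) ≤ 3 * lam) {j k : ℕ}
    (hjk : j ≤ k) : (L : ℝ) ^ j ≤ 3 ^ j * lam ^ k := by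
  calc (L : ℝ) ^ j ≤ (3 * lam) ^ j := by gcongr
    _ = 3 ^ j * lam ^ j := mul_pow _ _ _
    _ ≤ 3 ^ j * lam ^ k := by gcongr

/-- One group with `M = N`. The error bound is not used, so its `η` is set to the dummy value `1/2`.
-/
theorem exists_net_small (hne : ∃ i j, D.y i ≠ D.y j) {ρ : ℝ} (hρ0 : 0 < ρ)
    (hρ : ρ ≤ 1 / (5 * N * √(d : ℝ))) :
    ∃ (f : ReLUNet d 1) (B : ℕ), D.RobustlyMemorizes ρ f.toFun ∧
      (f.numParams : ℝ) ≤ 3000000000 * D.logFactor 0 ^ 4 * (√(N : ℝ) + d) ∧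
      (f.depth : ℝ) ≤ 3000000000 * D.logFactor 0 ^ 4 * √(N : ℝ) ∧
      (f.width : ℝ) ≤ 3000000000 * D.logFactor 0 ^ 4 ∧ f.HasBitComplexity B ∧
      (B : ℝ) ≤ 3000000000 * D.logFactor 0 ^ 4 * √(N : ℝ) := by
  obtain ⟨hlam, L, hL, hL3⟩ := D.exists_sizeBound hne le_rfl
  set lam := D.logFactor 0
  have hN := D.two_le_card hne
  obtain ⟨h, hh1, hh2⟩ := exists_sqrt_ceil (M := N) (by omega)
  have hL' : D.SizeBound (1 / (1 / 2)) L := { hL with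
    le := by
      have : (2 : ℝ) ^ 1 ≤ 2 ^ L := pow_le_pow_right₀ one_le_two (by have := hL.two_le; omega)
      norm_num at this ⊢
      exact this }
  obtain ⟨f, B, h1, h2, h3, h4, h5, -, h7⟩ := D.exists_net_grid hne one_half_pos hL' hρ0
    (by omega : 1 ≤ N) le_rfl hρ hh1 one_pos (by omega) (fun _ => 0) (fun _ => one_pos)
    (fun g => (Finset.card_filter_le _ _).trans (by simp))
  have p1 := pow_le_of_le_three_mul hlam hL3 (by norm_num : 1 ≤ 4)
  have p2 := pow_le_of_le_three_mul hlam hL3 (by norm_num : 2 ≤ 4)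
  have p4 := pow_le_of_le_three_mul hlam hL3 (by norm_num : 4 ≤ 4)
  have hl4 : 0 < lam ^ 4 := by positivity
  have hs : 0 ≤ √(N : ℝ) := Real.sqrt_nonneg _
  have hd : (0 : ℝ) ≤ d := Nat.cast_nonneg _
  simp only [mul_one] at h1 h3
  refine ⟨f, B, h7 rfl, ?_, ?_, ?_, h4, ?_⟩
  · calc (f.numParams : ℝ) ≤ 60 * (L : ℝ) ^ 1 * d + 1800000 * (L : ℝ) ^ 4 * h := by
          rw [pow_one]; exact_mod_cast h3
      _ ≤ 60 * (3 ^ 1 * lam ^ 4) * d + 1800000 * (3 ^ 4 * lam ^ 4) * (2 * √(N : ℝ)) := by gcongr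
      _ ≤ _ := by
          have : 0 ≤ lam ^ 4 * d := by positivity
          have : 0 ≤ lam ^ 4 * √(N : ℝ) := by positivity
          linarith
  · calc (f.depth : ℝ) ≤ 2000 * (L : ℝ) ^ 2 * h := by exact_mod_cast h1
      _ ≤ 2000 * (3 ^ 2 * lam ^ 4) * (2 * √(N : ℝ)) := by gcongr
      _ ≤ _ := by
          have : 0 ≤ lam ^ 4 * √(N : ℝ) := by positivity
          linarith
  · calc (f.width : ℝ) ≤ 30 * (L : ℝ) ^ 1 := by rw [pow_one]; exact_mod_cast h2
      _ ≤ 30 * (3 ^ 1 * lam ^ 4) := by gcongr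
      _ ≤ _ := by linarith
  · calc (B : ℝ) ≤ 200 * (L : ℝ) ^ 2 * h := by exact_mod_cast h5
      _ ≤ 200 * (3 ^ 2 * lam ^ 4) * (2 * √(N : ℝ)) := by gcongr
      _ ≤ _ := by
          have : 0 ≤ lam ^ 4 * √(N : ℝ) := by positivity
          linarith

theorem card_filter_div_le {N M : ℕ} (hM : 0 < M) (g : ℕ) :
    (Finset.univ.filter fun i : Fin N => (i : ℕ) / M = g).card ≤ M := by
  have hmaps : Set.MapsTo (fun i : Fin N => (i : ℕ))
      (Finset.univ.filter fun i : Fin N => (i : ℕ) / M = g) (Finset.Ico (g * M) (g * M + M)) := by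
    intro i hi
    have := (Nat.div_eq_iff hM).mp (Finset.mem_filter.mp (Finset.mem_coe.mp hi)).2
    simp only [Finset.coe_Ico, Set.mem_Ico]
    omega
  simpa using Finset.card_le_card_of_injOn _ hmaps (Fin.val_injective.injOn)

/-- With `u ^ 2 = √d * ρ`, the largest admissible group has about `1 / (5 * u ^ 2)` points. Up to
constants and logarithms a table costs `√M`, or `1 / u`, layers, and `N / M`, or `N * u ^ 2`, tables
are needed, in total `N * u`. The two bounds on `ρ` say that `M ≤ N` and `1 ≤ M`. -/
theorem exists_net_middle (hne : ∃ i j, D.y i ≠ D.y j) {η : ℝ} (hη : 0 < η) {ρ : ℝ}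
    (hρ1 : 1 / (5 * N * √(d : ℝ)) < ρ) (hρ2 : ρ ≤ 1 / (5 * √(d : ℝ))) :
    ∃ (f : ReLUNet d 1) (B : ℕ), D.robustError ρ f.toFun ≤ ENNReal.ofReal η ∧
      (f.numParams : ℝ) ≤ 3000000000 * D.logFactor (1 / η) ^ 4 *
        (N * (d : ℝ) ^ (1 / 4 : ℝ) * ρ ^ (1 / 2 : ℝ) + d) ∧
      (f.depth : ℝ) ≤ 3000000000 * D.logFactor (1 / η) ^ 4 *
        (N * (d : ℝ) ^ (1 / 4 : ℝ) * ρ ^ (1 / 2 : ℝ)) ∧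
      (f.width : ℝ) ≤ 3000000000 * D.logFactor (1 / η) ^ 4 ∧ f.HasBitComplexity B ∧
      (B : ℝ) ≤ 3000000000 * D.logFactor (1 / η) ^ 4 *
        (1 / ((d : ℝ) ^ (1 / 4 : ℝ) * ρ ^ (1 / 2 : ℝ))) := by
  obtain ⟨hlam, L, hL, hL3⟩ := D.exists_sizeBound hne (by positivity : 0 ≤ 1 / η)
  set lam := D.logFactor (1 / η)
  have hN := D.two_le_card hne
  have hN0 : (0 : ℝ) < N := by exact_mod_cast (by omega : 0 < N)
  have hd1 := D.one_le_dim hne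
  have hd0 : (0 : ℝ) < d := by exact_mod_cast hd1
  have hsd : 0 < √(d : ℝ) := Real.sqrt_pos.mpr hd0
  have hρ0 : 0 < ρ := lt_trans (by positivity) hρ1
  set u := (d : ℝ) ^ (1 / 4 : ℝ) * ρ ^ (1 / 2 : ℝ) with hu
  have hu0 : 0 < u := by positivity
  have hu2 : u ^ 2 = √(d : ℝ) * ρ := by
    rw [hu, mul_pow, ← Real.rpow_natCast, ← Real.rpow_natCast, ← Real.rpow_mul hd0.le,
      ← Real.rpow_mul hρ0.le, Real.sqrt_eq_rpow]
    norm_num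
  set M := ⌊1 / (5 * u ^ 2)⌋₊ with hM
  have hge1 : 1 ≤ 1 / (5 * u ^ 2) := by
    rw [le_div_iff₀ (by positivity)] at hρ2 ⊢
    rw [hu2]; linarith
  have hM1 : 1 ≤ M := Nat.le_floor (by exact_mod_cast hge1)
  have hMle : (M : ℝ) ≤ 1 / (5 * u ^ 2) := Nat.floor_le (by positivity)
  have hMgt : 1 / (10 * u ^ 2) ≤ M := by
    have h1 := Nat.lt_floor_add_one (1 / (5 * u ^ 2))
    rw [← hM] at h1
    have h2 : (1 : ℝ) ≤ M := by exact_mod_cast hM1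
    have h3 : 1 / (10 * u ^ 2) = 1 / (5 * u ^ 2) / 2 := by field_simp; norm_num
    rw [h3]; linarith
  have hMN : M ≤ N := by
    have h1 : (M : ℝ) ≤ N := by
      refine hMle.trans ?_
      rw [div_lt_iff₀ (by positivity)] at hρ1
      rw [div_le_iff₀ (by positivity), hu2]
      linarith
    exact_mod_cast h1
  have hMpos : (0 : ℝ) < M := by exact_mod_cast hM1
  have hρM : ρ ≤ 1 / (5 * M * √(d : ℝ)) := by
    rw [le_div_iff₀ (by positivity)] at hMle ⊢
    rw [hu2] at hMle
    linarith
  obtain ⟨h, hh1, hh2⟩ := exists_sqrt_ceil hM1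
  -- Using `N - 1` instead of `N` keeps `G ≤ N` even when `M = 1`.
  set G := (N - 1) / M + 1 with hG
  have hGN : G ≤ N := by
    have := Nat.div_le_self (N - 1) M
    omega
  have hGM : (G : ℝ) * M ≤ 2 * N := by
    have h1 : G * M ≤ 2 * N := by
      have := Nat.div_mul_le_self (N - 1) M
      rw [hG, add_mul]; omega
    exact_mod_cast h1
  obtain ⟨f, B, h1, h2, h3, h4, h5, h6, -⟩ := D.exists_net_grid hne hη hL hρ0 hM1 hMN hρM hh1
    (Nat.succ_pos _ : 0 < G) hGN (fun i => i / M)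
    (fun i => Nat.lt_succ_of_le (Nat.div_le_div_right (by omega)))
    (fun g => card_filter_div_le hM1 g)
  have hsM : 0 < √(M : ℝ) := Real.sqrt_pos.mpr hMpos
  have hsM2 : √(M : ℝ) ^ 2 = M := Real.sq_sqrt hMpos.le
  have hb1 : √(M : ℝ) ≤ 1 / u := by
    rw [Real.sqrt_le_left (by positivity)]
    refine hMle.trans ?_
    rw [div_pow, one_pow]
    exact one_div_le_one_div_of_le (by positivity) (by nlinarith [sq_nonneg u])
  have hb2 : 1 ≤ 4 * u * √(M : ℝ) := by
    rw [div_le_iff₀ (by positivity)] at hMgt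
    have : 1 ≤ (4 * u * √(M : ℝ)) ^ 2 := by
      rw [mul_pow, mul_pow, hsM2]
      nlinarith [sq_nonneg u]
    by_contra! hlt
    nlinarith [mul_pos hu0 hsM]
  have hhG : (h : ℝ) * G ≤ 16 * (N * u) := by
    have e1 : (h : ℝ) * G ≤ 2 * √(M : ℝ) * G := by gcongr
    have e2 : 2 * √(M : ℝ) * G ≤ 2 * √(M : ℝ) * G * (4 * u * √(M : ℝ)) :=
      le_mul_of_one_le_right (by positivity) hb2
    have e3 : 2 * √(M : ℝ) * G * (4 * u * √(M : ℝ)) = 8 * u * (G * √(M : ℝ) ^ 2) := by ring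
    rw [hsM2] at e3
    have e4 : 8 * u * (G * M) ≤ 8 * u * (2 * N) := by gcongr
    linarith
  have hhu : (h : ℝ) ≤ 2 * (1 / u) := by linarith
  have p1 := pow_le_of_le_three_mul hlam hL3 (by norm_num : 1 ≤ 4)
  have p2 := pow_le_of_le_three_mul hlam hL3 (by norm_num : 2 ≤ 4)
  have p4 := pow_le_of_le_three_mul hlam hL3 (by norm_num : 4 ≤ 4)
  have hl4 : 0 < lam ^ 4 := by positivity
  have hNu : (N : ℝ) * (d : ℝ) ^ (1 / 4 : ℝ) * ρ ^ (1 / 2 : ℝ) = N * u := by rw [hu]; ring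
  rw [hNu]
  have w1 : 0 ≤ lam ^ 4 * d := by positivity
  have w2 : 0 ≤ lam ^ 4 * (N * u) := by positivity
  have w3 : 0 ≤ lam ^ 4 * (1 / u) := by positivity
  refine ⟨f, B, h6, ?_, ?_, ?_, h4, ?_⟩
  · calc (f.numParams : ℝ) ≤ 60 * (L : ℝ) ^ 1 * d + 1800000 * (L : ℝ) ^ 4 * (h * G) := by
          rw [pow_one]; exact_mod_cast h3
      _ ≤ 60 * (3 ^ 1 * lam ^ 4) * d + 1800000 * (3 ^ 4 * lam ^ 4) * (16 * (N * u)) := by gcongr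
      _ ≤ _ := by linarith
  · calc (f.depth : ℝ) ≤ 2000 * (L : ℝ) ^ 2 * (h * G) := by exact_mod_cast h1
      _ ≤ 2000 * (3 ^ 2 * lam ^ 4) * (16 * (N * u)) := by gcongr
      _ ≤ _ := by linarith
  · calc (f.width : ℝ) ≤ 30 * (L : ℝ) ^ 1 := by rw [pow_one]; exact_mod_cast h2
      _ ≤ 30 * (3 ^ 1 * lam ^ 4) := by gcongr
      _ ≤ _ := by linarith
  · calc (B : ℝ) ≤ 200 * (L : ℝ) ^ 2 * h := by exact_mod_cast h5
      _ ≤ 200 * (3 ^ 2 * lam ^ 4) * (2 * (1 / u)) := by gcongr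
      _ ≤ _ := by linarith

end Dataset

/-! ### Approximation of the square by tent maps. -/

/-- The tent map on the unit interval, as a combination of two rectified functions. -/
noncomputable def tent (x : ℝ) : ℝ := 2 * max x 0 - 4 * max (x - 1 / 2) 0

theorem tent_mem {x : ℝ} (h0 : 0 ≤ x) (h1 : x ≤ 1) : 0 ≤ tent x ∧ tent x ≤ 1 := by
  rw [tent, max_eq_left h0]
  rcases le_total x (1 / 2) with h | h
  · rw [max_eq_right (by linarith)]; constructor <;> linarith
  · rw [max_eq_left (by linarith)]; constructor <;> linarith

/-- Up to a factor 4, `x - x ^ 2` reproduces itself at `tent x`; iteration gives the series for `x ^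
2` that `sqApprox` truncates. -/
theorem sub_sq_eq_tent {x : ℝ} (h0 : 0 ≤ x) :
    x - x ^ 2 = tent x / 4 + (tent x - tent x ^ 2) / 4 := by
  rw [tent, max_eq_left h0]
  rcases le_total x (1 / 2) with h | h
  · rw [max_eq_right (by linarith)]; ring
  · rw [max_eq_left (by linarith)]; ring

/-- The piecewise linear approximation of the square with `2 ^ n` pieces. -/
noncomputable def sqApprox (n : ℕ) (x : ℝ) : ℝ :=
  x - ∑ i ∈ Finset.range n, tent^[i + 1] x / 4 ^ (i + 1)

theorem sqApprox_succ (n : ℕ) (x : ℝ) :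
    sqApprox (n + 1) x = sqApprox n x - tent^[n + 1] x / 4 ^ (n + 1) := by
  rw [sqApprox, Finset.sum_range_succ, sqApprox]; ring

theorem tent_iterate_mem (n : ℕ) {x : ℝ} (h0 : 0 ≤ x) (h1 : x ≤ 1) :
    0 ≤ tent^[n] x ∧ tent^[n] x ≤ 1 := by
  induction n with
  | zero => exact ⟨h0, h1⟩
  | succ n ih => rw [Function.iterate_succ_apply']; exact tent_mem ih.1 ih.2

/-- The remainder is nonnegative on the unit interval, so the approximation is from above, and it
loses a factor 4 with each term. -/
theorem sqApprox_sub_sq (n : ℕ) {x : ℝ} (h0 : 0 ≤ x) (h1 : x ≤ 1) :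
    sqApprox n x - x ^ 2 = (tent^[n] x - tent^[n] x ^ 2) / 4 ^ n := by
  induction n with
  | zero => simp [sqApprox]
  | succ n ih =>
    have h2 := sub_sq_eq_tent (tent_iterate_mem n h0 h1).1
    rw [← Function.iterate_succ_apply' tent] at h2
    rw [sqApprox_succ, sub_right_comm, ih, h2, pow_succ]
    field_simp
    ring

theorem sq_le_sqApprox (n : ℕ) {x : ℝ} (h0 : 0 ≤ x) (h1 : x ≤ 1) : x ^ 2 ≤ sqApprox n x := by
  have h2 := sqApprox_sub_sq n h0 h1
  obtain ⟨h3, h4⟩ := tent_iterate_mem n h0 h1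
  have : 0 ≤ (tent^[n] x - tent^[n] x ^ 2) / 4 ^ n := div_nonneg (by nlinarith) (by positivity)
  linarith

theorem sqApprox_le (n : ℕ) {x : ℝ} (h0 : 0 ≤ x) (h1 : x ≤ 1) :
    sqApprox n x ≤ x ^ 2 + 1 / 4 ^ n := by
  have h2 := sqApprox_sub_sq n h0 h1
  obtain ⟨h3, h4⟩ := tent_iterate_mem n h0 h1
  have : (tent^[n] x - tent^[n] x ^ 2) / 4 ^ n ≤ 1 / 4 ^ n := by gcongr; nlinarith
  linarith

/-! ### Comparing distances with a threshold. -/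

namespace Layer

open AffForm

/-- Registers for the distance computation: for each coordinate its value and two temporary
registers; and an accumulator, a temporary register and the output. -/
abbrev DistReg (m : ℕ) : Type := (Fin m × Fin 3) ⊕ Fin 3

variable {m : ℕ}

/-- Computes the positive and negative parts of the differences to `ctr`. -/
noncomputable def diffLayer (ctr : Fin m → ℝ) : Layer (DistReg m) :=
  Sum.elim (fun k => ![reg (Sum.inl (k.1, 0)), reg (Sum.inl (k.1, 0)) - const (ctr k.1),
    const (ctr k.1) - reg (Sum.inl (k.1, 0))] k.2) ![const 0, const 0, reg (Sum.inr 2)]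

/-- Starts the tent maps and the accumulator with the absolute values of the differences. -/
noncomputable def absLayer : Layer (DistReg m) :=
  Sum.elim (fun k => ![reg (Sum.inl (k.1, 0)), reg (Sum.inl (k.1, 1)) + reg (Sum.inl (k.1, 2)),
    reg (Sum.inl (k.1, 1)) + reg (Sum.inl (k.1, 2)) - const (1 / 2)] k.2)
    ![∑ k, (reg (Sum.inl (k, 1)) + reg (Sum.inl (k, 2))), const 0, reg (Sum.inr 2)]

/-- Iterates the tent map and corrects the accumulator. -/
noncomputable def tentLayer (j : ℕ) : Layer (DistReg m) :=
  Sum.elim (fun k => ![reg (Sum.inl (k.1, 0)),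
    (2 : ℝ) • reg (Sum.inl (k.1, 1)) - (4 : ℝ) • reg (Sum.inl (k.1, 2)),
    (2 : ℝ) • reg (Sum.inl (k.1, 1)) - (4 : ℝ) • reg (Sum.inl (k.1, 2)) - const (1 / 2)] k.2)
    ![reg (Sum.inr 0) - ∑ k, ((2 / 4 ^ j : ℝ) • reg (Sum.inl (k, 1)) -
      (4 / 4 ^ j : ℝ) • reg (Sum.inl (k, 2))), const 0, reg (Sum.inr 2)]

/-- The first `n` tent layers. -/
noncomputable def tents : ℕ → List (Layer (DistReg m))
  | 0 => []
  | n + 1 => tents n ++ [tentLayer (n + 1)]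

/-- Replaces the output by its maximum with `y` if the registers are close to `ctr`. -/
noncomputable def ballProgram (ctr : Fin m → ℝ) (α : ℝ) (A y n : ℕ) : List (Layer (DistReg m)) :=
  diffLayer ctr :: absLayer :: (tents n ++
    [assign (Sum.inr 1) (reg (Sum.inr 0) - const α),
      assign (Sum.inr 1) (const y - (A : ℝ) • reg (Sum.inr 1) - reg (Sum.inr 2)),
      assign (Sum.inr 2) (reg (Sum.inr 2) + reg (Sum.inr 1))])

theorem length_tents (n : ℕ) : (tents (m := m) n).length = n := by
  induction n with
  | zero => rfl
  | succ n ih => simp [tents, ih]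

/-- The two temporary registers hold exactly the rectified values from which the next tent iterate
is an affine combination. The accumulator dominates a sum of squares, so the ReLU never truncates
it. -/
theorem run_tents {σ : DistReg m → ℝ} (hσ : 0 ≤ σ) {h : Fin m → ℝ} (h0 : ∀ k, 0 ≤ h k)
    (h1 : ∀ k, h k ≤ 1) (hp : ∀ k, σ (Sum.inl (k, 1)) = max (h k) 0)
    (hq : ∀ k, σ (Sum.inl (k, 2)) = max (h k - 1 / 2) 0) (ha : σ (Sum.inr 0) = ∑ k, h k) (n : ℕ) :
    (∀ k, run (tents n) σ (Sum.inl (k, 0)) = σ (Sum.inl (k, 0))) ∧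
    (∀ k, run (tents n) σ (Sum.inl (k, 1)) = max (tent^[n] (h k)) 0) ∧
    (∀ k, run (tents n) σ (Sum.inl (k, 2)) = max (tent^[n] (h k) - 1 / 2) 0) ∧
    run (tents n) σ (Sum.inr 0) = ∑ k, sqApprox n (h k) ∧
    run (tents n) σ (Sum.inr 2) = σ (Sum.inr 2) := by
  induction n with
  | zero => simp [tents, hp, hq, ha, sqApprox]
  | succ n ih =>
    obtain ⟨a0, a1, a2, a3, a4⟩ := ih
    rw [tents, run_append, run_cons, run_nil]
    set σ1 := run (tents n) σ
    have ht : ∀ k, 2 * max (tent^[n] (h k)) 0 - 4 * max (tent^[n] (h k) - 1 / 2) 0 =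
        tent^[n + 1] (h k) := fun k => by rw [Function.iterate_succ_apply', tent]
    refine ⟨fun k => ?_, fun k => ?_, fun k => ?_, ?_, ?_⟩
    · simp only [step, tentLayer, Sum.elim_inl, Matrix.cons_val_zero, eval_reg]
      rw [a0]; exact max_eq_left (hσ _)
    · simp only [step, tentLayer, Sum.elim_inl, Matrix.cons_val_one, Matrix.cons_val_zero, eval_sub,
        eval_smul, eval_reg, a1, a2, ht]
    · simp only [step, tentLayer, Sum.elim_inl, Matrix.cons_val, eval_sub,
        eval_smul, eval_reg, eval_const, a1, a2, ht]
    · simp only [step, tentLayer, Sum.elim_inr, Matrix.cons_val_zero, eval_sub, eval_sum,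
        eval_smul, eval_reg, a1, a2, a3]
      have e1 : ∑ k, sqApprox n (h k) - ∑ k, (2 / 4 ^ (n + 1) * max (tent^[n] (h k)) 0 -
          4 / 4 ^ (n + 1) * max (tent^[n] (h k) - 1 / 2) 0) = ∑ k, sqApprox (n + 1) (h k) := by
        rw [← Finset.sum_sub_distrib]
        refine Finset.sum_congr rfl fun k _ => ?_
        rw [sqApprox_succ, ← ht k]
        ring
      rw [e1]
      exact max_eq_left (Finset.sum_nonneg fun k _ =>
        (sq_nonneg _).trans (sq_le_sqApprox _ (h0 k) (h1 k)))
    · simp only [step, tentLayer, Sum.elim_inr, Matrix.cons_val, eval_reg]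
      rw [a4]; exact max_eq_left (hσ _)

theorem run_ballProgram {σ : DistReg m → ℝ} (hσ : 0 ≤ σ) {ctr : Fin m → ℝ} (α : ℝ) (A y n : ℕ)
    (hc : ∀ k, |σ (Sum.inl (k, 0)) - ctr k| ≤ 1) :
    (∀ k, run (ballProgram ctr α A y n) σ (Sum.inl (k, 0)) = σ (Sum.inl (k, 0))) ∧
    run (ballProgram ctr α A y n) σ (Sum.inr 2) = max (σ (Sum.inr 2))
      (y - A * max (∑ k, sqApprox n |σ (Sum.inl (k, 0)) - ctr k| - α) 0) := by
  set h : Fin m → ℝ := fun k => |σ (Sum.inl (k, 0)) - ctr k| with hh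
  rw [ballProgram, run_cons, run_cons, run_append]
  set σ1 := step (diffLayer ctr) σ with hσ1
  set σ2 := step absLayer σ1 with hσ2
  have b0 : ∀ k, σ1 (Sum.inl (k, 0)) = σ (Sum.inl (k, 0)) := fun k => by
    simp only [hσ1, step, diffLayer, Sum.elim_inl, Matrix.cons_val_zero, eval_reg]
    exact max_eq_left (hσ _)
  have b12 : ∀ k, σ1 (Sum.inl (k, 1)) + σ1 (Sum.inl (k, 2)) = h k := fun k => by
    simp only [hσ1, step, diffLayer, Sum.elim_inl, Matrix.cons_val, eval_reg, eval_sub, eval_const,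
      hh]
    rcases le_total (σ (Sum.inl (k, 0))) (ctr k) with hle | hle
    · rw [max_eq_right (by linarith), max_eq_left (by linarith), abs_of_nonpos (by linarith)]; ring
    · rw [max_eq_left (by linarith), max_eq_right (by linarith), abs_of_nonneg (by linarith)]; ring
  have bo : σ1 (Sum.inr 2) = σ (Sum.inr 2) := by
    simp only [hσ1, step, diffLayer, Sum.elim_inr, Matrix.cons_val, eval_reg]
    exact max_eq_left (hσ _)
  have n2 : 0 ≤ σ2 := step_nonneg _ _
  have h0 : ∀ k, 0 ≤ h k := fun k => abs_nonneg _
  obtain ⟨d0, -, -, d3, d4⟩ := run_tents n2 h0 hc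
    (fun k => by
      simp only [hσ2, step, absLayer, Sum.elim_inl, Matrix.cons_val, eval_add, eval_reg, b12])
    (fun k => by
      simp only [hσ2, step, absLayer, Sum.elim_inl, Matrix.cons_val, eval_add, eval_sub, eval_const,
        eval_reg, b12])
    (by
      simp only [hσ2, step, absLayer, Sum.elim_inr, Matrix.cons_val_zero, eval_sum, eval_add,
        eval_reg, b12]
      exact max_eq_left (Finset.sum_nonneg fun k _ => h0 k)) n
  set σ3 := run (tents n) σ2
  have n3 : 0 ≤ σ3 := run_nonneg _ n2
  have c0 : ∀ k, σ2 (Sum.inl (k, 0)) = σ (Sum.inl (k, 0)) := fun k => by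
    simp only [hσ2, step, absLayer, Sum.elim_inl, Matrix.cons_val_zero, eval_reg]
    rw [b0]; exact max_eq_left (hσ _)
  have co : σ2 (Sum.inr 2) = σ (Sum.inr 2) := by
    simp only [hσ2, step, absLayer, Sum.elim_inr, Matrix.cons_val, eval_reg]
    rw [bo]; exact max_eq_left (hσ _)
  have ho : 0 ≤ σ (Sum.inr 2) := hσ _
  constructor
  · intro k
    simp only [run_cons, run_nil, step_assign, n3, step_nonneg, reduceCtorEq, if_false]
    rw [d0, c0]
  · simp only [run_cons, run_nil, step_assign, n3, step_nonneg, Sum.inr.injEq, Fin.reduceEq,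
      if_true, if_false, eval_add, eval_sub, eval_smul, eval_const, eval_reg, d3, d4, co]
    rw [max_eq_left (by positivity)]
    set X := (y : ℝ) - A * max (∑ k, sqApprox n (h k) - α) 0
    rcases le_total (σ (Sum.inr 2)) X with hle | hle
    · rw [max_eq_left (by linarith), max_eq_right hle]; ring
    · rw [max_eq_right (by linarith), max_eq_left hle]; ring

theorem fits_ballProgram {ctr : Fin m → ℝ} {α : ℝ} {A y n c : ℕ} {H : ℝ} (hn : 2 * n + 1 ≤ c)
    (hctr : ∀ k, ctr k ∈ dyadics c ∧ |ctr k| ≤ 1) (hα : α ∈ dyadics c) (hα1 : |α| + 1 ≤ H)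
    (hH : 7 ≤ H) (hm : (6 : ℝ) * m + 1 ≤ H) (hA : (y : ℝ) + A + 1 ≤ H) :
    ∀ l ∈ ballProgram ctr α A y n, Fits c H l := by
  have hhalf : (1 / 2 : ℝ) ∈ dyadics c := by
    simpa using int_div_two_pow_mem_dyadics (by omega : 1 ≤ c) 1
  have hH1 : 1 ≤ H := by linarith
  have h2 : (2 : ℝ) ∈ dyadics c := by exact_mod_cast natCast_mem_dyadics c 2
  have h4 : (4 : ℝ) ∈ dyadics c := by exact_mod_cast natCast_mem_dyadics c 4
  have f0 : (const 0 : AffForm (DistReg m)).Fits c H := (fits_const (zero_mem _)).mono (by simp; linarith)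
  have fr : ∀ i : DistReg m, (reg i).Fits c H := fun i => (fits_reg i).mono hH1
  intro l hl
  simp only [ballProgram, List.mem_cons, List.mem_append, List.not_mem_nil, or_false] at hl
  rcases hl with rfl | rfl | hl | rfl | rfl | rfl
  · rintro (⟨k, j⟩ | j)
    · fin_cases j
      · exact fr _
      · exact ((fits_reg _).sub (fits_const (hctr k).1)).mono (by linarith [(hctr k).2])
      · exact ((fits_const (hctr k).1).sub (fits_reg _)).mono (by linarith [(hctr k).2])
    · fin_cases j
      · exact f0
      · exact f0
      · exact fr _
  · rintro (⟨k, j⟩ | j)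
    · fin_cases j
      · exact fr _
      · exact ((fits_reg _).add (fits_reg _)).mono (by linarith)
      · refine (((fits_reg _).add (fits_reg _)).sub (fits_const hhalf)).mono ?_
        rw [abs_of_pos (by norm_num)]; linarith
    · fin_cases j
      · refine (fits_sum Finset.univ fun k _ => (fits_reg (Sum.inl (k, 1))).add
          (fits_reg (Sum.inl (k, 2)))).mono ?_
        rw [Finset.card_univ, Fintype.card_fin]
        have : (0 : ℝ) ≤ m := Nat.cast_nonneg _
        linarith
      · exact f0
      · exact fr _
  · have hmem : ∃ j, j ≤ n ∧ l = tentLayer j := by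
      clear hn
      induction n with
      | zero => simp [tents] at hl
      | succ n ih =>
        simp only [tents, List.mem_append, List.mem_singleton] at hl
        rcases hl with hl | rfl
        · obtain ⟨j, hj, h⟩ := ih hl
          exact ⟨j, by omega, h⟩
        · exact ⟨n + 1, le_rfl, rfl⟩
    obtain ⟨j, hj, rfl⟩ := hmem
    have e4 : (4 : ℝ) ^ j = 2 ^ (2 * j) := by rw [pow_mul]; norm_num
    have hone : (1 : ℝ) ≤ 4 ^ j := one_le_pow₀ (by norm_num)
    have m2 : (2 / 4 ^ j : ℝ) ∈ dyadics c := by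
      rw [e4]; simpa using int_div_two_pow_mem_dyadics (by omega : 2 * j ≤ c) 2
    have m4 : (4 / 4 ^ j : ℝ) ∈ dyadics c := by
      rw [e4]; simpa using int_div_two_pow_mem_dyadics (by omega : 2 * j ≤ c) 4
    rintro (⟨k, i⟩ | i)
    · fin_cases i
      · exact fr _
      · refine ((fits_smul_reg h2 _).sub (fits_smul_reg h4 _)).mono ?_
        norm_num; linarith
      · refine (((fits_smul_reg h2 _).sub (fits_smul_reg h4 _)).sub (fits_const hhalf)).mono ?_
        norm_num; linarith
    · fin_cases i
      · refine ((fits_reg _).sub (fits_sum Finset.univ fun k _ =>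
          ((fits_smul_reg m2 (Sum.inl (k, 1))).sub (fits_smul_reg m4 (Sum.inl (k, 2)))).mono
            (H' := 6) ?_)).mono ?_
        · rw [abs_of_pos (by positivity), abs_of_pos (by positivity), ← add_div,
            div_le_iff₀ (by positivity)]
          linarith
        · rw [Finset.card_univ, Fintype.card_fin]
          linarith
      · exact f0
      · exact fr _
  · exact fits_assign hH1 (((fits_reg _).sub (fits_const hα)).mono (by linarith)) _
  · refine fits_assign hH1 ((((fits_const (natCast_mem_dyadics c y)).sub
      (fits_smul_reg (natCast_mem_dyadics c A) _)).sub (fits_reg _)).mono ?_) _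
    rw [abs_of_nonneg (Nat.cast_nonneg _), abs_of_nonneg (Nat.cast_nonneg _)]
    exact hA
  · exact fits_assign hH1 (((fits_reg _).add (fits_reg _)).mono (by linarith)) _

/-- The ball programs for the first points of a sequence. -/
noncomputable def ballPrograms (ctr : ℕ → Fin m → ℝ) (α : ℝ) (A : ℕ) (y : ℕ → ℕ) (n : ℕ) :
    ℕ → List (Layer (DistReg m))
  | 0 => []
  | i + 1 => ballPrograms ctr α A y n i ++ ballProgram (ctr i) α A (y i) n

theorem length_ballPrograms (ctr : ℕ → Fin m → ℝ) (α : ℝ) (A : ℕ) (y : ℕ → ℕ) (n N : ℕ) :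
    (ballPrograms ctr α A y n N).length = (n + 5) * N := by
  induction N with
  | zero => rfl
  | succ N ih => simp [ballPrograms, ballProgram, ih, length_tents]; ring

theorem mem_ballPrograms {ctr : ℕ → Fin m → ℝ} {α : ℝ} {A : ℕ} {y : ℕ → ℕ} {n N : ℕ}
    {l : Layer (DistReg m)} (hl : l ∈ ballPrograms ctr α A y n N) :
    ∃ i < N, l ∈ ballProgram (ctr i) α A (y i) n := by
  induction N with
  | zero => simp [ballPrograms] at hl
  | succ N ih =>
    rw [ballPrograms, List.mem_append] at hl
    rcases hl with hl | hl
    · obtain ⟨i, hi, h⟩ := ih hl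
      exact ⟨i, by omega, h⟩
    · exact ⟨N, by omega, hl⟩

/-- Overestimating squares cannot make a far center look near: a wrong label contributes at most `C
- A * (distance² - α) ≤ 0`. A center with label `Y` contributes at most `Y`, and exactly `Y` if the
approximation error still fits below `α`. -/
theorem run_ballPrograms {σ : DistReg m → ℝ} (hσ : 0 ≤ σ) {ctr : ℕ → Fin m → ℝ} {α : ℝ} {A : ℕ}
    {y : ℕ → ℕ} {n N : ℕ} (hc : ∀ i < N, ∀ k, |σ (Sum.inl (k, 0)) - ctr i k| ≤ 1) {C Y : ℕ}
    (hy : ∀ i < N, y i ≤ C) (hout : σ (Sum.inr 2) ≤ Y)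
    (hfar : ∀ i < N, y i = Y ∨ C ≤ A * (∑ k, (σ (Sum.inl (k, 0)) - ctr i k) ^ 2 - α)) :
    (∀ k, run (ballPrograms ctr α A y n N) σ (Sum.inl (k, 0)) = σ (Sum.inl (k, 0))) ∧
    run (ballPrograms ctr α A y n N) σ (Sum.inr 2) ≤ Y ∧
    ((∃ i < N, y i = Y ∧ ∑ k, (σ (Sum.inl (k, 0)) - ctr i k) ^ 2 + m / 4 ^ n ≤ α) →
      run (ballPrograms ctr α A y n N) σ (Sum.inr 2) = Y) := by
  induction N with
  | zero => simpa [ballPrograms] using hout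
  | succ N ih =>
    obtain ⟨a1, a2, a3⟩ := ih (fun i hi => hc i (by omega)) (fun i hi => hy i (by omega))
      (fun i hi => hfar i (by omega))
    rw [ballPrograms, run_append]
    set σ1 := run (ballPrograms ctr α A y n N) σ
    have n1 : 0 ≤ σ1 := run_nonneg _ hσ
    obtain ⟨b1, b2⟩ := run_ballProgram n1 (ctr := ctr N) α A (y N) n
      (fun k => by rw [a1]; exact hc N (by omega) k)
    simp only [a1] at b1 b2
    set S := ∑ k, (σ (Sum.inl (k, 0)) - ctr N k) ^ 2 with hS
    set S' := ∑ k, sqApprox n |σ (Sum.inl (k, 0)) - ctr N k| with hS'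
    have hSS' : S ≤ S' := Finset.sum_le_sum fun k _ => by
      rw [← sq_abs]; exact sq_le_sqApprox n (abs_nonneg _) (hc N (by omega) k)
    have hS'S : S' ≤ S + m / 4 ^ n := by
      calc S' ≤ ∑ k : Fin m, ((σ (Sum.inl (k, 0)) - ctr N k) ^ 2 + 1 / 4 ^ n) :=
            Finset.sum_le_sum fun k _ => by
              rw [← sq_abs (σ (Sum.inl (k, 0)) - ctr N k)]
              exact sqApprox_le n (abs_nonneg _) (hc N (by omega) k)
        _ = S + m / 4 ^ n := by
            rw [Finset.sum_add_distrib, Finset.sum_const, Finset.card_univ, Fintype.card_fin,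
              nsmul_eq_mul]
            ring
    have hA0 : (0 : ℝ) ≤ A := Nat.cast_nonneg _
    have hY0 : (0 : ℝ) ≤ Y := Nat.cast_nonneg _
    have hmax : 0 ≤ (A : ℝ) * max (S' - α) 0 := mul_nonneg hA0 (le_max_right _ _)
    have hle : (y N : ℝ) - A * max (S' - α) 0 ≤ Y := by
      rcases hfar N (by omega) with h | h
      · rw [h]; linarith
      · have h1 : (y N : ℝ) ≤ C := by exact_mod_cast hy N (by omega)
        have h2 : (A : ℝ) * (S - α) ≤ A * max (S' - α) 0 :=
          mul_le_mul_of_nonneg_left ((by linarith : S - α ≤ S' - α).trans (le_max_left _ _)) hA0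
        linarith
    refine ⟨b1, by rw [b2]; exact max_le a2 hle, ?_⟩
    rintro ⟨i, hi, hiY, hiα⟩
    rw [b2]
    rcases Nat.lt_succ_iff_lt_or_eq.mp hi with hi | rfl
    · rw [a3 ⟨i, hi, hiY, hiα⟩]; exact max_eq_left hle
    · rw [max_eq_right (a := S' - α) (by linarith), mul_zero, sub_zero, hiY]
      exact max_eq_right a2

end Layer

open AffForm Layer in
/-- A network that compares the distances of the image of an affine map to `N` centers. -/
theorem exists_net_balls {d m : ℕ} (F : Fin m → AffForm (Fin d)) {c b : ℕ}
    (hF : ∀ k, (F k).Fits c (2 ^ b)) (N : ℕ) {ctr : ℕ → Fin m → ℝ} {α : ℝ} {A C n : ℕ} {y : ℕ → ℕ}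
    (hn : 2 * n + 1 ≤ c) (hctr : ∀ i < N, ∀ k, ctr i k ∈ dyadics c ∧ 0 ≤ ctr i k ∧ ctr i k ≤ 1)
    (hα : α ∈ dyadics c) (hα1 : |α| + 1 ≤ 2 ^ b) (hb : 3 ≤ b) (hm : (6 : ℝ) * m + 1 ≤ 2 ^ b)
    (hA : (C : ℝ) + A + 1 ≤ 2 ^ b) (hy : ∀ i < N, y i ≤ C) :
    ∃ f : ReLUNet d 1, f.depth = (n + 5) * N + 2 ∧ f.width ≤ 3 * m + 4 ∧
      f.numParams ≤ (d + 1) * (3 * m + 4) + f.depth * (3 * m + 4) ^ 2 ∧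
      f.HasBitComplexity (c + b + 2) ∧
      ∀ (x : EuclideanSpace ℝ (Fin d)) (Y : ℕ) (z : Fin m → ℝ), (∀ k, z k = (F k).eval fun j => x j) →
        (∀ k, 0 ≤ z k ∧ z k ≤ 1) →
        (∀ i < N, y i = Y ∨ C ≤ A * (∑ k, (z k - ctr i k) ^ 2 - α)) →
        (∃ i < N, y i = Y ∧ ∑ k, (z k - ctr i k) ^ 2 + m / 4 ^ n ≤ α) → f.toFun x = Y := by
  have hcard : Fintype.card (DistReg m) + 1 = 3 * m + 4 := by simp; ring
  set inp : DistReg m → AffForm (Fin d) :=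
    Sum.elim (fun k => ![F k.1, const 0, const 0] k.2) (fun _ => const 0) with hinp
  set ls := ballPrograms ctr α A y n N with hls
  have hlen : ls.length = (n + 5) * N := length_ballPrograms ..
  have f0 : (const 0 : AffForm (Fin d)).Fits c (2 ^ b) := (fits_const (zero_mem _)).mono (by simp)
  have hb8 : (8 : ℝ) ≤ 2 ^ b := by
    calc (8 : ℝ) = 2 ^ 3 := by norm_num
      _ ≤ 2 ^ b := pow_le_pow_right₀ one_le_two hb
  refine ⟨ReLUNet.ofLayers inp ls (reg (Sum.inr 2)), ?_, ?_, ?_, ?_, ?_⟩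
  · rw [ReLUNet.depth_ofLayers, hlen]
  · exact (ReLUNet.width_ofLayers _ _ _).trans_eq hcard
  · refine (ReLUNet.numParams_ofLayers _ _ _).trans ?_
    rw [hcard, ReLUNet.depth_ofLayers]
    gcongr
    omega
  · refine ReLUNet.hasBitComplexity_ofLayers ?_ ?_ ?_
    · rintro (⟨k, j⟩ | j)
      · fin_cases j
        · exact hF k
        · exact f0
        · exact f0
      · exact f0
    · intro l hl
      obtain ⟨i, hi, hl⟩ := mem_ballPrograms hl
      refine fits_ballProgram hn (fun k => ?_) hα hα1 (by linarith) hm ?_ l hl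
      · obtain ⟨h1, h2, h3⟩ := hctr i hi k
        exact ⟨h1, by rwa [abs_of_nonneg h2]⟩
      · have : (y i : ℝ) ≤ C := by exact_mod_cast hy i hi
        linarith
    · exact (fits_reg _).mono (one_le_pow₀ one_le_two)
  · intro x Y z hz hz01 hfar hnear
    rw [ReLUNet.toFun_ofLayers, eval_reg]
    set σ : DistReg m → ℝ := fun i => max ((inp i).eval fun j => x j) 0 with hσ
    have e1 : ∀ k, σ (Sum.inl (k, 0)) = z k := fun k => by
      simp only [hσ, hinp, Sum.elim_inl, Matrix.cons_val_zero, ← hz]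
      exact max_eq_left (hz01 k).1
    refine (run_ballPrograms (σ := σ) (fun i => le_max_right _ _) (N := N) ?_ hy ?_ ?_).2.2 ?_
    · intro i hi k
      rw [e1, abs_le]
      obtain ⟨h1, h2, h3⟩ := hctr i hi k
      obtain ⟨h4, h5⟩ := hz01 k
      constructor <;> linarith
    · simp [hσ, hinp]
    · simpa only [e1] using hfar
    · simpa only [e1] using hnear

/-! ### From a projection that separates labels to a network. -/

theorem norm_le_card_mul {m : ℕ} (e : EuclideanSpace ℝ (Fin m)) {ξ : ℝ} (hξ : 0 ≤ ξ)
    (h : ∀ k, |e k| ≤ ξ) : ‖e‖ ≤ m * ξ := by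
  have h1 : ‖e‖ ^ 2 ≤ (m * ξ) ^ 2 := by
    rw [EuclideanSpace.real_norm_sq_eq]
    calc ∑ k, e k ^ 2 ≤ ∑ _k : Fin m, ξ ^ 2 := Finset.sum_le_sum fun k _ => by
          rw [← sq_abs]; exact pow_le_pow_left₀ (abs_nonneg _) (h k) 2
      _ = m * ξ ^ 2 := by simp
      _ ≤ m * (m * ξ ^ 2) := by
          rcases Nat.eq_zero_or_pos m with rfl | hm
          · simp
          · have : (1 : ℝ) ≤ m := by exact_mod_cast hm
            have : 0 ≤ (m : ℝ) * ξ ^ 2 := by positivity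
            nlinarith
      _ = (m * ξ) ^ 2 := by ring
  exact abs_le_of_sq_le_sq' h1 (by positivity) |>.2

theorem exists_dyadic_near (x : ℝ) (c : ℕ) :
    ∃ y ∈ dyadics c, y ≤ x ∧ x - y ≤ 1 / 2 ^ c ∧ (0 ≤ x → 0 ≤ y) := by
  have h : (0 : ℝ) < 2 ^ c := by positivity
  refine ⟨⌊x * 2 ^ c⌋ / 2 ^ c, ⟨_, rfl⟩, ?_, ?_, fun hx => ?_⟩
  · rw [div_le_iff₀ h]; exact Int.floor_le _
  · have := Int.lt_floor_add_one (x * 2 ^ c)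
    rw [sub_le_iff_le_add, ← add_div, le_div_iff₀ h]
    linarith
  · have : (0 : ℤ) ≤ ⌊x * 2 ^ c⌋ := Int.floor_nonneg.mpr (by positivity)
    have : (0 : ℝ) ≤ ⌊x * 2 ^ c⌋ := by exact_mod_cast this
    positivity

theorem mem_unit_of_abs_sub_le {S z p : ℝ} (hS : 32 ≤ S) (h : |S * (z - 1 / 2) - p| ≤ 1)
    (hp : |p| ≤ S / 4) : 0 ≤ z ∧ z ≤ 1 := by
  have h1 := abs_le.mp h
  have h2 := abs_le.mp hp
  have hS0 : 0 < S := by linarith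
  constructor
  · refine le_of_mul_le_mul_left ?_ hS0
    linarith
  · refine le_of_mul_le_mul_left ?_ hS0
    linarith

namespace Dataset

variable {d N C : ℕ} (D : Dataset d N C)

theorem norm_le_of_mem_ball (hne : ∃ i j, D.y i ≠ D.y j) {L : ℕ} (hR : D.radius ≤ 2 ^ L) {ρ : ℝ}
    (hρ : ρ ≤ 1) {i : Fin N} {x : EuclideanSpace ℝ (Fin d)}
    (hx : x ∈ Metric.ball (D.x i) (ρ * D.sep)) : ‖x‖ ≤ 2 ^ (L + 1) := by
  have hsep := D.sep_pos hne
  rw [Metric.mem_ball, dist_eq_norm] at hx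
  have h1 : ‖x‖ ≤ ‖x - D.x i‖ + ‖D.x i‖ := by
    simpa using norm_add_le (x - D.x i) (D.x i)
  have h2 := D.norm_le_radius i
  have h3 := D.sep_le_radius hne
  have h4 : ρ * D.sep ≤ 1 * D.sep := by gcongr
  rw [pow_succ]; linarith

set_option maxHeartbeats 1600000 in
/-- A network for the points with centers in an image under a linear contraction that does not move
points with different labels too close to each other. -/
theorem exists_net_of_projection (hne : ∃ i j, D.y i ≠ D.y j) {t : ℝ} {L : ℕ}
    (hL : D.SizeBound t L) {ρ θ : ℝ} (hρ0 : 0 < ρ) (hρ1 : ρ < 1) {m : ℕ}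
    (P : EuclideanSpace ℝ (Fin d) →ₗ[ℝ] EuclideanSpace ℝ (Fin m)) (hP : ∀ x, ‖P x‖ ≤ ‖x‖)
    (hsepP : ∀ i j, D.y i ≠ D.y j → 2 * θ * D.sep ≤ ‖P (D.x i - D.x j)‖)
    (hθ : ρ + 1 / 2 ^ (L + 3) ≤ θ) (hm : m ≤ 2 ^ (3 * L + 14)) :
    ∃ f : ReLUNet d 1, f.depth = (5 * L + 19) * N + 2 ∧ f.width ≤ 3 * m + 4 ∧
      f.numParams ≤ (d + 1) * (3 * m + 4) + f.depth * (3 * m + 4) ^ 2 ∧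
      f.HasBitComplexity (17 * L + 45) ∧ D.RobustlyMemorizes ρ f.toFun := by
  have hsep := D.sep_pos hne
  set ε := D.sep with hε
  have hL2 := hL.two_le
  -- Norms on the balls are at most `2 ^ (L + 1) = S / 4`; division by `S` and adding `1/2` leads
  -- into the unit interval with room for rounding.
  set S : ℝ := 2 ^ (L + 3) with hS
  have hS0 : 0 < S := by positivity
  have hm' : (m : ℝ) ≤ 2 ^ (3 * L + 14) := by exact_mod_cast hm
  have hε1 : 1 / 2 ^ L ≤ ε := by
    have := hL.inv_sep_le
    rw [div_le_iff₀ hsep] at this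
    rw [div_le_iff₀ (by positivity)]; linarith
  -- rounded matrix
  choose w hwd hwle hwnear _ using fun (k : Fin m) (j : Fin d) =>
    exists_dyadic_near (P (EuclideanSpace.single j 1) k) (7 * L + 21)
  choose ctr hcd hcle hcnear hc0 using fun (i : Fin N) (k : Fin m) =>
    exists_dyadic_near (P (D.x i) k / S + 1 / 2) (6 * L + 23)
  have hPx : ∀ x k, P x k = ∑ j, P (EuclideanSpace.single j 1) k * x j := by
    intro x k
    conv_lhs => rw [← (EuclideanSpace.basisFun (Fin d) ℝ).sum_repr x]
    simp only [map_sum, map_smul, EuclideanSpace.basisFun_repr, EuclideanSpace.basisFun_apply]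
    simp [mul_comm]
  have hcoord : ∀ {n : ℕ} (x : EuclideanSpace ℝ (Fin n)) k, |x k| ≤ ‖x‖ := by
    intro n x k
    simpa using PiLp.norm_apply_le x k
  set z : EuclideanSpace ℝ (Fin d) → Fin m → ℝ :=
    fun x k => ∑ j, w k j / S * x j + 1 / 2 with hz
  -- rounding error of the map
  have herr : ∀ x : EuclideanSpace ℝ (Fin d), ‖x‖ ≤ 2 ^ (L + 1) → ∀ k,
      |S * (z x k - 1 / 2) - P x k| ≤ 1 / 2 ^ (5 * L + 20) := by
    intro x hx k
    have h1 : S * (z x k - 1 / 2) - P x k =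
        ∑ j, (w k j - P (EuclideanSpace.single j 1) k) * x j := by
      simp only [hz, add_sub_cancel_right, Finset.mul_sum, hPx x k, ← Finset.sum_sub_distrib]
      refine Finset.sum_congr rfl fun j _ => ?_
      field_simp
    rw [h1]
    calc |∑ j, (w k j - P (EuclideanSpace.single j 1) k) * x j|
        ≤ ∑ j, |(w k j - P (EuclideanSpace.single j 1) k) * x j| := Finset.abs_sum_le_sum_abs _ _
      _ ≤ ∑ _j : Fin d, 1 / 2 ^ (7 * L + 21) * 2 ^ (L + 1) := by
          refine Finset.sum_le_sum fun j _ => ?_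
          rw [abs_mul]
          gcongr
          · rw [abs_sub_comm, abs_of_nonneg (by linarith [hwle k j])]; exact hwnear k j
          · exact (hcoord x j).trans hx
      _ = d * (1 / 2 ^ (7 * L + 21) * 2 ^ (L + 1)) := by simp
      _ ≤ 2 ^ L * (1 / 2 ^ (7 * L + 21) * 2 ^ (L + 1)) := by
          gcongr
          exact_mod_cast hL.dim_le
      _ = 1 / 2 ^ (5 * L + 20) := by
          rw [show 7 * L + 21 = (5 * L + 20) + L + (L + 1) by ring, pow_add, pow_add]
          field_simp
  have hsmall : (1 : ℝ) / 2 ^ (5 * L + 20) ≤ 1 := by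
    rw [div_le_one (by positivity)]; exact one_le_pow₀ one_le_two
  have hS4 : (2 : ℝ) ^ (L + 1) = S / 4 := by rw [hS]; ring
  have hS32 : 32 ≤ S := by
    calc (32 : ℝ) = 2 ^ 5 := by norm_num
      _ ≤ 2 ^ (L + 3) := pow_le_pow_right₀ one_le_two (by omega)
  have hz01 : ∀ x : EuclideanSpace ℝ (Fin d), ‖x‖ ≤ 2 ^ (L + 1) → ∀ k, 0 ≤ z x k ∧ z x k ≤ 1 := by
    intro x hx k
    have h2 := abs_le.mp (((hcoord (P x) k).trans (hP x)).trans hx)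
    rw [hS4] at h2
    exact mem_unit_of_abs_sub_le hS32 ((herr x hx k).trans hsmall) (abs_le.mpr h2)
  have hctr01 : ∀ i k, 0 ≤ ctr i k ∧ ctr i k ≤ 1 := by
    intro i k
    have h1 : |P (D.x i) k| ≤ S / 4 := by
      rw [← hS4]
      refine ((hcoord _ k).trans (hP _)).trans ((D.norm_le_radius i).trans (hL.radius_le.trans ?_))
      exact pow_le_pow_right₀ one_le_two (by omega)
    have h2 : |P (D.x i) k / S| ≤ 1 / 4 := by
      rw [abs_div, abs_of_pos hS0, div_le_iff₀ hS0]; linarith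
    have h3 := abs_le.mp h2
    exact ⟨hc0 i k (by linarith), (hcle i k).trans (by linarith)⟩
  -- `κ` absorbs the rounding of matrix and centers: `m ≤ 2 ^ (3 * L + 14)` coordinates with error
  -- `2 ^ (-(5 * L + 19))` each, and `ε ≥ 2 ^ (-L)`.
  set κ : ℝ := ε / 2 ^ (L + 5) with hκ
  -- total error in the Euclidean norm
  have htotal : ∀ x : EuclideanSpace ℝ (Fin d), ‖x‖ ≤ 2 ^ (L + 1) → ∀ i,
      |√(∑ k, (z x k - ctr i k) ^ 2) * S - ‖P (x - D.x i)‖| ≤ κ := by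
    intro x hx i
    set ζ : EuclideanSpace ℝ (Fin m) := WithLp.toLp 2 fun k => S * (z x k - ctr i k) with hζ
    have h1 : ‖ζ‖ = √(∑ k, (z x k - ctr i k) ^ 2) * S := by
      rw [EuclideanSpace.norm_eq]
      simp only [hζ, Real.norm_eq_abs, sq_abs, mul_pow]
      rw [← Finset.mul_sum, Real.sqrt_mul (by positivity), Real.sqrt_sq hS0.le, mul_comm]
    rw [← h1]
    refine (abs_norm_sub_norm_le _ _).trans ?_
    have h2 : ∀ k, |(ζ - P (x - D.x i)) k| ≤ 1 / 2 ^ (5 * L + 19) := by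
      intro k
      have e1 : (ζ - P (x - D.x i)) k = (S * (z x k - 1 / 2) - P x k) +
          S * (P (D.x i) k / S + 1 / 2 - ctr i k) := by
        simp only [map_sub, PiLp.sub_apply, hζ]
        field_simp
        ring
      rw [e1]
      refine (abs_add_le _ _).trans ?_
      have e2 : |S * (P (D.x i) k / S + 1 / 2 - ctr i k)| ≤ 1 / 2 ^ (5 * L + 20) := by
        rw [abs_of_nonneg (mul_nonneg hS0.le (by linarith [hcle i k]))]
        calc S * (P (D.x i) k / S + 1 / 2 - ctr i k) ≤ S * (1 / 2 ^ (6 * L + 23)) := by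
              gcongr; exact hcnear i k
          _ = 1 / 2 ^ (5 * L + 20) := by
              rw [hS, show 6 * L + 23 = (L + 3) + (5 * L + 20) by ring, pow_add _ (L + 3)]
              field_simp
      have e3 : (1 : ℝ) / 2 ^ (5 * L + 19) = 1 / 2 ^ (5 * L + 20) + 1 / 2 ^ (5 * L + 20) := by
        rw [show (2 : ℝ) ^ (5 * L + 20) = 2 * 2 ^ (5 * L + 19) by ring]; field_simp; norm_num
      linarith [herr x hx k]
    refine (norm_le_card_mul _ (by positivity) h2).trans ?_
    calc (m : ℝ) * (1 / 2 ^ (5 * L + 19)) ≤ 2 ^ (3 * L + 14) * (1 / 2 ^ (5 * L + 19)) := by gcongr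
      _ = 1 / 2 ^ L / 2 ^ (L + 5) := by
          rw [show (2 : ℝ) ^ (5 * L + 19) = 2 ^ (3 * L + 14) * 2 ^ L * 2 ^ (L + 5) by ring]
          field_simp
      _ ≤ κ := by rw [hκ]; gcongr
  -- the threshold
  set γ : ℝ := 1 / 2 ^ (L + 3) with hγ
  have hκγ : κ = γ * ε / 4 := by
    rw [hκ, hγ, show L + 5 = L + 3 + 2 by ring, pow_add]; field_simp; norm_num
  have hγ0 : 0 < γ := by positivity
  -- On a ball the computed distance to its own center is at most `r₁`, and to a center with another
  -- label at least `r₂`.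
  set r₁ := ρ * ε + κ with hr₁
  set r₂ := 2 * θ * ε - ρ * ε - κ with hr₂
  have hγε : 0 < γ * ε := by positivity
  have hρε : 0 < ρ * ε := by positivity
  have hr₁0 : 0 < r₁ := by rw [hr₁, hκγ]; positivity
  have hθε : ρ * ε + γ * ε ≤ θ * ε := by
    rw [← add_mul]; exact mul_le_mul_of_nonneg_right hθ hsep.le
  have hr12 : r₁ + γ * ε ≤ r₂ := by rw [hr₁, hr₂, hκγ]; linarith
  have hsum12 : 2 * (γ * ε) ≤ r₁ + r₂ := by rw [hr₁, hr₂]; linarith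
  -- `Δ` is `2 * (γ * ε) ^ 2 / S ^ 2` with `ε` replaced by its lower bound `2 ^ (-L)`.
  set Δ : ℝ := 1 / 2 ^ (6 * L + 11) with hΔ
  have hgap : r₁ ^ 2 / S ^ 2 + Δ ≤ r₂ ^ 2 / S ^ 2 := by
    have h1 : 2 * (γ * ε) ^ 2 ≤ r₂ ^ 2 - r₁ ^ 2 := by
      have h := mul_le_mul (le_sub_iff_add_le'.mpr hr12) hsum12 (by positivity) (by linarith)
      calc 2 * (γ * ε) ^ 2 = γ * ε * (2 * (γ * ε)) := by ring
        _ ≤ (r₂ - r₁) * (r₁ + r₂) := h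
        _ = r₂ ^ 2 - r₁ ^ 2 := by ring
    have h2 : γ / 2 ^ L ≤ γ * ε := by
      calc γ / 2 ^ L = γ * (1 / 2 ^ L) := by ring
        _ ≤ γ * ε := by gcongr
    have h3 : 2 * (γ / 2 ^ L) ^ 2 ≤ 2 * (γ * ε) ^ 2 := by gcongr
    have h4 : Δ * S ^ 2 = 2 * (γ / 2 ^ L) ^ 2 := by
      have h5 : (2 : ℝ) ^ (6 * L + 11) * 2 = S ^ 4 * (2 ^ L) ^ 2 := by rw [hS]; ring
      have h6 : (2 : ℝ) ^ (6 * L + 11) = S ^ 4 * (2 ^ L) ^ 2 / 2 := by linarith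
      rw [hΔ, h6, hγ, ← hS]
      field_simp
    rw [← sub_nonneg, ← sub_sub, ← sub_div, sub_nonneg, le_div_iff₀ (by positivity)]
    linarith
  obtain ⟨α₀, hα₀d, hα₀le, hα₀near, hα₀0⟩ := exists_dyadic_near (r₁ ^ 2 / S ^ 2) (6 * L + 13)
  have hα₀nn : 0 ≤ α₀ := hα₀0 (by positivity)
  have hΔ4 : (1 : ℝ) / 2 ^ (6 * L + 13) = Δ / 4 := by
    rw [hΔ, show 6 * L + 13 = 6 * L + 11 + 2 by ring, pow_add]; field_simp; norm_num
  have hΔ0 : 0 < Δ := by positivity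
  have hΔ1 : Δ ≤ 1 := by
    rw [hΔ, div_le_one (by positivity)]; exact one_le_pow₀ one_le_two
  -- Of the added `Δ / 2`, one half pays for rounding down to `α₀` and the other for the approximate
  -- squares. Far centers still exceed `α` by `Δ / 2`.
  set α := α₀ + (2 : ℤ) / 2 ^ (6 * L + 13) with hα
  have hα' : α = α₀ + Δ / 2 := by
    have : ((2 : ℤ) : ℝ) / 2 ^ (6 * L + 13) = 2 * (1 / 2 ^ (6 * L + 13)) := by push_cast; ring
    rw [hα, this, hΔ4]; ring
  rw [hΔ4] at hα₀near
  have hr₁S : r₁ ^ 2 / S ^ 2 ≤ 1 := by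
    rw [div_le_one (by positivity)]
    apply pow_le_pow_left₀ hr₁0.le
    have h1 : ε ≤ 2 ^ L := (D.sep_le_radius hne).trans hL.radius_le
    have h2 : ρ * ε ≤ 1 * ε := by gcongr
    have h3 : γ ≤ 1 := by
      rw [hγ, div_le_one (by positivity)]; exact one_le_pow₀ one_le_two
    have h4 : γ * ε ≤ 1 * ε := by gcongr
    have h5 : S = 8 * 2 ^ L := by rw [hS]; ring
    rw [hr₁, hκγ, h5]
    linarith
  have hmem : ∀ {c : ℕ} {p : ℝ}, c ≤ 10 * L + 29 → p ∈ dyadics c → p ∈ dyadics (10 * L + 29) := by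
    rintro c p hc ⟨a, rfl⟩
    exact int_div_two_pow_mem_dyadics hc a
  have hpb : ∀ {j : ℕ}, j ≤ 7 * L + 14 → (2 : ℝ) ^ j ≤ 2 ^ (7 * L + 14) := fun hj =>
    pow_le_pow_right₀ one_le_two hj
  have hw2 : ∀ k j, |w k j| ≤ 2 := by
    intro k j
    have h1 : |P (EuclideanSpace.single j 1) k| ≤ 1 := by
      refine ((hcoord _ k).trans (hP _)).trans ?_
      simp
    have h2 : (1 : ℝ) / 2 ^ (7 * L + 21) ≤ 1 := by
      rw [div_le_one (by positivity)]; exact one_le_pow₀ one_le_two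
    have h3 := abs_le.mp h1
    rw [abs_le]
    constructor <;> linarith [hwle k j, hwnear k j]
  obtain ⟨f, hdepth, hwidth, hparams, hbits, hf⟩ := exists_net_balls (d := d) (m := m)
    (fun k => (fun j => w k j / S, 1 / 2)) (c := 10 * L + 29) (b := 7 * L + 14) (by
      intro k
      refine ⟨fun j => ⟨?_, ?_⟩, ?_, ?_⟩
      · obtain ⟨a, ha⟩ := hwd k j
        have : w k j / S = (a : ℝ) / 2 ^ (8 * L + 24) := by
          rw [ha, hS, div_div, ← pow_add]; congr 2; ring
        simp only [this]
        exact int_div_two_pow_mem_dyadics (by omega) a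
      · simp only
        rw [abs_div, abs_of_pos hS0, div_le_iff₀ hS0]
        have h1 : (1 : ℝ) ≤ 2 ^ (7 * L + 14) := one_le_pow₀ one_le_two
        exact (hw2 k j).trans (by linarith [le_mul_of_one_le_left hS0.le h1])
      · simpa using int_div_two_pow_mem_dyadics (by omega : 1 ≤ 10 * L + 29) 1
      · have h1 : (1 : ℝ) ≤ 2 ^ (7 * L + 14) := one_le_pow₀ one_le_two
        simp only
        rw [abs_of_pos (by norm_num)]; linarith) N
    -- The slope `A` is chosen so that `A * (Δ / 2) = 2 ^ L ≥ C`.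
    (ctr := fun i => if h : i < N then ctr ⟨i, h⟩ else 0) (α := α) (A := 2 ^ (7 * L + 12)) (C := C)
    (n := 5 * L + 14) (y := fun i => if h : i < N then D.y ⟨i, h⟩ else 0) (by omega)
    (fun i hi k => by
      simp only [dif_pos hi]
      exact ⟨hmem (by omega) (hcd ⟨i, hi⟩ k), hctr01 ⟨i, hi⟩ k⟩)
    (add_mem (hmem (by omega) hα₀d) (int_div_two_pow_mem_dyadics (by omega) 2))
    (by
      rw [hα', abs_of_nonneg (by positivity)]
      have : (2 : ℝ) ^ 2 ≤ 2 ^ (7 * L + 14) := hpb (by omega)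
      linarith)
    (by omega)
    (by
      have h1 : (2 : ℝ) ^ (3 * L + 14 + 3) ≤ 2 ^ (7 * L + 14) := hpb (by omega)
      have h2 : (1 : ℝ) ≤ 2 ^ (3 * L + 14) := one_le_pow₀ one_le_two
      rw [pow_add] at h1
      linarith)
    (by
      have h1 : (C : ℝ) + 2 ≤ 2 ^ L := by exact_mod_cast hL.label_le
      have h2 : (2 : ℝ) ^ L ≤ 2 ^ (7 * L + 12) := pow_le_pow_right₀ one_le_two (by omega)
      have h3 : (2 : ℝ) ^ (7 * L + 14) = 4 * 2 ^ (7 * L + 12) := by ring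
      push_cast
      linarith)
    (fun i hi => by
      simp only [dif_pos hi]
      exact (Finset.mem_Icc.mp (D.y_mem _)).2)
  refine ⟨f, by rw [hdepth], hwidth, hparams, ?_, ?_⟩
  · convert hbits using 1; ring
  intro i x hx
  have hxn := D.norm_le_of_mem_ball hne hL.radius_le hρ1.le hx
  have hsq : ∀ i : Fin N, √(∑ k, (z x k - ctr i k) ^ 2) ^ 2 = ∑ k, (z x k - ctr i k) ^ 2 := fun i =>
    Real.sq_sqrt (Finset.sum_nonneg fun _ _ => sq_nonneg _)
  have hxi : ‖P (x - D.x i)‖ ≤ ρ * ε := by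
    refine (hP _).trans ?_
    rw [Metric.mem_ball, dist_eq_norm] at hx
    exact hx.le
  refine hf x (D.y i) (z x) (fun k => ?_) (hz01 x hxn) (fun j hj => ?_) ⟨i, i.2, ?_, ?_⟩
  · simp only [AffForm.eval, hz]
  · simp only [dif_pos hj]
    set j' : Fin N := ⟨j, hj⟩
    by_cases hy : D.y j' = D.y i
    · exact Or.inl hy
    · right
      have h1 := abs_le.mp (htotal x hxn j')
      have h2 : 2 * θ * ε - ρ * ε ≤ ‖P (x - D.x j')‖ := by
        have h3 := hsepP j' i hy
        have h4 : P (D.x j' - D.x i) = P (x - D.x i) - P (x - D.x j') := by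
          rw [← map_sub]; congr 1; abel
        rw [h4] at h3
        have := norm_sub_le (P (x - D.x i)) (P (x - D.x j'))
        linarith
      have h5 : r₂ / S ≤ √(∑ k, (z x k - ctr j' k) ^ 2) := by
        rw [div_le_iff₀ hS0, hr₂]; linarith
      have h6 : r₂ ^ 2 / S ^ 2 ≤ ∑ k, (z x k - ctr j' k) ^ 2 := by
        rw [← hsq j', ← div_pow]
        exact pow_le_pow_left₀ (by apply div_nonneg _ hS0.le; linarith) h5 2
      have h7 : Δ / 2 ≤ ∑ k, (z x k - ctr j' k) ^ 2 - α := by rw [hα']; linarith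
      have h8 : (C : ℝ) ≤ 2 ^ L := by
        have : (C : ℝ) + 2 ≤ 2 ^ L := by exact_mod_cast hL.label_le
        linarith
      have h9 : (2 : ℝ) ^ (7 * L + 12) * (Δ / 2) = 2 ^ L := by
        rw [hΔ, show 7 * L + 12 = L + (6 * L + 11) + 1 by ring, pow_succ, pow_add]; field_simp
      push_cast
      calc (C : ℝ) ≤ 2 ^ (7 * L + 12) * (Δ / 2) := by rw [h9]; exact h8
        _ ≤ _ := by gcongr
  · simp
  · simp only [Fin.is_lt, dif_pos, Fin.eta]
    have h1 := abs_le.mp (htotal x hxn i)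
    have h5 : √(∑ k, (z x k - ctr i k) ^ 2) ≤ r₁ / S := by
      rw [le_div_iff₀ hS0, hr₁]; linarith
    have h6 : ∑ k, (z x k - ctr i k) ^ 2 ≤ r₁ ^ 2 / S ^ 2 := by
      rw [← hsq i, ← div_pow]
      exact pow_le_pow_left₀ (Real.sqrt_nonneg _) h5 2
    have h7 : (m : ℝ) / 4 ^ (5 * L + 14) ≤ Δ / 4 := by
      rw [← hΔ4, show (4 : ℝ) ^ (5 * L + 14) = 2 ^ (10 * L + 28) by
        rw [show 10 * L + 28 = 2 * (5 * L + 14) by ring, pow_mul]; norm_num]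
      rw [div_le_div_iff₀ (by positivity) (by positivity), one_mul]
      calc (m : ℝ) * 2 ^ (6 * L + 13) ≤ 2 ^ (3 * L + 14) * 2 ^ (6 * L + 13) := by gcongr
        _ = 2 ^ (9 * L + 27) := by ring
        _ ≤ 2 ^ (10 * L + 28) := pow_le_pow_right₀ one_le_two (by omega)
    rw [hα']
    linarith

end Dataset

/-! ### Reduction of the dimension. -/

/-- Coordinates in the span of finitely many points. -/
theorem exists_span_coordinates {d N : ℕ} (x : Fin N → EuclideanSpace ℝ (Fin d)) :
    ∃ n, n ≤ N ∧ n ≤ d ∧ ∃ P : EuclideanSpace ℝ (Fin d) →ₗ[ℝ] EuclideanSpace ℝ (Fin n),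
      (∀ v, ‖P v‖ ≤ ‖v‖) ∧ ∀ i j, ‖P (x i - x j)‖ = ‖x i - x j‖ := by
  set S := Submodule.span ℝ (Set.range x)
  -- Orthogonal projection onto the span, in orthonormal coordinates.
  refine ⟨Module.finrank ℝ S, ?_, ?_,
    (stdOrthonormalBasis ℝ S).repr.toLinearEquiv.toLinearMap ∘ₗ
      S.orthogonalProjectionOnto.toLinearMap, fun v => ?_, fun i j => ?_⟩
  · simpa [Set.finrank] using finrank_range_le_card (R := ℝ) x
  · simpa using Submodule.finrank_le S
  · simpa using S.norm_orthogonalProjectionOnto_apply_le v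
  · have h : x i - x j ∈ S := sub_mem (Submodule.subset_span ⟨i, rfl⟩)
      (Submodule.subset_span ⟨j, rfl⟩)
    simp only [LinearMap.comp_apply, LinearEquiv.coe_coe, LinearIsometryEquiv.coe_toLinearEquiv,
      LinearIsometryEquiv.norm_map, ContinuousLinearMap.coe_coe]
    exact S.norm_orthogonalProjectionOnto_apply h

section blocks

variable {κ : Type} [Fintype κ] [DecidableEq κ]

theorem blockSq_nonneg {n : ℕ} (β : Fin n → κ) (v : Fin n → ℝ) (s : Fin n → Bool) :
    0 ≤ blockSq β v s := Finset.sum_nonneg fun _ _ => sq_nonneg _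

/-- Cauchy–Schwarz in every block. -/
theorem blockSq_le {n b : ℕ} (β : Fin n → κ) (hβ : ∀ k, (Finset.univ.filter (β · = k)).card ≤ b)
    (v : Fin n → ℝ) (s : Fin n → Bool) : blockSq β v s ≤ b * ∑ j, v j ^ 2 := by
  have h1 : ∀ k, blockSum β v s k ^ 2 ≤ b * ∑ j with β j = k, v j ^ 2 := by
    intro k
    rw [blockSum, ← Finset.sum_filter]
    refine sq_sum_le_card_mul_sum_sq.trans ?_
    simp only [mul_pow, boolSign_sq, one_mul]
    gcongr
    exact hβ k
  calc blockSq β v s ≤ ∑ k, b * ∑ j with β j = k, v j ^ 2 := Finset.sum_le_sum fun k _ => h1 k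
    _ = b * ∑ j, v j ^ 2 := by
      rw [← Finset.mul_sum, Finset.sum_fiberwise]

theorem blockSq_le_sum {n t T : ℕ} (β : Fin n → κ) (v : Fin n → ℝ) (s : ℕ → Fin n → Bool)
    (ht : t < T) : blockSq β v (s t) ≤ ∑ t : Fin T, blockSq β v (s t) := by
  rw [Fin.sum_univ_eq_sum_range (fun t => blockSq β v (s t)) T]
  generalize hg : (fun t => blockSq β v (s t)) = g
  have h0 : ∀ t, 0 ≤ g t := fun t => by rw [← hg]; exact blockSq_nonneg _ _ _
  have h1 : blockSq β v (s t) = g t := by rw [← hg]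
  rw [h1]
  exact Finset.single_le_sum (fun t _ => h0 t) (Finset.mem_range.mpr ht)

/-- The map to the signed block sums for `T` sign patterns. -/
noncomputable def blockMap {n T μ : ℕ} (β : Fin n → Fin μ) (s : ℕ → Fin n → Bool) (c : ℝ) :
    EuclideanSpace ℝ (Fin n) →ₗ[ℝ] EuclideanSpace ℝ (Fin (T * μ)) where
  toFun v := WithLp.toLp 2 fun q =>
    c * blockSum β v (s (finProdFinEquiv.symm q).1) (finProdFinEquiv.symm q).2
  map_add' u v := by
    ext q
    simp only [PiLp.add_apply, blockSum, ← mul_add, ← Finset.sum_add_distrib]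
    congr 1
    refine Finset.sum_congr rfl fun j _ => ?_
    split_ifs <;> ring
  map_smul' r v := by
    ext q
    simp only [PiLp.smul_apply, smul_eq_mul, blockSum, RingHom.id_apply, Finset.mul_sum]
    refine Finset.sum_congr rfl fun j _ => ?_
    split_ifs <;> ring

theorem norm_blockMap_sq {n T μ : ℕ} (β : Fin n → Fin μ) (s : ℕ → Fin n → Bool) (c : ℝ)
    (v : EuclideanSpace ℝ (Fin n)) :
    ‖blockMap (T := T) β s c v‖ ^ 2 = c ^ 2 * ∑ t : Fin T, blockSq β v (s t) := by
  rw [EuclideanSpace.real_norm_sq_eq]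
  simp only [blockMap, LinearMap.coe_mk, AddHom.coe_mk, mul_pow]
  rw [← Finset.mul_sum, Equiv.sum_comp finProdFinEquiv.symm
    (fun q : Fin T × Fin μ => blockSum β v (s q.1) q.2 ^ 2), Fintype.sum_prod_type]
  rfl

end blocks

set_option maxHeartbeats 800000 in
/-- A linear contraction to a space of smaller dimension that shrinks finitely many given vectors
by a factor of at most `2 * ρ`. -/
theorem exists_contraction {n p : ℕ} {α : Type} [DecidableEq α] (V : Finset α)
    (v : α → EuclideanSpace ℝ (Fin n)) (hp0 : 0 < p) (hp : V.card < 2 ^ p) {ρ : ℝ} (hρ0 : 0 < ρ)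
    (hρ : 8 * (8 * p) * ρ ^ 2 ≤ 1) :
    ∃ m : ℕ, (m : ℝ) ≤ 8 * p * (16 * (8 * p) * ρ ^ 2 * n + 1) ∧
      ∃ P : EuclideanSpace ℝ (Fin n) →ₗ[ℝ] EuclideanSpace ℝ (Fin m),
        (∀ u, ‖P u‖ ≤ ‖u‖) ∧ ∀ a ∈ V, 2 * ρ * ‖v a‖ ≤ ‖P (v a)‖ := by
  set T : ℕ := 8 * p with hT
  have hT0 : (0 : ℝ) < T := by rw [hT]; exact_mod_cast (by omega : 0 < 8 * p)
  have hTp : (8 * p : ℝ) = T := by rw [hT]; push_cast; ring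
  rw [hTp] at hρ ⊢
  -- Longer blocks mean fewer dimensions. With the factor `1 / √(T * b)` needed for a contraction,
  -- one good pattern guarantees `‖v‖ ^ 2 / (2 * T * b)`, and this is at least `(2 * ρ * ‖v‖) ^ 2`
  -- precisely when `b ≤ X`.
  set X : ℝ := 1 / (8 * T * ρ ^ 2) with hX
  have hX1 : 1 ≤ X := by rw [hX, le_div_iff₀ (by positivity)]; linarith
  set b : ℕ := ⌊X⌋₊ with hb
  have hb1 : 1 ≤ b := Nat.le_floor (by simpa using hX1)
  have hb1' : (1 : ℝ) ≤ b := by exact_mod_cast hb1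
  have hbX : (b : ℝ) ≤ X := Nat.floor_le (by linarith)
  have hXb : X ≤ 2 * b := by have := Nat.lt_floor_add_one X; linarith
  have hX8 : X * (8 * T * ρ ^ 2) = 1 := by rw [hX]; field_simp
  have hb8 : b * (8 * T * ρ ^ 2) ≤ 1 := by rw [← hX8]; gcongr
  have hb16 : 1 ≤ b * (16 * T * ρ ^ 2) := by
    calc 1 = X * (8 * T * ρ ^ 2) := hX8.symm
      _ ≤ 2 * b * (8 * T * ρ ^ 2) := by gcongr
      _ = _ := by ring
  set μ := n / b + 1 with hμ
  have hdiv : ∀ j : Fin n, (j : ℕ) / b < μ := fun j => by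
    have := Nat.div_le_div_right (c := b) j.2.le
    omega
  set β : Fin n → Fin μ := fun j => ⟨j / b, hdiv j⟩ with hβ
  obtain ⟨s, hs⟩ := exists_signs β V (fun a => v a) hp
  have hTb : (0 : ℝ) < T * b := by positivity
  have hc : (1 / √(T * b : ℝ)) ^ 2 = 1 / (T * b) := by
    rw [div_pow, Real.sq_sqrt hTb.le, one_pow]
  refine ⟨T * μ, ?_, blockMap (T := T) β s (1 / √(T * b : ℝ)), fun u => ?_, fun a ha => ?_⟩
  · push_cast
    gcongr
    have h1 : ((n / b : ℕ) : ℝ) ≤ n / b := Nat.cast_div_le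
    have h2 : (n : ℝ) / b ≤ 16 * T * ρ ^ 2 * n := by
      rw [div_le_iff₀ (by positivity)]
      calc (n : ℝ) = n * 1 := by ring
        _ ≤ n * (b * (16 * T * ρ ^ 2)) := by gcongr
        _ = _ := by ring
    rw [hμ]; push_cast; linarith
  · refine abs_le_of_sq_le_sq' ?_ (norm_nonneg u) |>.2
    rw [norm_blockMap_sq, hc]
    have h1 : ∀ t, blockSq β u (s t) ≤ b * ‖u‖ ^ 2 := fun t => by
      rw [EuclideanSpace.real_norm_sq_eq]
      refine blockSq_le β (fun k => ?_) _ _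
      simpa only [hβ, Fin.ext_iff] using Dataset.card_filter_div_le (N := n) hb1 k
    calc 1 / (T * b : ℝ) * ∑ t : Fin T, blockSq β u (s t)
        ≤ 1 / (T * b : ℝ) * ∑ _t : Fin T, b * ‖u‖ ^ 2 := by
          gcongr with t; exact h1 t
      _ = ‖u‖ ^ 2 := by simp; field_simp
  · refine abs_le_of_sq_le_sq' ?_ (norm_nonneg _) |>.2
    rw [norm_blockMap_sq, hc]
    obtain ⟨t, ht, h⟩ := hs a ha
    have h1 : ‖v a‖ ^ 2 / 2 ≤ ∑ t : Fin T, blockSq β (v a) (s t) := by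
      rw [EuclideanSpace.real_norm_sq_eq]
      exact h.trans (blockSq_le_sum β (v a) s ht)
    calc (2 * ρ * ‖v a‖) ^ 2 = 1 / (T * b) * ((b * (8 * T * ρ ^ 2)) * (‖v a‖ ^ 2 / 2)) := by
          field_simp; ring
      _ ≤ 1 / (T * b) * (1 * (‖v a‖ ^ 2 / 2)) := by gcongr
      _ ≤ _ := by rw [one_mul]; gcongr

/-! ### The network for `ρ > 1 / (5 √d)`. -/

namespace Dataset

variable {d N C : ℕ} (D : Dataset d N C)

/-- Contracted balls have radius at most `ρ * sep`, so distances may shrink as long as centers stay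
`2 * θ * sep` apart with `θ` above `ρ`. Shrinking by `2 * ρ` gives `θ = 2 * ρ`, with margin `ρ`. If
`ρ ^ 2` exceeds a multiple of `1 / L`, then `n` itself is of order `L * ρ ^ 2 * n`; the span
coordinates are kept, with `θ = 1` and margin `1 - ρ`. -/
theorem exists_projection (hne : ∃ i j, D.y i ≠ D.y j) {ρ : ℝ} (hρ0 : 1 / (5 * √(d : ℝ)) < ρ)
    (hρ1 : ρ < 1) {L : ℕ} (hL : D.SizeBound (1 / (1 - ρ)) L) :
    ∃ (m n : ℕ) (θ : ℝ), n ≤ N ∧ n ≤ d ∧ (m : ℝ) ≤ 6400 * L ^ 2 * (ρ ^ 2 * n + 1) ∧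
      ρ + 1 / 2 ^ (L + 3) ≤ θ ∧
      ∃ P : EuclideanSpace ℝ (Fin d) →ₗ[ℝ] EuclideanSpace ℝ (Fin m), (∀ x, ‖P x‖ ≤ ‖x‖) ∧
        ∀ i j, D.y i ≠ D.y j → 2 * θ * D.sep ≤ ‖P (D.x i - D.x j)‖ := by
  obtain ⟨n, hnN, hnd, P₀, hP₀, hP₀x⟩ := exists_span_coordinates D.x
  have hsep := D.sep_pos hne
  have hd0 : (0 : ℝ) < d := by exact_mod_cast D.one_le_dim hne
  have hρpos : 0 < ρ := lt_of_le_of_lt (by positivity) hρ0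
  have hL2 : (2 : ℝ) ≤ L := by exact_mod_cast hL.two_le
  set p := 2 * L + 1 with hp
  have hp20 : (8 * p : ℝ) ≤ 20 * L := by rw [hp]; push_cast; linarith
  have hρn : 0 ≤ ρ ^ 2 * n := by positivity
  by_cases hc : 8 * (8 * p) * ρ ^ 2 ≤ 1
  · obtain ⟨m, hm, P, hP, hPv⟩ := exists_contraction (Finset.univ : Finset (Fin N × Fin N))
      (fun q => P₀ (D.x q.1 - D.x q.2)) (by omega : 0 < p) (by
        rw [Finset.card_univ, Fintype.card_prod, Fintype.card_fin]
        calc N * N ≤ 2 ^ L * 2 ^ L := Nat.mul_le_mul hL.card_le hL.card_le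
          _ = 2 ^ (2 * L) := by rw [← pow_add]; congr 1; ring
          _ < 2 ^ p := Nat.pow_lt_pow_right (by norm_num) (by omega)) hρpos hc
    refine ⟨m, n, 2 * ρ, hnN, hnd, hm.trans ?_, ?_, P ∘ₗ P₀,
      fun x => (hP _).trans (hP₀ _), fun i j hij => ?_⟩
    · calc 8 * p * (16 * (8 * p) * ρ ^ 2 * n + 1) ≤ 20 * L * (16 * (20 * L) * ρ ^ 2 * n + 1) := by
            gcongr
        _ = 6400 * L ^ 2 * (ρ ^ 2 * n) + 20 * (L * 1) := by ring
        _ ≤ 6400 * L ^ 2 * (ρ ^ 2 * n) + 6400 * (L * L) := by gcongr <;> linarith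
        _ = _ := by ring
    -- Here `ρ > 1 / (5 * √d)` and `√d ≤ 2 ^ L`.
    · suffices h : 1 / 2 ^ (L + 3) ≤ ρ by linarith
      refine le_trans ?_ hρ0.le
      have h1 : √(d : ℝ) ≤ 2 ^ L := by
        have h1' : (1 : ℝ) ≤ d := by exact_mod_cast D.one_le_dim hne
        have h2' : (d : ℝ) ≤ 2 ^ L := by exact_mod_cast hL.dim_le
        refine le_trans ?_ h2'
        rw [Real.sqrt_le_left (by positivity)]
        exact le_self_pow₀ h1' two_ne_zero
      apply one_div_le_one_div_of_le (by positivity)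
      have h2 : (0 : ℝ) < 2 ^ L := by positivity
      rw [pow_add]; linarith
    · have h1 := hPv (i, j) (Finset.mem_univ _)
      simp only [hP₀x] at h1
      refine le_trans ?_ h1
      calc 2 * (2 * ρ) * D.sep = 2 * ρ * (2 * D.sep) := by ring
        _ ≤ _ := by gcongr; exact D.two_mul_sep_le hij
  · push Not at hc
    refine ⟨n, n, 1, hnN, hnd, ?_, ?_, P₀, hP₀, fun i j hij => ?_⟩
    · calc (n : ℝ) = 1 * n := by ring
        _ ≤ (8 * (8 * p) * ρ ^ 2) * n := by gcongr
        _ ≤ (8 * (20 * L) * ρ ^ 2) * n := by gcongr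
        _ = 160 * (L * 1) * (ρ ^ 2 * n) := by ring
        _ ≤ 6400 * (L * L) * (ρ ^ 2 * n + 1) := by gcongr <;> linarith
        _ = _ := by ring
    · have h1 := hL.le
      have h2 : 0 < 1 - ρ := by linarith
      rw [div_le_iff₀ h2] at h1
      have h3 : 1 / 2 ^ (L + 3) ≤ 1 - ρ := by
        have h4 : (0 : ℝ) < (1 - ρ) * 2 ^ L := by positivity
        rw [div_le_iff₀ (by positivity), pow_add]; linarith
      linarith
    · rw [hP₀x, mul_one]
      exact D.two_mul_sep_le hij

end Dataset

/-- With `u = ρ ^ 2 * d`, the lower bound on `ρ` reads `1 ≤ 25 * u`. The width is controlled by `n ≤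
d`; the first layer needs `n ≤ N`, through `d * (ρ ^ 2 * n) = u * n ≤ 25 * N * u ^ 2`. Depth times
squared width gives `L * (L ^ 2) ^ 2`, the source of the exponent 5. -/
theorem projected_net_size_le {d N n L m dep Q ρ : ℝ} (hN : 2 ≤ N) (hd : 1 ≤ d) (hL2 : 2 ≤ L)
    (hn0 : 0 ≤ n) (hnN : n ≤ N) (hnd : n ≤ d) (hm0 : 0 ≤ m) (hu25 : 1 ≤ 25 * (ρ ^ 2 * d))
    (hm : m ≤ 6400 * L ^ 2 * (ρ ^ 2 * n + 1)) (hdep : dep ≤ 15 * L * N)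
    (hLp2 : L ^ 2 ≤ 3 ^ 2 * Q) (hLp5 : L ^ 5 ≤ 3 ^ 5 * Q) :
    (d + 1) * (3 * m + 4) + dep * (3 * m + 4) ^ 2 ≤ 10 ^ 15 * Q * (N * d ^ 2 * ρ ^ 4 + d) ∧
      3 * m + 4 ≤ 10 ^ 15 * Q * (ρ ^ 2 * d) := by
  obtain ⟨u, hu⟩ : ∃ u, u = ρ ^ 2 * d := ⟨_, rfl⟩
  have hρn : ρ ^ 2 * n ≤ u := by rw [hu]; gcongr
  have hρn0 : 0 ≤ ρ ^ 2 * n := by positivity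
  rw [← hu] at hu25 ⊢
  have hLL : 4 ≤ L ^ 2 := by nlinarith
  have hu0 : 0 < u := by linarith
  have hQ0 : 0 < Q := by linarith
  have hW1 : (3 * m + 4) ≤ 19201 * L ^ 2 * (ρ ^ 2 * n + 1) := by
    have h1 : 0 ≤ L ^ 2 * (ρ ^ 2 * n) := by positivity
    linarith
  have hW2 : (3 * m + 4) ≤ 500000 * L ^ 2 * u := by
    have h1 : ρ ^ 2 * n + 1 ≤ 26 * u := by
      linarith
    calc (3 * m + 4) ≤ 19201 * L ^ 2 * (ρ ^ 2 * n + 1) := hW1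
      _ ≤ 19201 * L ^ 2 * (26 * u) := by gcongr
      _ = 499226 * (L ^ 2 * u) := by ring
      _ ≤ 500000 * (L ^ 2 * u) := mul_le_mul_of_nonneg_right (by norm_num) (by positivity)
      _ = _ := by ring
  constructor
  · have h1 : (d + 1) * (3 * m + 4) ≤ 1000000 * L ^ 2 * (N * u ^ 2 + d) := by
      have e1 : d * (ρ ^ 2 * n) ≤ 25 * (N * u ^ 2) := by
        calc d * (ρ ^ 2 * n) = u * n * 1 := by rw [hu]; ring
          _ ≤ u * N * (25 * u) := by gcongr
          _ = _ := by ring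
      calc (d + 1) * (3 * m + 4) ≤ (2 * d) * (19201 * L ^ 2 * (ρ ^ 2 * n + 1)) := by
            gcongr
            linarith
        _ = 38402 * L ^ 2 * (d * (ρ ^ 2 * n) + d) := by ring
        _ ≤ 38402 * L ^ 2 * (25 * (N * u ^ 2) + d) := by gcongr
        _ ≤ 38402 * L ^ 2 * (25 * (N * u ^ 2) + 25 * d) := by gcongr; linarith
        _ = 960050 * (L ^ 2 * (N * u ^ 2 + d)) := by ring
        _ ≤ 1000000 * (L ^ 2 * (N * u ^ 2 + d)) := mul_le_mul_of_nonneg_right (by norm_num) (by positivity)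
        _ = _ := by ring
    have h2 : dep * (3 * m + 4) ^ 2 ≤ 3750000000000 * L ^ 5 * (N * u ^ 2) := by
      calc dep * (3 * m + 4) ^ 2 ≤ 15 * L * N * (500000 * L ^ 2 * u) ^ 2 := by gcongr
        _ = _ := by ring
    calc (d + 1) * (3 * m + 4) + dep * (3 * m + 4) ^ 2
      _ ≤ 1000000 * L ^ 2 * (N * u ^ 2 + d) + 3750000000000 * L ^ 5 * (N * u ^ 2 + d) := by
          refine add_le_add h1 (h2.trans ?_)
          gcongr
          linarith
      _ ≤ 1000000 * (3 ^ 2 * Q) * (N * u ^ 2 + d) + 3750000000000 * (3 ^ 5 * Q) *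
          (N * u ^ 2 + d) := by
        have e0 : 0 ≤ N * u ^ 2 + d := by positivity
        exact add_le_add
          (mul_le_mul_of_nonneg_right (mul_le_mul_of_nonneg_left hLp2 (by norm_num)) e0)
          (mul_le_mul_of_nonneg_right (mul_le_mul_of_nonneg_left hLp5 (by norm_num)) e0)
      _ = (1000000 * 3 ^ 2 + 3750000000000 * 3 ^ 5) * (Q * (N * u ^ 2 + d)) := by ring
      _ ≤ 10 ^ 15 * (Q * (N * u ^ 2 + d)) := mul_le_mul_of_nonneg_right (by norm_num) (by positivity)
      _ = _ := by rw [hu]; ring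
  · calc 3 * m + 4 ≤ 500000 * L ^ 2 * u := hW2
      _ ≤ 500000 * (3 ^ 2 * Q) * u := by gcongr
      _ = 4500000 * (Q * u) := by ring
      _ ≤ 10 ^ 15 * (Q * u) := mul_le_mul_of_nonneg_right (by norm_num) (by positivity)
      _ = _ := by ring

namespace Dataset

variable {d N C : ℕ} (D : Dataset d N C)

set_option maxHeartbeats 800000 in
theorem exists_net_large (hne : ∃ i j, D.y i ≠ D.y j) {ρ : ℝ} (hρ0 : 1 / (5 * √(d : ℝ)) < ρ)
    (hρ1 : ρ < 1) :
    ∃ (f : ReLUNet d 1) (B : ℕ), D.RobustlyMemorizes ρ f.toFun ∧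
      (f.numParams : ℝ) ≤ 10 ^ 15 * D.logFactor (1 / (1 - ρ)) ^ 5 * (N * (d : ℝ) ^ 2 * ρ ^ 4 + d) ∧
      (f.depth : ℝ) ≤ 10 ^ 15 * D.logFactor (1 / (1 - ρ)) ^ 5 * N ∧
      (f.width : ℝ) ≤ 10 ^ 15 * D.logFactor (1 / (1 - ρ)) ^ 5 * (ρ ^ 2 * d) ∧
      f.HasBitComplexity B ∧ (B : ℝ) ≤ 10 ^ 15 * D.logFactor (1 / (1 - ρ)) ^ 5 * N := by
  have hρ1' : 0 < 1 - ρ := by linarith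
  obtain ⟨hlam, L, hL, hL3⟩ := D.exists_sizeBound hne (by positivity : 0 ≤ 1 / (1 - ρ))
  set lam := D.logFactor (1 / (1 - ρ))
  have hN : (2 : ℝ) ≤ N := by exact_mod_cast D.two_le_card hne
  have hd1 : (1 : ℝ) ≤ d := by exact_mod_cast D.one_le_dim hne
  have hL2 : (2 : ℝ) ≤ L := by exact_mod_cast hL.two_le
  have hρpos : 0 < ρ := lt_of_le_of_lt (by positivity) hρ0
  have hu25 : 1 ≤ 25 * (ρ ^ 2 * d) := by
    rw [div_lt_iff₀ (by positivity)] at hρ0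
    calc (1 : ℝ) = 1 ^ 2 := by norm_num
      _ ≤ (ρ * (5 * √(d : ℝ))) ^ 2 := by gcongr
      _ = 25 * (ρ ^ 2 * √(d : ℝ) ^ 2) := by ring
      _ = 25 * (ρ ^ 2 * d) := by rw [Real.sq_sqrt (by positivity)]
  obtain ⟨m, n, θ, hnN, hnd, hm, hθ, P, hP, hPx⟩ := D.exists_projection hne hρ0 hρ1 hL
  have hnN' : (n : ℝ) ≤ N := by exact_mod_cast hnN
  have hnd' : (n : ℝ) ≤ d := by exact_mod_cast hnd
  have hm2 : m ≤ 2 ^ (3 * L + 14) := by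
    have h1 : (L : ℝ) ≤ 2 ^ L := by exact_mod_cast Nat.lt_two_pow_self.le
    have h2 : (n : ℝ) ≤ 2 ^ L := hnd'.trans (by exact_mod_cast hL.dim_le)
    have h3 : ρ ^ 2 * n ≤ 1 * 2 ^ L := by
      gcongr
      exact pow_le_one₀ hρpos.le hρ1.le
    have h4 : (1 : ℝ) ≤ 2 ^ L := one_le_pow₀ one_le_two
    have h5 : (m : ℝ) ≤ 2 ^ (3 * L + 14) := by
      calc (m : ℝ) ≤ 6400 * L ^ 2 * (ρ ^ 2 * n + 1) := hm
        _ ≤ 8192 * (2 ^ L) ^ 2 * (2 ^ L + 2 ^ L) := by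
            gcongr
            · norm_num
            · linarith
        _ = 2 ^ (3 * L + 14) := by ring
    exact_mod_cast h5
  obtain ⟨f, hdepth, hwidth, hparams, hbits, hf⟩ :=
    D.exists_net_of_projection hne hL hρpos hρ1 P hP hPx hθ hm2
  have hL1 : (L : ℝ) ≤ 3 * lam ^ 5 := by
    simpa using pow_le_of_le_three_mul hlam hL3 (by norm_num : 1 ≤ 5)
  have hLp2 := pow_le_of_le_three_mul hlam hL3 (by norm_num : 2 ≤ 5)
  have hLp5 := pow_le_of_le_three_mul hlam hL3 (le_refl 5)
  set Q := lam ^ 5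
  have hQ0 : 0 < Q := by positivity
  have hD : (f.depth : ℝ) ≤ 15 * L * N := by
    rw [hdepth]; push_cast
    have : 0 ≤ (L - 2) * (N : ℝ) := mul_nonneg (by linarith) (by linarith)
    linarith
  have hwidth' : (f.width : ℝ) ≤ 3 * m + 4 := by exact_mod_cast hwidth
  have hparams' : (f.numParams : ℝ) ≤ (d + 1) * (3 * m + 4) + f.depth * (3 * m + 4) ^ 2 := by
    exact_mod_cast hparams
  have hsize := projected_net_size_le hN hd1 hL2 n.cast_nonneg hnN' hnd' m.cast_nonneg hu25 hm
    hD hLp2 hLp5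
  refine ⟨f, 17 * L + 45, hf, ?_, ?_, ?_, hbits, ?_⟩
  · exact hparams'.trans hsize.1
  · calc (f.depth : ℝ) ≤ 15 * L * N := hD
      _ ≤ 15 * (3 * Q) * N := by gcongr
      _ = 45 * (Q * N) := by ring
      _ ≤ 10 ^ 15 * (Q * N) := mul_le_mul_of_nonneg_right (by norm_num) (by positivity)
      _ = _ := by ring
  · exact hwidth'.trans hsize.2
  · push_cast
    calc (17 * L + 45 : ℝ) ≤ 40 * L := by linarith
      _ ≤ 40 * (3 * Q) := by gcongr
      _ = 120 * Q * 1 := by ring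
      _ ≤ 10 ^ 15 * Q * N := mul_le_mul
          (mul_le_mul_of_nonneg_right (by norm_num) hQ0.le) (by linarith) zero_le_one (by positivity)

end Dataset

/-! ### The three regimes together. -/

theorem mainTheorem4 :
    ∃ (K : ℝ) (k : ℕ), ∀ (d N C : ℕ) (D : Dataset d N C), (∃ i j, D.y i ≠ D.y j) →
      ∀ η : ℝ, 0 < η → η < 1 → ∀ ρ : ℝ,
        (0 < ρ → ρ ≤ 1 / (5 * N * √(d : ℝ)) →
          ∃ (f : ReLUNet d 1) (B : ℕ),
            D.RobustlyMemorizes ρ f.toFun ∧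
            (f.numParams : ℝ) ≤ K * D.logFactor 0 ^ k * (√(N : ℝ) + d) ∧
            (f.depth : ℝ) ≤ K * D.logFactor 0 ^ k * √(N : ℝ) ∧
            (f.width : ℝ) ≤ K * D.logFactor 0 ^ k ∧
            f.HasBitComplexity B ∧
            (B : ℝ) ≤ K * D.logFactor 0 ^ k * √(N : ℝ)) ∧
        (1 / (5 * N * √(d : ℝ)) < ρ → ρ ≤ 1 / (5 * √(d : ℝ)) →
          ∃ (f : ReLUNet d 1) (B : ℕ),
            D.robustError ρ f.toFun ≤ ENNReal.ofReal η ∧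
            (f.numParams : ℝ) ≤ K * D.logFactor (1 / η) ^ k *
              (N * (d : ℝ) ^ (1 / 4 : ℝ) * ρ ^ (1 / 2 : ℝ) + d) ∧
            (f.depth : ℝ) ≤ K * D.logFactor (1 / η) ^ k *
              (N * (d : ℝ) ^ (1 / 4 : ℝ) * ρ ^ (1 / 2 : ℝ)) ∧
            (f.width : ℝ) ≤ K * D.logFactor (1 / η) ^ k ∧
            f.HasBitComplexity B ∧
            (B : ℝ) ≤ K * D.logFactor (1 / η) ^ k *
              (1 / ((d : ℝ) ^ (1 / 4 : ℝ) * ρ ^ (1 / 2 : ℝ)))) ∧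
        (1 / (5 * √(d : ℝ)) < ρ → ρ < 1 →
          ∃ (f : ReLUNet d 1) (B : ℕ),
            D.RobustlyMemorizes ρ f.toFun ∧
            (f.numParams : ℝ) ≤ K * D.logFactor (1 / (1 - ρ)) ^ k *
              (N * (d : ℝ) ^ 2 * ρ ^ 4 + d) ∧
            (f.depth : ℝ) ≤ K * D.logFactor (1 / (1 - ρ)) ^ k * N ∧
            (f.width : ℝ) ≤ K * D.logFactor (1 / (1 - ρ)) ^ k * (ρ ^ 2 * d) ∧
            f.HasBitComplexity B ∧
            (B : ℝ) ≤ K * D.logFactor (1 / (1 - ρ)) ^ k * N) := by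
  -- The constants are those of the large radii; the other cases have smaller ones, and `logFactor`
  -- is at least 1.
  refine ⟨10 ^ 15, 5, fun d N C D hne η hη _ ρ => ⟨fun h0 h1 => ?_, fun h0 h1 => ?_,
    fun h0 h1 => D.exists_net_large hne h0 h1⟩⟩
  · have hlam := (D.exists_sizeBound hne le_rfl).1
    have hK : 3000000000 * D.logFactor 0 ^ 4 ≤ 10 ^ 15 * D.logFactor 0 ^ 5 := by
      gcongr <;> norm_num
    obtain ⟨f, B, hf, hp, hd, hw, hb, hB⟩ := D.exists_net_small hne h0 h1
    exact ⟨f, B, hf, hp.trans (by gcongr), hd.trans (by gcongr), hw.trans hK, hb,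
      hB.trans (by gcongr)⟩
  · have hlam := (D.exists_sizeBound hne (by positivity : 0 ≤ 1 / η)).1
    have hρ : 0 < ρ := lt_of_le_of_lt (by positivity) h0
    have hK : 3000000000 * D.logFactor (1 / η) ^ 4 ≤ 10 ^ 15 * D.logFactor (1 / η) ^ 5 := by
      gcongr <;> norm_num
    obtain ⟨f, B, hf, hp, hd, hw, hb, hB⟩ := D.exists_net_middle hne hη h0 h1
    exact ⟨f, B, hf, hp.trans (by gcongr), hd.trans (by gcongr), hw.trans hK, hb,
      hB.trans (by gcongr)⟩
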